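/- Let $r \ge 2$ be an integer. For $n \in \mathbb{N}$ let $$m_r(n) = \theta_r\, n^{2-\frac{2}{r+2}} (\log n)^{\frac{1}{\binom{r+1}{2}-1}}, \qquad \theta_r = \frac{r-1}{2r}\left[ r \left(\frac{2r+2}{r+2}\right)^{\frac{1}{r-1}} \right]^{\frac{2}{r+2}}.$$ An $r$-coloring $\Pi = \{V_1, \dots, V_r\}$ of $[n] = \{1,\dots,n\}$ is a partition of $[n]$ into $r$ (possibly empty) color classes. It is identified with the complete $r$-partite graph on $[n]$ with these classes, $e(\Pi)$ is the number of edges of this graph, and $e(G \setminus \Pi)$ is the number of monochromatic edges of a graph $G$ on $[n]$, i.e. edges with both endpoints in the same class. For $\gamma > 0$ let $\mathcal{P}_{n,r}(\gamma)$ be the set of all $r$-colorings with $(\frac1r - \gamma) n \le |V_i| \le (\frac1r + \gamma) n$ for all $i$. For $\gamma, \delta > 0$ and $\Pi \in \mathcal{P}_{n,r}(\gamma)$ let $\mathcal{F}^*_{n,m}(K_{r+1};\delta,\gamma,\Pi)$ be the set of all $K_{r+1}$-free graphs $G$ on $[n]$ with exactly $m$ edges such that 1. every $r$-coloring $\Pi'$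 of $[n]$ with $e(G \setminus \Pi') \le \delta m$ belongs to $\mathcal{P}_{n,r}(\gamma)$; 2. $e(G \setminus \Pi) \le \delta m$; 3. $\deg_G(v, V_i) \le \deg_G(v, V_j)$ for all $i \neq j$ and all $v \in V_i$, where $\deg_G(v,A)$ is the number of neighbors of $v$ in $A$; 4. $e(G \setminus \Pi) > 0$, i.e. $\Pi$ is not a proper coloring of $G$. **Theorem.** For every integer $r \ge 2$ and every $\varepsilon > 0$, there exist a constant $\gamma > 0$ and a function $\omega \colon \mathbb{N} \to (0,\infty)$ with $\omega(n) \to \infty$ as $n \to \infty$ such that the following holds for all sufficiently small $\delta > 0$. For every $n$ and every $m \ge (1+\varepsilon) m_r(n)$, $$|\mathcal{F}^*_{n,m}(K_{r+1};\delta,\gamma,\Pi)| \le \frac{1}{\omega(n)} \binom{e(\Pi)}{m} \qquad \text{for every } \Pi \in \mathcal{P}_{n,r}(\gamma).$$ -/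

import Mathlib

open Filter

/-- `θ_r = (r-1)/(2r) * [r * ((2r+2)/(r+2))^(1/(r-1))]^(2/(r+2))`. -/
noncomputable def thetaConst (r : ℕ) : ℝ :=
  ((r : ℝ) - 1) / (2 * r) *
    ((r : ℝ) * ((2 * (r : ℝ) + 2) / ((r : ℝ) + 2)) ^ (1 / ((r : ℝ) - 1))) ^ (2 / ((r : ℝ) + 2))

/-- The threshold `m_r(n) = θ_r * n^(2 - 2/(r+2)) * (log n)^(1/(binom(r+1,2) - 1))`. -/
noncomputable def mThreshold (r n : ℕ) : ℝ :=
  thetaConst r * (n : ℝ) ^ (2 - 2 / ((r : ℝ) + 2)) *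
    (Real.log n) ^ (1 / (((r + 1).choose 2 : ℝ) - 1))

/-- `e(G)`, the number of edges of `G`. -/
noncomputable def numEdges {n : ℕ} (G : SimpleGraph (Fin n)) : ℕ :=
  G.edgeSet.ncard

/-- An `r`-colouring `c : Fin n → Fin r` encodes the partition `Π = {V_1, …, V_r}` with classes
`V_i = c⁻¹(i)`. As a graph, `Π` is the complete `r`-partite graph with these colour classes: two
vertices are adjacent if and only if their colours differ. -/
def partitionGraph {n r : ℕ} (c : Fin n → Fin r) : SimpleGraph (Fin n) :=
  (⊤ : SimpleGraph (Fin r)).comap c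

/-- Membership in `P_{n,r}(γ)`: every colour class has between `(1/r - γ) n` and `(1/r + γ) n`
elements. -/
def IsBalanced {n r : ℕ} (γ : ℝ) (c : Fin n → Fin r) : Prop :=
  ∀ i : Fin r,
    (1 / (r : ℝ) - γ) * n ≤ ({v | c v = i} : Set (Fin n)).ncard ∧
      (({v | c v = i} : Set (Fin n)).ncard : ℝ) ≤ (1 / (r : ℝ) + γ) * n

/-- `e(G \ Π) ≤ δ m`: at most `δ m` edges of `G` are monochromatic in the colouring. -/
def FewMonochromatic {n r : ℕ} (m : ℕ) (δ : ℝ) (G : SimpleGraph (Fin n)) (c : Fin n → Fin r) :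
    Prop :=
  (numEdges (G \ partitionGraph c) : ℝ) ≤ δ * m

/-- `deg_G(v, V_j)`, the number of neighbours of `v` in the `j`th colour class. -/
noncomputable def degInClass {n r : ℕ} (G : SimpleGraph (Fin n)) (c : Fin n → Fin r)
    (v : Fin n) (j : Fin r) : ℕ :=
  ({w | G.Adj v w ∧ c w = j} : Set (Fin n)).ncard

/-- Each vertex has at least as many neighbours in every other colour class as in its own. -/
def IsUnfriendly {n r : ℕ} (G : SimpleGraph (Fin n)) (c : Fin n → Fin r) : Prop :=
  ∀ (v : Fin n) (j : Fin r), j ≠ c v → degInClass G c v (c v) ≤ degInClass G c v j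

/-- `F_{n,m}(K_{r+1})`: the `K_{r+1}`-free graphs on `n` labelled vertices with `m` edges. -/
def cliqueFreeFamily (n m r : ℕ) : Set (SimpleGraph (Fin n)) :=
  {G | numEdges G = m ∧ G.CliqueFree (r + 1)}

/-- `F_{n,m}(K_{r+1}; δ, γ)`: those graphs in `F_{n,m}(K_{r+1})` for which some `γ`-balanced
`r`-colouring makes at most `δ m` edges monochromatic, and no `r`-colouring that is not
`γ`-balanced does so. -/
def almostColorableFamily (n m r : ℕ) (δ γ : ℝ) : Set (SimpleGraph (Fin n)) :=
  {G | G ∈ cliqueFreeFamily n m r ∧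
    (∃ c : Fin n → Fin r, IsBalanced γ c ∧ FewMonochromatic m δ G c) ∧
    ¬ ∃ c : Fin n → Fin r, ¬ IsBalanced γ c ∧ FewMonochromatic m δ G c}

/-- `F_{n,m}(K_{r+1}; δ, γ, Π)`. -/
def familyOfPartition {n r : ℕ} (m : ℕ) (δ γ : ℝ) (c : Fin n → Fin r) :
    Set (SimpleGraph (Fin n)) :=
  {G | G ∈ almostColorableFamily n m r δ γ ∧ FewMonochromatic m δ G c ∧ IsUnfriendly G c}

/-- `F*_{n,m}(K_{r+1}; δ, γ, Π)`: the graphs in `F_{n,m}(K_{r+1}; δ, γ, Π)` with at least one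
monochromatic edge, i.e. not properly coloured by `Π`. -/
def starFamilyOfPartition {n r : ℕ} (m : ℕ) (δ γ : ℝ) (c : Fin n → Fin r) :
    Set (SimpleGraph (Fin n)) :=
  {G | G ∈ familyOfPartition m δ γ c ∧ 0 < numEdges (G \ partitionGraph c)}

/-!
A graph `G` is split into the set `T` of its monochromatic pairs and the set `H` of its crossing
pairs with respect to the colouring `c`. The claim is that the pairs `(T, H)` with `T` nonempty are
rare in comparison with the `m`-subsets of the `N` crossing pairs. The argument uses two features of
`G` (`IsBadPair`): no pair of `T` completes a `K_{r+1}` together with `H`, and each vertex has at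
least as many neighbours in every other class as in its own.

**The threshold.** A pair of `T` lies in about `k ^ (r - 1)` potential copies of `K_{r+1}` whose
other `e = (r + 1).choose 2 - 1` pairs are crossing, where `k` is the least size of a class. If `H`
has density `p`, then `μ = k ^ (r - 1) * p ^ e` of them are expected to be present, and if copies
were independent, `H` would avoid them all with probability `exp (-μ)` per pair of `T`. On the other
side, exchanging crossing pairs for monochromatic ones gives about `n ^ 2 * p` choices per pair of
`T`. So the pairs are rare once `μ > log (n ^ 2 * p)`. At `m = m_r(n)` one has
`μ = (2 - 2 / (r + 2)) * log n`, and `n ^ 2 * p` is `n ^ (2 - 2 / (r + 2))` up to powers of `log n`: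
this is `mThreshold_pow`, and `expected_copies_ge` and `eventually_log_weight_le` give the room that
the factor `1 + ε` leaves. A power of `n` is gained, and it serves as `ω n`.

**Sparse case.** Independence is replaced by Janson's inequality (`card_powersetCard_avoid_le`),
which is nearly sharp for the copies on the pairs of a graph that has few pairs, `n ^ 2 * p / log n`,
and small degrees, `n * p / log n` (`card_avoid_rooted_le`, `eventually_rooted_conditions`). It is
applied to a maximal such subgraph `T'` of `T`. If `T'` has the largest number of pairs allowed, the
gain `exp (-c * n ^ 2 * p)` outweighs the number of all sets `T` of at most `δ * m` pairs. If not,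
every other pair of `T` meets one of the few vertices of full degree in `T'`, so `T` has a cheap
description (`HasCover`, `sum_pow_card_hasCover_le`), as long as few vertices have degree at least
`2 * d` in `T`, where `d` is a small multiple of `n * p`.

A vertex of degree at least `d` in `T` has at least `d` neighbours in each class, and between these
neighbourhoods `H` has no `K_r`. For nearly all `H`, at most a proportion `exp (-K * n * p)` of the
`r`-tuples of `d`-sets has no `K_r` across it (`eventually_card_atypical_le`); this is shown by
bounding a moment of order proportional to `n`, exposing one tuple at a time
(`card_many_cliqueFreeTuples_le`). Hence the neighbourhoods of vertices of high degree have very few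
choices (`card_high_degree_le`), which pays for the case of many such vertices.

**Dense case.** If `H` contains almost all crossing pairs, then each pair of `T` has an end that
misses linearly many crossing pairs. These missing pairs outnumber `T`, so that `H` has many fewer
missing pairs elsewhere than a typical `m`-set, and a crude count suffices (`card_dense_le`).
-/

/-! ### Random subsets and Janson's inequality -/

/-- The weight of `S` under the product measure on subsets of `β` that contains each element
independently with probability `p`. -/
noncomputable def bernWeight {β : Type*} [Fintype β] [DecidableEq β] (p : ℝ) (S : Finset β) : ℝ :=
  ∏ b, if b ∈ S then p else 1 - p

/-- The expectation of `f` over the `p`-random subset of `β`. -/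
noncomputable def bernExp {β : Type*} [Fintype β] [DecidableEq β] (p : ℝ)
    (f : Finset β → ℝ) : ℝ :=
  ∑ S, bernWeight p S * f S

section Bernoulli

variable {β : Type*} [Fintype β] [DecidableEq β] {p : ℝ}

lemma bernWeight_nonneg (h0 : 0 ≤ p) (h1 : p ≤ 1) (S : Finset β) : 0 ≤ bernWeight p S := by
  refine Finset.prod_nonneg fun b _ => ?_
  split_ifs <;> linarith

lemma bernWeight_eq (S : Finset β) :
    bernWeight p S = p ^ S.card * (1 - p) ^ (Fintype.card β - S.card) := by
  unfold bernWeight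
  rw [Finset.prod_ite, Finset.prod_const, Finset.prod_const, ← Finset.card_compl]
  congr 3
  · ext; simp
  · ext; simp

/-- The product measure is log-supermodular, as the FKG inequality requires. -/
lemma bernWeight_mul (S T : Finset β) :
    bernWeight p S * bernWeight p T ≤ bernWeight p (S ⊓ T) * bernWeight p (S ⊔ T) := by
  unfold bernWeight
  rw [← Finset.prod_mul_distrib, ← Finset.prod_mul_distrib]
  refine le_of_eq (Finset.prod_congr rfl fun b _ => ?_)
  by_cases h1 : b ∈ S <;> by_cases h2 : b ∈ T <;> simp [h1, h2, mul_comm]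

lemma sum_bernWeight : ∑ S : Finset β, bernWeight p S = 1 := by
  have h := Fintype.sum_pow_mul_eq_add_pow β p (1 - p)
  simp only [add_sub_cancel, one_pow] at h
  rw [← h]
  exact Finset.sum_congr rfl fun S _ => bernWeight_eq S

lemma bernExp_mono (h0 : 0 ≤ p) (h1 : p ≤ 1) {f g : Finset β → ℝ} (h : ∀ S, f S ≤ g S) :
    bernExp p f ≤ bernExp p g :=
  Finset.sum_le_sum fun S _ => mul_le_mul_of_nonneg_left (h S) (bernWeight_nonneg h0 h1 S)

lemma bernExp_nonneg (h0 : 0 ≤ p) (h1 : p ≤ 1) {f : Finset β → ℝ} (h : ∀ S, 0 ≤ f S) :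
    0 ≤ bernExp p f :=
  Finset.sum_nonneg fun S _ => mul_nonneg (bernWeight_nonneg h0 h1 S) (h S)

lemma bernExp_const (a : ℝ) : bernExp p (fun _ : Finset β => a) = a := by
  unfold bernExp
  rw [← Finset.sum_mul, sum_bernWeight, one_mul]

lemma bernExp_sub (f g : Finset β → ℝ) :
    bernExp p (fun S => f S - g S) = bernExp p f - bernExp p g := by
  simp [bernExp, mul_sub, Finset.sum_sub_distrib]

lemma bernExp_sum {ι : Type*} (I : Finset ι) (f : ι → Finset β → ℝ) :
    bernExp p (fun S => ∑ i ∈ I, f i S) = ∑ i ∈ I, bernExp p (f i) := by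
  simp only [bernExp, Finset.mul_sum]
  exact Finset.sum_comm

lemma bernExp_mul_left (a : ℝ) (f : Finset β → ℝ) :
    bernExp p (fun S => a * f S) = a * bernExp p f := by
  simp only [bernExp, Finset.mul_sum]
  exact Finset.sum_congr rfl fun S _ => by ring

/-- The event `b ∈ S` is independent of a function that does not depend on `b`. -/
lemma bernExp_mem_mul (b : β) (f : Finset β → ℝ) (hf : ∀ S, f (insert b S) = f S) :
    bernExp p (fun S => (if b ∈ S then 1 else 0) * f S) = p * bernExp p f := by
  have hsplit : ∀ g : Finset β → ℝ, ∑ S, g S =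
      ∑ S ∈ (Finset.univ.erase b).powerset, (g S + g (insert b S)) := by
    intro g
    rw [← Finset.powerset_univ, ← Finset.insert_erase (Finset.mem_univ b),
      Finset.sum_powerset_insert (Finset.notMem_erase _ _), Finset.sum_add_distrib,
      Finset.insert_erase (Finset.mem_univ b)]
  unfold bernExp
  rw [hsplit, hsplit, Finset.mul_sum]
  refine Finset.sum_congr rfl fun S hS => ?_
  have hb : b ∉ S := fun h => by simpa using Finset.mem_powerset.1 hS h
  have e1 : bernWeight p S = (1 - p) * ∏ x ∈ Finset.univ.erase b, if x ∈ S then p else 1 - p := by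
    rw [bernWeight, ← Finset.mul_prod_erase _ _ (Finset.mem_univ b), if_neg hb]
  have e2 : bernWeight p (insert b S) =
      p * ∏ x ∈ Finset.univ.erase b, if x ∈ S then p else 1 - p := by
    rw [bernWeight, ← Finset.mul_prod_erase _ _ (Finset.mem_univ b),
      if_pos (Finset.mem_insert_self _ _)]
    congr 1
    refine Finset.prod_congr rfl fun x hx => ?_
    simp [Finset.mem_insert, Finset.ne_of_mem_erase hx]
  have h3 := hf S
  rw [e1, e2]
  simp only [hb, if_false, Finset.mem_insert_self, if_true, h3]
  ring

/-- The event `A ⊆ S` is independent of a function that does not depend on `A`. -/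
lemma bernExp_subset_mul (A : Finset β) (f : Finset β → ℝ)
    (hf : ∀ b ∈ A, ∀ S, f (insert b S) = f S) :
    bernExp p (fun S => (if A ⊆ S then 1 else 0) * f S) = p ^ A.card * bernExp p f := by
  induction A using Finset.induction_on with
  | empty => simp
  | insert b A hb ih =>
    have := bernExp_mem_mul (p := p) b (fun S => (if A ⊆ S then 1 else 0) * f S) (by
      intro S
      rw [hf b (Finset.mem_insert_self _ _)]
      congr 2
      rw [eq_iff_iff]
      refine ⟨fun h x hx => ?_, fun h => h.trans (Finset.subset_insert _ _)⟩
      rcases Finset.mem_insert.1 (h hx) with rfl | h'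
      · exact absurd hx hb
      · exact h')
    rw [ih fun x hx => hf x (Finset.mem_insert_of_mem hx)] at this
    rw [Finset.card_insert_of_notMem hb, pow_succ', mul_assoc, ← this]
    congr 1
    ext S
    by_cases h1 : b ∈ S <;> by_cases h2 : A ⊆ S <;> simp [Finset.insert_subset_iff, h1, h2]

lemma bernExp_subset (A : Finset β) :
    bernExp p (fun S => if A ⊆ S then 1 else 0) = p ^ A.card := by
  have := bernExp_subset_mul (p := p) A (fun _ => 1) (by simp)
  simpa [bernExp_const] using this

/-- Harris' inequality for the increasing event `A ⊆ S` and a decreasing function. -/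
lemma bernExp_subset_mul_le (h0 : 0 ≤ p) (h1 : p ≤ 1) (A : Finset β) (g : Finset β → ℝ)
    (hg : Antitone g) (hg1 : ∀ S, g S ≤ 1) :
    bernExp p (fun S => (if A ⊆ S then 1 else 0) * g S) ≤ p ^ A.card * bernExp p g := by
  have h := fkg (μ := bernWeight p) (f := fun S : Finset β => if A ⊆ S then (1 : ℝ) else 0)
    (g := fun S => 1 - g S) (fun S => bernWeight_nonneg h0 h1 S)
    (fun S => by dsimp; split_ifs <;> norm_num) (fun S => by simpa using hg1 S)
    (fun S T hST => by
      dsimp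
      split_ifs with h1 h2 h2
      · rfl
      · exact absurd (h1.trans hST) h2
      · norm_num
      · rfl)
    (fun S T hST => sub_le_sub_left (hg hST) 1) bernWeight_mul
  rw [sum_bernWeight, one_mul] at h
  change bernExp p _ * bernExp p (fun S => 1 - g S) ≤ bernExp p _ at h
  rw [bernExp_subset, bernExp_sub, bernExp_const] at h
  have e : bernExp p (fun S => (if A ⊆ S then (1 : ℝ) else 0) * (1 - g S)) =
      p ^ A.card - bernExp p (fun S => (if A ⊆ S then 1 else 0) * g S) := by
    rw [← bernExp_subset (p := p) A, ← bernExp_sub]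
    simp only [mul_sub, mul_one]
  rw [e] at h
  linarith

variable {ι : Type*}

/-- The probability that the `p`-random subset contains none of the sets `K i`, `i ∈ I`. -/
noncomputable def avoidProb (p : ℝ) (K : ι → Finset β) (I : Finset ι) : ℝ :=
  bernExp p (fun S => if ∀ i ∈ I, ¬ K i ⊆ S then 1 else 0)

lemma avoidProb_nonneg (h0 : 0 ≤ p) (h1 : p ≤ 1) (K : ι → Finset β) (I : Finset ι) :
    0 ≤ avoidProb p K I :=
  bernExp_nonneg h0 h1 fun S => by split_ifs <;> norm_num

lemma avoidProb_anti (h0 : 0 ≤ p) (h1 : p ≤ 1) (K : ι → Finset β) {I J : Finset ι} (h : I ⊆ J) :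
    avoidProb p K J ≤ avoidProb p K I :=
  bernExp_mono h0 h1 fun S => by
    split_ifs with h1 h2
    · rfl
    · exact absurd (fun i hi => h1 i (h hi)) h2
    · norm_num
    · rfl

/-- The effect of one more set on the probability of avoiding: the sets disjoint from `K a` are
independent of it, and Harris' inequality bounds the contribution of the others. -/
lemma avoidProb_insert_le [DecidableEq ι] (h0 : 0 ≤ p) (h1 : p ≤ 1) (K : ι → Finset β)
    (I : Finset ι) (a : ι) :
    avoidProb p K (insert a I) ≤ avoidProb p K I * Real.exp (-(p ^ (K a).card) +
      ∑ j ∈ I.filter (fun j => ¬ Disjoint (K a) (K j)), p ^ (K a ∪ K j).card) := by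
  set I0 := I.filter (fun j => Disjoint (K a) (K j)) with hI0
  set I1 := I.filter (fun j => ¬ Disjoint (K a) (K j)) with hI1
  set g0 : Finset β → ℝ := fun S => if ∀ i ∈ I0, ¬ K i ⊆ S then 1 else 0 with hg0
  set g : Finset β → ℝ := fun S => if ∀ i ∈ I, ¬ K i ⊆ S then 1 else 0 with hg
  have hanti : Antitone g0 := by
    intro S T hST
    simp only [hg0]
    split_ifs with h1 h2
    · rfl
    · exact absurd (fun i hi h => h1 i hi (h.trans hST)) h2
    · norm_num
    · rfl
  have hind : bernExp p (fun S => (if K a ⊆ S then 1 else 0) * g0 S) =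
      p ^ (K a).card * avoidProb p K I0 := by
    refine bernExp_subset_mul _ _ fun b hb S => ?_
    simp only [hg0]
    congr 1
    rw [eq_iff_iff]
    refine forall₂_congr fun i hi => not_congr ?_
    have hbi : b ∉ K i := fun h =>
      Finset.disjoint_left.1 (Finset.mem_filter.1 hi).2 hb h
    exact ⟨fun h => (Finset.subset_insert_iff_of_notMem hbi).1 h,
      fun h => h.trans (Finset.subset_insert _ _)⟩
  have hmain : avoidProb p K (insert a I) =
      avoidProb p K I - bernExp p (fun S => (if K a ⊆ S then 1 else 0) * g S) := by
    unfold avoidProb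
    rw [← bernExp_sub]
    congr 1
    ext S
    by_cases h1 : K a ⊆ S <;> by_cases h2 : ∀ i ∈ I, ¬ K i ⊆ S <;> simp [hg, h1, h2]
  -- union bound: avoiding `I0` but not `I` means containing some `K j` with `j ∈ I1`
  have hlow : bernExp p (fun S => (if K a ⊆ S then 1 else 0) * g0 S) -
      ∑ j ∈ I1, bernExp p (fun S => (if K a ∪ K j ⊆ S then 1 else 0) * g0 S) ≤
      bernExp p (fun S => (if K a ⊆ S then 1 else 0) * g S) := by
    rw [← bernExp_sum, ← bernExp_sub]
    refine bernExp_mono h0 h1 fun S => ?_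
    have hnn : ∀ j ∈ I1, 0 ≤ (if K a ∪ K j ⊆ S then (1 : ℝ) else 0) * g0 S := by
      intro j _
      simp only [hg0]
      split_ifs <;> norm_num
    have hsn := Finset.sum_nonneg hnn
    by_cases hK : K a ⊆ S
    · by_cases h2 : ∀ i ∈ I0, ¬ K i ⊆ S
      · by_cases h3 : ∀ i ∈ I, ¬ K i ⊆ S
        · have e1 : g0 S = 1 := if_pos h2
          have e2 : g S = 1 := if_pos h3
          rw [if_pos hK, e2]
          rw [e1] at hsn ⊢
          linarith
        · push Not at h3
          obtain ⟨j, hj, hjS⟩ := h3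
          have hj1 : j ∈ I1 := by
            refine Finset.mem_filter.2 ⟨hj, fun hd => h2 j (Finset.mem_filter.2 ⟨hj, hd⟩) hjS⟩
          have := Finset.single_le_sum hnn hj1
          rw [if_pos (Finset.union_subset hK hjS)] at this
          have h4 : 0 ≤ g S := by simp only [hg]; split_ifs <;> norm_num
          rw [if_pos hK]
          linarith
      · have e1 : g0 S = 0 := if_neg h2
        have h4 : 0 ≤ g S := by simp only [hg]; split_ifs <;> norm_num
        rw [e1] at hsn ⊢
        rw [if_pos hK]
        linarith
    · rw [if_neg hK]
      linarith
  have hup : ∀ j ∈ I1, bernExp p (fun S => (if K a ∪ K j ⊆ S then 1 else 0) * g0 S) ≤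
      p ^ (K a ∪ K j).card * avoidProb p K I0 := fun j _ =>
    bernExp_subset_mul_le h0 h1 _ _ hanti fun S => by simp only [hg0]; split_ifs <;> norm_num
  have hsum := Finset.sum_le_sum hup
  rw [← Finset.sum_mul] at hsum
  set s := ∑ j ∈ I1, p ^ (K a ∪ K j).card with hs
  have hQ0 := avoidProb_nonneg h0 h1 K I0
  have hQ := avoidProb_nonneg h0 h1 K I
  have hQQ := avoidProb_anti h0 h1 K (Finset.filter_subset (fun j => Disjoint (K a) (K j)) I)
  have hpos : 0 ≤ bernExp p (fun S => (if K a ⊆ S then 1 else 0) * g S) :=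
    bernExp_nonneg h0 h1 fun S => by simp only [hg]; split_ifs <;> norm_num
  have hkey : avoidProb p K I * (p ^ (K a).card - s) ≤
      bernExp p (fun S => (if K a ⊆ S then 1 else 0) * g S) := by
    rcases le_total 0 (p ^ (K a).card - s) with h | h
    · have := mul_le_mul_of_nonneg_right hQQ h
      nlinarith
    · nlinarith [mul_nonneg hQ (neg_nonneg.2 h)]
  have hexp := Real.add_one_le_exp (-(p ^ (K a).card) + s)
  nlinarith [mul_le_mul_of_nonneg_left hexp hQ]

/-- **Janson's inequality.** -/
lemma avoidProb_le_exp [DecidableEq ι] (h0 : 0 ≤ p) (h1 : p ≤ 1) (K : ι → Finset β)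
    (I : Finset ι) :
    avoidProb p K I ≤ Real.exp (-(∑ i ∈ I, p ^ (K i).card) +
      (∑ i ∈ I, ∑ j ∈ I,
        if i ≠ j ∧ ¬ Disjoint (K i) (K j) then p ^ (K i ∪ K j).card else 0) / 2) := by
  induction I using Finset.induction_on with
  | empty => simp [avoidProb, bernExp_const]
  | insert a I ha ih =>
    refine (avoidProb_insert_le h0 h1 K I a).trans
      ((mul_le_mul_of_nonneg_right ih (Real.exp_nonneg _)).trans ?_)
    rw [← Real.exp_add]
    refine Real.exp_le_exp.2 (le_of_eq ?_)
    have e1 : ∑ i ∈ I, ∑ j ∈ insert a I,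
        (if i ≠ j ∧ ¬ Disjoint (K i) (K j) then p ^ (K i ∪ K j).card else 0) =
        (∑ j ∈ I.filter (fun j => ¬ Disjoint (K a) (K j)), p ^ (K a ∪ K j).card) +
        ∑ i ∈ I, ∑ j ∈ I,
          (if i ≠ j ∧ ¬ Disjoint (K i) (K j) then p ^ (K i ∪ K j).card else 0) := by
      rw [Finset.sum_filter, ← Finset.sum_add_distrib]
      refine Finset.sum_congr rfl fun i hi => ?_
      rw [Finset.sum_insert ha]
      have hia : i ≠ a := fun h => ha (h ▸ hi)
      simp only [ne_eq, hia, not_false_eq_true, true_and, disjoint_comm, Finset.union_comm]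
    have e2 : ∑ j ∈ insert a I,
        (if a ≠ j ∧ ¬ Disjoint (K a) (K j) then p ^ (K a ∪ K j).card else 0) =
        ∑ j ∈ I.filter (fun j => ¬ Disjoint (K a) (K j)), p ^ (K a ∪ K j).card := by
      rw [Finset.sum_insert ha, Finset.sum_filter]
      simp only [ne_eq, not_true_eq_false, false_and, if_false, zero_add]
      refine Finset.sum_congr rfl fun i hi => ?_
      have hia : ¬ a = i := fun h => ha (h ▸ hi)
      simp [hia]
    rw [Finset.sum_insert ha, Finset.sum_insert ha, e1, e2]
    ring

/-- Janson's inequality with thinning. Some subfamily does at least as well as a `q`-random one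
does on average, so the main term may be scaled by `q` and the correlation term by `q ^ 2`. -/
lemma avoidProb_le_exp_thin {ι : Type*} [Fintype ι] [DecidableEq ι] (h0 : 0 ≤ p) (h1 : p ≤ 1)
    {q : ℝ} (hq0 : 0 ≤ q) (hq1 : q ≤ 1) (K : ι → Finset β) :
    avoidProb p K Finset.univ ≤ Real.exp (-(q * ∑ i, p ^ (K i).card) +
      q ^ 2 * (∑ i, ∑ j,
        if i ≠ j ∧ ¬ Disjoint (K i) (K j) then p ^ (K i ∪ K j).card else 0) / 2) := by
  set b : ι → ι → ℝ := fun i j =>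
    if i ≠ j ∧ ¬ Disjoint (K i) (K j) then p ^ (K i ∪ K j).card else 0 with hb
  set f : Finset ι → ℝ := fun J =>
    -(∑ i ∈ J, p ^ (K i).card) + (∑ i ∈ J, ∑ j ∈ J, b i j) / 2 with hf
  obtain ⟨J, -, hJ⟩ := Finset.exists_min_image (Finset.univ : Finset (Finset ι)) f
    ⟨∅, Finset.mem_univ _⟩
  have hle : f J ≤ bernExp q f := by
    have := bernExp_mono hq0 hq1 (f := fun _ => f J) (g := f) fun S => hJ S (Finset.mem_univ _)
    rwa [bernExp_const] at this
  have hE : bernExp q f = -(q * ∑ i, p ^ (K i).card) + q ^ 2 * (∑ i, ∑ j, b i j) / 2 := by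
    have hf' : f = fun J => (∑ i, (if {i} ⊆ J then 1 else 0) * -(p ^ (K i).card)) -
        ∑ i, ∑ j, (-(b i j) / 2) * (if {i, j} ⊆ J then 1 else 0) := by
      ext J
      have s1 : ∀ g : ι → ℝ, ∑ i ∈ J, g i = ∑ i, if i ∈ J then g i else 0 := fun g => by simp
      simp only [hf, s1, Finset.singleton_subset_iff, Finset.insert_subset_iff]
      rw [sub_eq_add_neg, ← Finset.sum_neg_distrib, Finset.sum_div, ← Finset.sum_neg_distrib]
      congr 1
      · refine Finset.sum_congr rfl fun i _ => ?_
        split_ifs <;> simp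
      · refine Finset.sum_congr rfl fun i _ => ?_
        by_cases hi : i ∈ J
        · simp only [hi, if_true, true_and]
          rw [Finset.sum_div, ← Finset.sum_neg_distrib]
          refine Finset.sum_congr rfl fun j _ => ?_
          split_ifs <;> ring
        · simp [hi]
    rw [hf', bernExp_sub, bernExp_sum, bernExp_sum]
    have e1 : ∀ i, bernExp q (fun J : Finset ι => (if {i} ⊆ J then (1 : ℝ) else 0) *
        -(p ^ (K i).card)) = -(q * p ^ (K i).card) := by
      intro i
      rw [bernExp_subset_mul _ (fun _ => -(p ^ (K i).card)) (by simp), bernExp_const]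
      simp
    have e2 : ∀ i, bernExp q (fun J : Finset ι => ∑ j, (-(b i j) / 2) *
        (if {i, j} ⊆ J then (1 : ℝ) else 0)) = ∑ j, -(q ^ 2 * b i j / 2) := by
      intro i
      rw [bernExp_sum]
      refine Finset.sum_congr rfl fun j _ => ?_
      rw [bernExp_mul_left, bernExp_subset]
      by_cases hij : i = j
      · simp [hb, hij]
      · rw [Finset.card_pair hij]; ring
    simp only [e1, e2, Finset.sum_neg_distrib, Finset.mul_sum, Finset.sum_div]
    ring
  refine (avoidProb_anti h0 h1 K (Finset.subset_univ J)).trans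
    ((avoidProb_le_exp h0 h1 K J).trans (Real.exp_le_exp.2 ?_))
  rw [← hE]
  exact hle

lemma sum_bernWeight_card : ∑ S : Finset β, bernWeight p S * (S.card : ℝ) = p * Fintype.card β := by
  have h : ∀ S : Finset β, (S.card : ℝ) = ∑ b, (if {b} ⊆ S then (1 : ℝ) else 0) := by
    intro S
    simp [Finset.singleton_subset_iff]
  have : bernExp p (fun S : Finset β => (S.card : ℝ)) = p * Fintype.card β := by
    simp_rw [h]
    rw [bernExp_sum]
    simp only [bernExp_subset, Finset.card_singleton, pow_one, Finset.sum_const, Finset.card_univ,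
      nsmul_eq_mul, mul_comm]
  exact this

/-- A decreasing property is at most as likely for a uniform `M`-subset as for a sparser binomial
random subset, up to a constant factor: by the local LYM inequality the proportion of the `k`-sets
with the property decreases with `k`, and the binomial set has at most `M` elements with probability
at least `η`. -/
lemma card_slice_le_avoidProb {ι : Type*} (h0 : 0 ≤ p) (h1 : p ≤ 1) {η : ℝ} (hη : 0 < η) (M : ℕ)
    (hp : p * Fintype.card β ≤ (1 - η) * (M + 1)) (K : ι → Finset β) (I : Finset ι) :
    (((Finset.univ.powersetCard M).filter (fun S => ∀ i ∈ I, ¬ K i ⊆ S)).card : ℝ) ≤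
      η⁻¹ * (Fintype.card β).choose M * avoidProb p K I := by
  set N := Fintype.card β with hN
  set a : ℕ → Finset (Finset β) := fun k =>
    (Finset.univ.powersetCard k).filter (fun S => ∀ i ∈ I, ¬ K i ⊆ S) with ha
  have hanti : Antitone fun k => ((a k).card : ℝ) / N.choose k := by
    refine antitone_nat_of_succ_le fun k => ?_
    have hs : ((a (k + 1) : Finset (Finset β)) : Set (Finset β)).Sized (k + 1) := by
      intro S hS
      simp only [ha, Finset.coe_filter, Finset.mem_powersetCard, Set.mem_ofPred_eq] at hS
      exact hS.1.2
    have := Finset.local_lubell_yamamoto_meshalkin_inequality_div (𝕜 := ℝ) (Nat.succ_ne_zero k) hs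
    refine this.trans ?_
    have hsub : (a (k + 1)).shadow ⊆ a k := by
      intro S hS
      obtain ⟨T, hT, b, hb, rfl⟩ := Finset.mem_shadow_iff.1 hS
      simp only [ha, Finset.mem_filter, Finset.mem_powersetCard, Finset.subset_univ, true_and]
        at hT ⊢
      refine ⟨by rw [Finset.card_erase_of_mem hb, hT.1]; rfl, fun i hi h => hT.2 i hi
        (h.trans (Finset.erase_subset _ _))⟩
    simp only [Nat.succ_eq_add_one, Nat.add_sub_cancel]
    gcongr
  rcases lt_or_ge N M with hNM | hNM
  · have : a M = ∅ := by
      refine Finset.filter_eq_empty_iff.2 fun S hS => ?_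
      rw [Finset.powersetCard_eq_empty.2 (by simpa [hN] using hNM)] at hS
      simp at hS
    change ((a M).card : ℝ) ≤ _
    rw [this]
    have := avoidProb_nonneg h0 h1 K I
    simp only [Finset.card_empty, Nat.cast_zero]
    positivity
  set ρ := ((a M).card : ℝ) / N.choose M with hρ
  have hρ0 : 0 ≤ ρ := by positivity
  have hC : (0 : ℝ) < N.choose M := by exact_mod_cast Nat.choose_pos hNM
  -- Markov's inequality for the size of the random set
  have htail : η ≤ ∑ S : Finset β, bernWeight p S * (if S.card ≤ M then 1 else 0) := by
    have hM : (0 : ℝ) < M + 1 := by positivity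
    have h2 : ∀ S : Finset β, bernWeight p S * 1 - bernWeight p S * (S.card : ℝ) / (M + 1) ≤
        bernWeight p S * (if S.card ≤ M then 1 else 0) := by
      intro S
      have hw := bernWeight_nonneg h0 h1 S
      rw [mul_div_assoc, ← mul_sub]
      refine mul_le_mul_of_nonneg_left ?_ hw
      split_ifs with h
      · have : 0 ≤ (S.card : ℝ) / (M + 1) := by positivity
        linarith
      · have : (M : ℝ) + 1 ≤ S.card := by exact_mod_cast not_le.1 h
        rw [sub_nonpos, le_div_iff₀ hM]
        linarith
    refine le_trans ?_ (Finset.sum_le_sum fun S _ => h2 S)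
    rw [Finset.sum_sub_distrib, ← Finset.sum_div, sum_bernWeight_card]
    simp only [mul_one, sum_bernWeight]
    have : p * (Fintype.card β : ℝ) / (M + 1) ≤ 1 - η := by
      rw [div_le_iff₀ hM]; exact hp
    linarith
  have hcmp : ρ * ∑ S : Finset β, bernWeight p S * (if S.card ≤ M then 1 else 0) ≤
      avoidProb p K I := by
    unfold avoidProb bernExp
    rw [← Finset.powerset_univ, Finset.sum_powerset, Finset.sum_powerset, Finset.mul_sum]
    refine Finset.sum_le_sum fun k hk => ?_
    have e1 : ∑ S ∈ Finset.univ.powersetCard k, bernWeight p S *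
        (if ∀ i ∈ I, ¬ K i ⊆ S then 1 else 0) =
        (a k).card * (p ^ k * (1 - p) ^ (N - k)) := by
      simp only [mul_ite, mul_one, mul_zero]
      rw [← Finset.sum_filter, ← nsmul_eq_mul]
      refine Finset.sum_eq_card_nsmul fun S hS => ?_
      rw [bernWeight_eq, (Finset.mem_powersetCard.1 (Finset.mem_filter.1 hS).1).2]
    have e2 : ∑ S ∈ (Finset.univ : Finset β).powersetCard k, bernWeight p S *
        (if S.card ≤ M then 1 else 0) =
        (if k ≤ M then 1 else 0) * (N.choose k * (p ^ k * (1 - p) ^ (N - k))) := by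
      have : ∀ S ∈ (Finset.univ : Finset β).powersetCard k, bernWeight p S *
        (if S.card ≤ M then 1 else 0) =
          (if k ≤ M then 1 else 0) * (p ^ k * (1 - p) ^ (N - k)) := by
        intro S hS
        rw [bernWeight_eq, (Finset.mem_powersetCard.1 hS).2, mul_comm]
      rw [Finset.sum_eq_card_nsmul this, Finset.card_powersetCard, nsmul_eq_mul,
        Finset.card_univ]
      ring
    rw [e1, e2]
    have hw : 0 ≤ p ^ k * (1 - p) ^ (N - k) :=
      mul_nonneg (pow_nonneg h0 _) (pow_nonneg (sub_nonneg.2 h1) _)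
    split_ifs with hkM
    · have hkN : (0 : ℝ) < N.choose k := by exact_mod_cast Nat.choose_pos (hkM.trans hNM)
      have := hanti hkM
      dsimp only at this
      rw [one_mul, ← mul_assoc]
      refine mul_le_mul_of_nonneg_right ?_ hw
      rw [le_div_iff₀ hkN] at this
      exact this
    · rw [zero_mul, mul_zero]
      positivity
  have h3 : ρ * η ≤ avoidProb p K I := (mul_le_mul_of_nonneg_left htail hρ0).trans hcmp
  change ((a M).card : ℝ) ≤ _
  have h4 : ((a M).card : ℝ) = ρ * N.choose M := by rw [hρ]; field_simp
  rw [h4, mul_assoc, ← div_eq_inv_mul, le_div_iff₀ hη]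
  nlinarith [mul_le_mul_of_nonneg_left h3 hC.le]

end Bernoulli

/-- Janson's inequality for a uniformly random `M`-subset `H` of `E`, in counting form, for a family
of sets of the same size `e`. The hypothesis `hθ` bounds, for each set of the family, the total
weight of the other sets that meet it. -/
theorem card_powersetCard_avoid_le {β ι : Type*} [DecidableEq β] [DecidableEq ι] (E : Finset β)
    (M e : ℕ) {p q η θ : ℝ} (h0 : 0 ≤ p) (h1 : p ≤ 1) (hq0 : 0 ≤ q) (hq1 : q ≤ 1) (hη : 0 < η)
    (hp : p * E.card ≤ (1 - η) * (M + 1)) (I : Finset ι) (K : ι → Finset β)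
    (hK : ∀ i ∈ I, K i ⊆ E) (hKe : ∀ i ∈ I, (K i).card = e)
    (hθ : ∀ i ∈ I, q * ∑ j ∈ I.filter (fun j => i ≠ j ∧ ¬ Disjoint (K i) (K j)),
      p ^ (e - (K i ∩ K j).card) ≤ θ) :
    (((E.powersetCard M).filter (fun H => ∀ i ∈ I, ¬ K i ⊆ H)).card : ℝ) ≤
      η⁻¹ * E.card.choose M * Real.exp (-((1 - θ / 2) * (q * I.card * p ^ e))) := by
  obtain ⟨K', hK'⟩ : ∃ K' : I → Finset E, K' = fun i : I => (K i).subtype (· ∈ E) := ⟨_, rfl⟩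
  have hmem : ∀ i ∈ I, ∀ x ∈ K i, x ∈ E := fun i hi x hx => hK i hi hx
  have hcard : ∀ s : Finset β, s ⊆ E → (s.subtype (· ∈ E)).card = s.card := by
    intro s hs
    rw [Finset.card_subtype, Finset.filter_true_of_mem fun x hx => hs hx]
  have hstep1 : ((E.powersetCard M).filter (fun H => ∀ i ∈ I, ¬ K i ⊆ H)).card ≤
      (((Finset.univ : Finset E).powersetCard M).filter
        (fun S => ∀ i ∈ (Finset.univ : Finset I), ¬ K' i ⊆ S)).card := by
    refine Finset.card_le_card_of_injOn (fun H => H.subtype (· ∈ E)) ?_ ?_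
    · intro H hH
      simp only [Finset.coe_filter, Finset.mem_powersetCard, Set.mem_ofPred_eq] at hH ⊢
      refine ⟨⟨Finset.subset_univ _, by rw [hcard H hH.1.1, hH.1.2]⟩, fun i _ hi => ?_⟩
      refine hH.2 i i.2 fun x hx => ?_
      have := hi (show (⟨x, hmem i i.2 x hx⟩ : E) ∈ K' i by rw [hK']; exact Finset.mem_subtype.2 hx)
      simpa using this
    · intro H hH H' hH' hHH
      simp only [Finset.coe_filter, Finset.mem_powersetCard, Set.mem_ofPred_eq] at hH hH'
      ext x
      by_cases hx : x ∈ E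
      · have := congrArg (fun s => (⟨x, hx⟩ : E) ∈ s) hHH
        simpa using this
      · exact ⟨fun h => absurd (hH.1.1 h) hx, fun h => absurd (hH'.1.1 h) hx⟩
  have hN : Fintype.card E = E.card := Fintype.card_coe E
  have hstep2 := card_slice_le_avoidProb h0 h1 hη M (by rw [hN]; exact hp) K' Finset.univ
  have hstep3 := avoidProb_le_exp_thin h0 h1 hq0 hq1 K'
  have hKe' : ∀ i : I, (K' i).card = e := fun i => by rw [hK', hcard _ (hK i i.2), hKe i i.2]
  have hpe : 0 ≤ p ^ e := pow_nonneg h0 _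
  have hstep1' : (((E.powersetCard M).filter (fun H => ∀ i ∈ I, ¬ K i ⊆ H)).card : ℝ) ≤
      η⁻¹ * (Fintype.card E).choose M * avoidProb p K' Finset.univ := by
    refine le_trans (Nat.cast_le.2 hstep1) (le_trans (le_of_eq ?_) hstep2)
    congr!
  refine hstep1'.trans ?_
  rw [hN]
  refine mul_le_mul_of_nonneg_left (hstep3.trans (Real.exp_le_exp.2 ?_)) (by positivity)
  have hs1 : ∑ i, p ^ (K' i).card = I.card * p ^ e := by
    simp [hKe']
  have hs2 : ∀ i : I, q * (∑ j : I, if i ≠ j ∧ ¬ Disjoint (K' i) (K' j) then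
      p ^ (K' i ∪ K' j).card else 0) ≤ θ * p ^ e := by
    intro i
    refine le_trans (le_of_eq ?_) (mul_le_mul_of_nonneg_right (hθ i i.2) hpe)
    rw [mul_assoc, Finset.sum_mul, Finset.sum_filter, ← Finset.sum_coe_sort I]
    congr 1
    refine Finset.sum_congr rfl fun j _ => ?_
    have hd : Disjoint (K' i) (K' j) ↔ Disjoint (K i) (K j) := by
      rw [Finset.disjoint_left, Finset.disjoint_left, hK']
      refine ⟨fun h x hx hx' => ?_, fun h x hx hx' => ?_⟩
      · exact h (a := (⟨x, hmem i i.2 x hx⟩ : E)) (Finset.mem_subtype.2 hx)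
          (Finset.mem_subtype.2 hx')
      · exact h (Finset.mem_subtype.1 hx) (Finset.mem_subtype.1 hx')
    have hne : i ≠ j ↔ (i : ι) ≠ j := not_congr Subtype.ext_iff
    by_cases h : (i : ι) ≠ j ∧ ¬ Disjoint (K i) (K j)
    · rw [if_pos h, if_pos ⟨hne.2 h.1, fun h' => h.2 (hd.1 h')⟩, ← pow_add]
      congr 1
      have e1 : K' i ∪ K' j = (K i ∪ K j).subtype (· ∈ E) := by
        ext x; simp [hK']
      rw [e1, hcard _ (Finset.union_subset (hK i i.2) (hK j j.2))]
      have e2 := Finset.card_union_add_card_inter (K i) (K j)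
      have e3 : (K i ∩ K j).card ≤ e := by
        rw [← hKe i i.2]; exact Finset.card_le_card Finset.inter_subset_left
      rw [hKe i i.2, hKe j j.2] at e2
      omega
    · rw [if_neg h, if_neg fun h' => h ⟨hne.1 h'.1, fun h'' => h'.2 (hd.2 h'')⟩]
  have hs3 := Finset.sum_le_sum fun i (_ : i ∈ (Finset.univ : Finset I)) => hs2 i
  rw [← Finset.mul_sum] at hs3
  simp only [Finset.sum_const, Finset.card_univ, Fintype.card_coe, nsmul_eq_mul] at hs3
  rw [hs1]
  have h4 := mul_le_mul_of_nonneg_left hs3 hq0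
  have h5 : ∀ x : ℝ, q ^ 2 * x = q * (q * x) := fun x => by ring
  rw [h5]
  refine le_trans (add_le_add_right (div_le_div_of_nonneg_right h4 zero_le_two) _) (le_of_eq ?_)
  ring

/-! ### Transversals and copies of a clique rooted at a pair -/

section Transversals

variable {V : Type*} {r : ℕ} {c : V → Fin r}

lemma injective_of_transversal {w : Fin r → V} (hw : ∀ j, c (w j) = j) : Function.Injective w :=
  fun j k h => by rw [← hw j, ← hw k, h]

/-- The pairs with ends of different colours, that is, the edges of the complete multipartite graph
of the colouring. -/
def crossPairs [Fintype V] (c : V → Fin r) : Finset (Sym2 V) :=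
  Finset.univ.filter fun e => ¬ (Sym2.map c e).IsDiag

lemma mk_mem_crossPairs [Fintype V] {a b : V} : s(a, b) ∈ crossPairs c ↔ c a ≠ c b := by
  simp [crossPairs]

variable [DecidableEq V]

/-- The pairs `{w j, w k}` with distinct `j, k ∈ A`: the clique on the `A`-part of the
transversal `w`. -/
def pairsOn (w : Fin r → V) (A : Finset (Fin r)) : Finset (Sym2 V) :=
  A.offDiag.image fun x => s(w x.1, w x.2)

lemma mem_pairsOn {w : Fin r → V} {A : Finset (Fin r)} {e : Sym2 V} :
    e ∈ pairsOn w A ↔ ∃ j ∈ A, ∃ k ∈ A, j ≠ k ∧ s(w j, w k) = e := by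
  simp only [pairsOn, Finset.mem_image, Finset.mem_offDiag, Prod.exists]
  constructor
  · rintro ⟨j, k, ⟨hj, hk, hjk⟩, h⟩
    exact ⟨j, hj, k, hk, hjk, h⟩
  · rintro ⟨j, hj, k, hk, hjk, h⟩
    exact ⟨j, k, ⟨hj, hk, hjk⟩, h⟩

lemma pairsOn_eq_image (w : Fin r → V) (A : Finset (Fin r)) :
    pairsOn w A = (A.offDiag.image fun x => s(x.1, x.2)).image (Sym2.map w) := by
  rw [pairsOn, Finset.image_image]
  rfl

lemma card_pairsOn_le (w : Fin r → V) (A : Finset (Fin r)) :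
    (pairsOn w A).card ≤ A.card.choose 2 := by
  rw [pairsOn_eq_image]
  exact Finset.card_image_le.trans (Sym2.card_image_offDiag A).le

lemma card_pairsOn {w : Fin r → V} (hw : Function.Injective w) (A : Finset (Fin r)) :
    (pairsOn w A).card = A.card.choose 2 := by
  rw [pairsOn_eq_image, Finset.card_image_of_injective _ (Sym2.map.injective hw)]
  exact Sym2.card_image_offDiag A

/-- Two transversals span common pairs only on the colours where they agree. -/
lemma pairsOn_inter_subset {w w' : Fin r → V} (hw : ∀ j, c (w j) = j) (hw' : ∀ j, c (w' j) = j) :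
    pairsOn w Finset.univ ∩ pairsOn w' Finset.univ ⊆
      pairsOn w (Finset.univ.filter fun j => w j = w' j) := by
  intro e he
  obtain ⟨h1, h2⟩ := Finset.mem_inter.1 he
  obtain ⟨j, -, k, -, hjk, rfl⟩ := mem_pairsOn.1 h1
  obtain ⟨j', -, k', -, -, h⟩ := mem_pairsOn.1 h2
  have hc := congrArg (Sym2.map c) h
  simp only [Sym2.map_mk, hw, hw'] at hc
  refine mem_pairsOn.2 ⟨j, ?_, k, ?_, hjk, rfl⟩
  all_goals
    rw [Finset.mem_filter]
    refine ⟨Finset.mem_univ _, ?_⟩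
    rcases Sym2.eq_iff.1 hc with ⟨rfl, rfl⟩ | ⟨rfl, rfl⟩ <;>
    rcases Sym2.eq_iff.1 h with ⟨h3, h4⟩ | ⟨h3, h4⟩
  · exact h3.symm
  · exact absurd (by rw [← hw' j', h3, hw]) hjk
  · exact absurd (by rw [← hw' j', h3, hw]) hjk
  · exact h4.symm
  · exact h4.symm
  · exact absurd (by rw [← hw' j', h3, hw]) hjk
  · exact absurd (by rw [← hw' j', h3, hw]) hjk
  · exact h3.symm

/-- The pairs that the vertex `v` together with the transversal `w` contributes to a copy of
`K_{r+1}` in which the only monochromatic pair is `{w (c v), v}`. -/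
def rootedPairs (c : V → Fin r) (v : V) (w : Fin r → V) : Finset (Sym2 V) :=
  pairsOn w Finset.univ ∪ (Finset.univ.erase (c v)).image fun j => s(v, w j)

lemma card_rootedPairs {v : V} {w : Fin r → V} (hw : ∀ j, c (w j) = j) (hv : v ≠ w (c v)) :
    (rootedPairs c v w).card = r.choose 2 + (r - 1) := by
  have hwi := injective_of_transversal hw
  rw [rootedPairs, Finset.card_union_of_disjoint, card_pairsOn hwi, Finset.card_image_of_injOn,
    Finset.card_erase_of_mem (Finset.mem_univ _), Finset.card_univ, Fintype.card_fin]
  · intro j _ k _ h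
    rcases Sym2.eq_iff.1 h with ⟨-, h⟩ | ⟨h1, h2⟩
    · exact hwi h
    · exact hwi (h2.trans h1)
  · rw [Finset.disjoint_left]
    intro e h1 h2
    obtain ⟨j, -, k, -, hjk, rfl⟩ := mem_pairsOn.1 h1
    obtain ⟨l, hl, h⟩ := Finset.mem_image.1 h2
    rcases Sym2.eq_iff.1 h with ⟨h1, h2⟩ | ⟨h1, h2⟩
    · exact hv (by rw [h1, hw])
    · exact hv (by rw [h1, hw])

lemma pairsOn_subset_crossPairs [Fintype V] {w : Fin r → V} (hw : ∀ j, c (w j) = j)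
    (A : Finset (Fin r)) : pairsOn w A ⊆ crossPairs c := by
  intro e he
  obtain ⟨j, -, k, -, hjk, rfl⟩ := mem_pairsOn.1 he
  rwa [mk_mem_crossPairs, hw, hw]

lemma rootedPairs_subset_crossPairs [Fintype V] {v : V} {w : Fin r → V} (hw : ∀ j, c (w j) = j) :
    rootedPairs c v w ⊆ crossPairs c := by
  refine Finset.union_subset (pairsOn_subset_crossPairs hw _) fun e he => ?_
  obtain ⟨j, hj, rfl⟩ := Finset.mem_image.1 he
  rw [mk_mem_crossPairs, hw]
  exact (Finset.ne_of_mem_erase hj).symm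

lemma mem_of_mem_rootedPairs {v : V} {w : Fin r → V} {e : Sym2 V} (he : e ∈ rootedPairs c v w)
    {x : V} (hx : x ∈ e) : x ∈ insert v (Finset.univ.image w) := by
  rw [Finset.mem_insert, Finset.mem_image]
  rcases Finset.mem_union.1 he with h | h
  · obtain ⟨j, -, k, -, -, rfl⟩ := mem_pairsOn.1 h
    rcases Sym2.mem_iff.1 hx with rfl | rfl
    · exact Or.inr ⟨_, Finset.mem_univ _, rfl⟩
    · exact Or.inr ⟨_, Finset.mem_univ _, rfl⟩
  · obtain ⟨j, -, rfl⟩ := Finset.mem_image.1 h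
    rcases Sym2.mem_iff.1 hx with rfl | rfl
    · exact Or.inl rfl
    · exact Or.inr ⟨_, Finset.mem_univ _, rfl⟩

/-- The pairs of one rooted copy inside a vertex set `S`: if `a` of the vertices outside the root
edge and `b` of the two roots lie in `S`, there are at most `a(a-1)/2 + ab` of them. -/
lemma card_le_of_subset_rootedPairs {S : Finset V} {v : V} {w : Fin r → V} {F : Finset (Sym2 V)}
    (hF : F ⊆ rootedPairs c v w) (hS : ∀ e ∈ F, ∀ x ∈ e, x ∈ S) :
    F.card ≤
      (((Finset.univ.erase (c v)).filter fun j => w j ∈ S).card).choose 2 +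
      ((Finset.univ.erase (c v)).filter fun j => w j ∈ S).card *
        (({w (c v), v} : Finset V).filter (· ∈ S)).card := by
  set A := (Finset.univ.erase (c v)).filter fun j => w j ∈ S with hA
  set B := ({w (c v), v} : Finset V).filter (· ∈ S) with hB
  have hsub : F ⊆ pairsOn w A ∪ (A ×ˢ B).image fun x => s(x.2, w x.1) := by
    intro e he
    replace hS := hS e he
    rw [Finset.mem_union]
    rcases Finset.mem_union.1 (hF he) with h | h
    · obtain ⟨j, -, k, -, hjk, rfl⟩ := mem_pairsOn.1 h
      have hj := hS (w j) (Sym2.mem_mk_left _ _)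
      have hk := hS (w k) (Sym2.mem_mk_right _ _)
      by_cases h1 : j = c v
      · right
        refine Finset.mem_image.2 ⟨(k, w j), Finset.mem_product.2 ⟨?_, ?_⟩, rfl⟩
        · simp [hA, hk, ← h1, hjk.symm]
        · simp only [hB, Finset.mem_filter, Finset.mem_insert]
          exact ⟨Or.inl (by rw [h1]), hj⟩
      · by_cases h2 : k = c v
        · right
          refine Finset.mem_image.2 ⟨(j, w k), Finset.mem_product.2 ⟨?_, ?_⟩, Sym2.eq_swap⟩
          · simp [hA, hj, h1]
          · simp only [hB, Finset.mem_filter, Finset.mem_insert]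
            exact ⟨Or.inl (by rw [h2]), hk⟩
        · left
          exact mem_pairsOn.2 ⟨j, by simp [hA, hj, h1], k, by simp [hA, hk, h2], hjk, rfl⟩
    · obtain ⟨j, hj, rfl⟩ := Finset.mem_image.1 h
      right
      refine Finset.mem_image.2 ⟨(j, v), Finset.mem_product.2 ⟨?_, ?_⟩, rfl⟩
      · exact Finset.mem_filter.2 ⟨hj, hS _ (Sym2.mem_mk_right _ _)⟩
      · simp only [hB, Finset.mem_filter, Finset.mem_insert]
        exact ⟨Or.inr (Finset.mem_singleton.2 rfl), hS _ (Sym2.mem_mk_left _ _)⟩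
  refine (Finset.card_le_card hsub).trans ((Finset.card_union_le _ _).trans ?_)
  refine add_le_add (card_pairsOn_le _ _) (Finset.card_image_le.trans ?_)
  rw [Finset.card_product]

/-- Two rooted copies can only share pairs inside the vertex set of the first one. -/
lemma card_rootedPairs_inter_le (v v' : V) (w w' : Fin r → V) :
    (rootedPairs c v w ∩ rootedPairs c v' w').card ≤
      (((Finset.univ.erase (c v')).filter
        fun j => w' j ∈ insert v (Finset.univ.image w)).card).choose 2 +
      ((Finset.univ.erase (c v')).filter
        fun j => w' j ∈ insert v (Finset.univ.image w)).card *
        (({w' (c v'), v'} : Finset V).filter (· ∈ insert v (Finset.univ.image w))).card := by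
  refine card_le_of_subset_rootedPairs Finset.inter_subset_right fun e he x hx => ?_
  exact mem_of_mem_rootedPairs (Finset.mem_inter.1 he).1 hx

end Transversals

section RootedCopies

variable {V : Type*} {r : ℕ} {c : V → Fin r}

/-- The transversals through the first vertex of the monochromatic pair `f` whose other vertices
lie in the sets `U j`. The second vertex of `f` is the root, so the orientation of `f` fixes which
end the transversal uses. -/
def rootedTransversals (c : V → Fin r) (U : Fin r → Finset V) (f : V × V) :
    Finset (Fin r → V) :=
  Fintype.piFinset fun j => if j = c f.1 then {f.1} else U j

lemma mem_rootedTransversals {U : Fin r → Finset V} {f : V × V} {w : Fin r → V} :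
    w ∈ rootedTransversals c U f ↔ w (c f.1) = f.1 ∧ ∀ j, j ≠ c f.1 → w j ∈ U j := by
  rw [rootedTransversals, Fintype.mem_piFinset]
  constructor
  · intro h
    refine ⟨by simpa using h (c f.1), fun j hj => by simpa [hj] using h j⟩
  · rintro ⟨h1, h2⟩ j
    by_cases hj : j = c f.1
    · rw [if_pos hj, hj, h1]; exact Finset.mem_singleton_self _
    · rw [if_neg hj]; exact h2 j hj

lemma transversal_of_mem_rootedTransversals {U : Fin r → Finset V} (hU : ∀ j, ∀ v ∈ U j, c v = j)
    {f : V × V} {w : Fin r → V} (hw : w ∈ rootedTransversals c U f) (j : Fin r) : c (w j) = j := by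
  obtain ⟨h1, h2⟩ := mem_rootedTransversals.1 hw
  by_cases hj : j = c f.1
  · rw [hj, h1]
  · exact hU j _ (h2 j hj)

lemma card_rootedTransversals {U : Fin r → Finset V} {k : ℕ} (hUk : ∀ j, (U j).card = k)
    (f : V × V) : (rootedTransversals c U f).card = k ^ (r - 1) := by
  rw [rootedTransversals, Fintype.card_piFinset,
    ← Finset.mul_prod_erase _ _ (Finset.mem_univ (c f.1)),
    Finset.prod_congr rfl (g := fun _ => k), Finset.prod_const,
    Finset.card_erase_of_mem (Finset.mem_univ _), Finset.card_univ, Fintype.card_fin]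
  · simp
  · intro j hj
    rw [if_neg (Finset.ne_of_mem_erase hj), hUk]

variable [DecidableEq V]

/-- Few rooted transversals have their `A`-vertices in the vertex set of a given rooted copy. -/
lemma card_rootedTransversals_meet_le {U : Fin r → Finset V} {k : ℕ} (hU : ∀ j, ∀ v ∈ U j, c v = j)
    (hUk : ∀ j, (U j).card = k) (f : V × V) (v : V) {w : Fin r → V} (hw : ∀ j, c (w j) = j)
    {A : Finset (Fin r)} (hA : A ⊆ Finset.univ.erase (c f.1)) :
    ((rootedTransversals c U f).filter
      fun w' => ∀ j ∈ A, w' j ∈ insert v (Finset.univ.image w)).card ≤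
      2 ^ r * k ^ (r - 1 - A.card) := by
  have hsub : ((rootedTransversals c U f).filter
      fun w' => ∀ j ∈ A, w' j ∈ insert v (Finset.univ.image w)) ⊆
      Fintype.piFinset fun j => if j = c f.1 then {f.1} else if j ∈ A then {v, w j} else U j := by
    intro w' hw'
    obtain ⟨h1, h2⟩ := Finset.mem_filter.1 hw'
    have ht := transversal_of_mem_rootedTransversals hU h1
    obtain ⟨h3, h4⟩ := mem_rootedTransversals.1 h1
    refine Fintype.mem_piFinset.2 fun j => ?_
    by_cases hj : j = c f.1
    · rw [if_pos hj, hj, h3]; exact Finset.mem_singleton_self _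
    · rw [if_neg hj]
      by_cases hjA : j ∈ A
      · rw [if_pos hjA]
        rcases Finset.mem_insert.1 (h2 j hjA) with h | h
        · rw [h]; exact Finset.mem_insert_self _ _
        · obtain ⟨l, -, hl⟩ := Finset.mem_image.1 h
          have : l = j := by rw [← hw l, hl, ht]
          rw [← hl, this]; simp
      · rw [if_neg hjA]; exact h4 j hj
  refine (Finset.card_le_card hsub).trans ?_
  rw [Fintype.card_piFinset, ← Finset.mul_prod_erase _ _ (Finset.mem_univ (c f.1)), if_pos rfl,
    Finset.card_singleton, one_mul]
  rw [← Finset.prod_sdiff hA]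
  have e1 : ∏ j ∈ Finset.univ.erase (c f.1) \ A,
      (if j = c f.1 then {f.1} else if j ∈ A then {v, w j} else U j).card =
      k ^ (r - 1 - A.card) := by
    rw [Finset.prod_congr rfl (g := fun _ => k), Finset.prod_const, Finset.card_sdiff_of_subset hA,
      Finset.card_erase_of_mem (Finset.mem_univ _), Finset.card_univ, Fintype.card_fin]
    intro j hj
    rw [Finset.mem_sdiff] at hj
    rw [if_neg (Finset.ne_of_mem_erase hj.1), if_neg hj.2, hUk]
  have e2 : ∏ j ∈ A, (if j = c f.1 then {f.1} else if j ∈ A then {v, w j} else U j).card ≤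
      2 ^ r := by
    refine (Finset.prod_le_pow_card A _ 2 fun j hj => ?_).trans
      (Nat.pow_le_pow_right two_pos ((Finset.card_le_univ A).trans_eq (Fintype.card_fin r)))
    rw [if_neg (Finset.ne_of_mem_erase (hA hj)), if_pos hj]
    exact Finset.card_le_two
  rw [e1, mul_comm]
  exact Nat.mul_le_mul_right _ e2

variable [Fintype V]

/-- Let `τ` be a set of `t` monochromatic pairs of maximum degree at most `D`. The hypotheses
`h0`, `h1`, `h2` bound the contribution to Janson's correlation sum of two rooted copies whose root
pairs share none, one or two vertices with the other copy, and which share `a` further vertices.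
Then almost no `M`-subset of the crossing pairs avoids completing a copy at some pair of `τ`. -/
theorem card_avoid_rooted_le {U : Fin r → Finset V} {k : ℕ} (hU : ∀ j, ∀ v ∈ U j, c v = j)
    (hUk : ∀ j, (U j).card = k) (τ : Finset (V × V)) (hτ : ∀ f ∈ τ, c f.1 = c f.2 ∧ f.1 ≠ f.2)
    (hswap : ∀ f ∈ τ, f.swap ∉ τ) {D : ℕ}
    (hD : ∀ x, (τ.filter fun f => f.1 = x ∨ f.2 = x).card ≤ D)
    (M : ℕ) {p q η θ : ℝ} (hp0 : 0 ≤ p) (hp1 : p ≤ 1) (hq0 : 0 ≤ q) (hq1 : q ≤ 1) (hη : 0 < η)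
    (hp : p * (crossPairs c).card ≤ (1 - η) * (M + 1))
    (hθ : 0 ≤ θ)
    (h0 : ∀ a, 2 ≤ a → a + 1 ≤ r → q * τ.card * k ^ (r - 1 - a) *
      p ^ (r.choose 2 + (r - 1) - a.choose 2) ≤ θ)
    (h1 : ∀ a, 1 ≤ a → a + 1 ≤ r → q * D * k ^ (r - 1 - a) *
      p ^ (r.choose 2 + (r - 1) - (a.choose 2 + a)) ≤ θ)
    (h2 : ∀ a, 1 ≤ a → a + 2 ≤ r → q * k ^ (r - 1 - a) *
      p ^ (r.choose 2 + (r - 1) - (a.choose 2 + a * 2)) ≤ θ) :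
    ((((crossPairs c).powersetCard M).filter fun H => ∀ f ∈ τ, ∀ w ∈ rootedTransversals c U f,
      ¬ rootedPairs c f.2 w ⊆ H).card : ℝ) ≤
      η⁻¹ * (crossPairs c).card.choose M *
        Real.exp (-((1 - 4 ^ r * (r + 3) * θ / 2) *
          (q * (τ.card * k ^ (r - 1)) * p ^ (r.choose 2 + (r - 1))))) := by
  set e := r.choose 2 + (r - 1) with he
  set I : Finset (Σ _ : V × V, Fin r → V) := τ.sigma fun f => rootedTransversals c U f with hI
  set K : (Σ _ : V × V, Fin r → V) → Finset (Sym2 V) := fun x => rootedPairs c x.1.2 x.2 with hK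
  have hcard : I.card = τ.card * k ^ (r - 1) := by
    rw [hI, Finset.card_sigma, Finset.sum_congr rfl fun f _ => card_rootedTransversals hUk f]
    simp
  have htr : ∀ x ∈ I, ∀ j, c (x.2 j) = j := fun x hx =>
    transversal_of_mem_rootedTransversals hU (Finset.mem_sigma.1 hx).2
  have hroot : ∀ x ∈ I, x.2 (c x.1.2) = x.1.1 := fun x hx => by
    obtain ⟨h3, h4⟩ := Finset.mem_sigma.1 hx
    rw [← (hτ _ h3).1]
    exact (mem_rootedTransversals.1 h4).1
  have hmain := card_powersetCard_avoid_le (crossPairs c) M e (θ := 4 ^ r * (r + 3) * θ) hp0 hp1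
    hq0 hq1 hη hp I K (fun x hx => rootedPairs_subset_crossPairs (htr x hx))
    (fun x hx => card_rootedPairs (htr x hx) (by
      rw [hroot x hx]; exact (hτ _ (Finset.mem_sigma.1 hx).1).2.symm)) ?_
  · rw [hcard] at hmain
    push_cast at hmain
    refine le_trans (Nat.cast_le.2 (Finset.card_le_card
      (t := ((crossPairs c).powersetCard M).filter fun H => ∀ x ∈ I, ¬ K x ⊆ H) ?_))
      (le_trans (le_of_eq (by congr!)) hmain)
    intro H hH
    refine Finset.mem_filter.2 ⟨(Finset.mem_filter.1 hH).1, fun x hx => ?_⟩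
    obtain ⟨h3, h4⟩ := Finset.mem_sigma.1 hx
    exact (Finset.mem_filter.1 hH).2 _ h3 _ h4
  rintro ⟨f, w⟩ hfw
  obtain ⟨hf, hw⟩ := Finset.mem_sigma.1 hfw
  dsimp only at hf hw
  have hwt : ∀ j, c (w j) = j := htr _ hfw
  obtain ⟨hwr, hwU⟩ := mem_rootedTransversals.1 hw
  -- `S` is the vertex set of the copy, and `b f'` counts the ends of `f'` in it
  set S : Finset V := insert f.2 (Finset.univ.image w) with hS
  set b : V × V → ℕ := fun f' => (({f'.1, f'.2} : Finset V).filter (· ∈ S)).card with hb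
  have hSc : ∀ x ∈ S, x = f.2 ∨ x = w (c x) := by
    intro x hx
    rcases Finset.mem_insert.1 hx with h | h
    · exact Or.inl h
    · obtain ⟨j, -, rfl⟩ := Finset.mem_image.1 h
      exact Or.inr (by rw [hwt])
  -- the only two vertices of `S` of the same colour are the ends of `f`
  have hb2 : ∀ f' ∈ τ, b f' = 2 → f' = f := by
    intro f' hf' hbf
    obtain ⟨hc, hne⟩ := hτ f' hf'
    have hboth : f'.1 ∈ S ∧ f'.2 ∈ S := by
      have := (Finset.filter_card_eq (s := {f'.1, f'.2}) (p := (· ∈ S))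
        (hbf.trans (Finset.card_pair hne).symm))
      exact ⟨this _ (by simp), this _ (by simp)⟩
    rcases hSc _ hboth.1 with h3 | h3 <;> rcases hSc _ hboth.2 with h4 | h4
    · exact absurd (h3.trans h4.symm) hne
    · have : f' = f.swap := by
        refine Prod.ext h3 ?_
        change f'.2 = f.1
        rw [h4, ← hc, h3, ← (hτ f hf).1, hwr]
      exact absurd (this ▸ hf') (hswap f hf)
    · refine Prod.ext ?_ h4
      rw [h3, hc, h4, ← (hτ f hf).1, hwr]
    · exact absurd (by rw [h3, h4, hc]) hne
  have hb_le : ∀ f', b f' ≤ 2 := fun f' =>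
    (Finset.card_filter_le _ _).trans Finset.card_le_two
  -- the possible numbers `a` of common vertices outside the root pair, when the copies share a
  -- pair and `β` vertices of the root pair; for `β = 2` the copies have the same root pair, and
  -- being distinct they cannot share all `r - 1` further vertices
  set adm : ℕ → ℕ → Prop := fun β a =>
    a + 1 ≤ r ∧ (β = 0 → 2 ≤ a) ∧ 1 ≤ a ∧ (β = 2 → a + 2 ≤ r) with hadm
  classical
  set G : ℕ → ℝ := fun β => ∑ A : Finset (Fin r), if adm β A.card then
    2 ^ r * (k ^ (r - 1 - A.card) * p ^ (e - (A.card.choose 2 + A.card * β))) else 0 with hG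
  have hG0 : ∀ β, 0 ≤ G β := fun β => Finset.sum_nonneg fun A _ => by
    split_ifs <;> positivity
  have hinner : ∀ f' ∈ τ, ∑ w' ∈ rootedTransversals c U f',
      (if (⟨f, w⟩ : Σ _ : V × V, Fin r → V) ≠ ⟨f', w'⟩ ∧ ¬ Disjoint (K ⟨f, w⟩) (K ⟨f', w'⟩) then
        p ^ (e - (K ⟨f, w⟩ ∩ K ⟨f', w'⟩).card) else 0) ≤ G (b f') := by
    intro f' hf'
    have hcc := (hτ f' hf').1
    have hterm : ∀ w' ∈ rootedTransversals c U f',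
      (if (⟨f, w⟩ : Σ _ : V × V, Fin r → V) ≠ ⟨f', w'⟩ ∧ ¬ Disjoint (K ⟨f, w⟩) (K ⟨f', w'⟩) then
        p ^ (e - (K ⟨f, w⟩ ∩ K ⟨f', w'⟩).card) else 0) ≤
        ∑ A : Finset (Fin r), if adm (b f') A.card ∧ A ⊆ Finset.univ.erase (c f'.1) ∧
          ∀ j ∈ A, w' j ∈ S then p ^ (e - (A.card.choose 2 + A.card * b f')) else 0 := by
      intro w' hw'
      have hnn : ∀ A ∈ (Finset.univ : Finset (Finset (Fin r))),
          (0 : ℝ) ≤ if adm (b f') A.card ∧ A ⊆ Finset.univ.erase (c f'.1) ∧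
          ∀ j ∈ A, w' j ∈ S then p ^ (e - (A.card.choose 2 + A.card * b f')) else 0 := by
        intro A _
        split_ifs <;> positivity
      split_ifs with hcond
      swap
      · exact Finset.sum_nonneg hnn
      obtain ⟨hne, hdis⟩ := hcond
      have hwt' := transversal_of_mem_rootedTransversals hU hw'
      obtain ⟨hwr', hwU'⟩ := mem_rootedTransversals.1 hw'
      set A := (Finset.univ.erase (c f'.2)).filter fun j => w' j ∈ S with hA
      have hcap : (K ⟨f, w⟩ ∩ K ⟨f', w'⟩).card ≤ A.card.choose 2 + A.card * b f' := by
        have := card_rootedPairs_inter_le (c := c) f.2 f'.2 w w'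
        rwa [← hcc, hwr', hcc] at this
      have hpos : 1 ≤ A.card.choose 2 + A.card * b f' := by
        refine le_trans ?_ hcap
        rw [Nat.one_le_iff_ne_zero, Finset.card_ne_zero]
        exact Finset.not_disjoint_iff_nonempty_inter.1 hdis
      have hAsub : A ⊆ Finset.univ.erase (c f'.1) := by
        rw [hcc]; exact Finset.filter_subset _ _
      have hA1 : A.card + 1 ≤ r := by
        have h3 := Finset.card_le_card hAsub
        have h4 : 0 < r := (c f.1).pos
        rw [Finset.card_erase_of_mem (Finset.mem_univ _), Finset.card_univ, Fintype.card_fin] at h3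
        omega
      have hAadm : adm (b f') A.card := by
        refine ⟨hA1, fun hb0 => ?_, ?_, fun hbb => ?_⟩
        · by_contra hlt
          rw [hb0, mul_zero, add_zero, Nat.choose_eq_zero_of_lt (not_le.1 hlt)] at hpos
          omega
        · rw [Nat.one_le_iff_ne_zero]
          intro h3
          rw [h3] at hpos
          simp at hpos
        · have hff := hb2 f' hf' hbb
          by_contra hlt
          have hAu : A = Finset.univ.erase (c f'.2) := by
            refine Finset.eq_of_subset_of_card_le (Finset.filter_subset _ _) ?_
            rw [Finset.card_erase_of_mem (Finset.mem_univ _), Finset.card_univ, Fintype.card_fin]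
            omega
          refine hne ?_
          subst hff
          congr 1
          ext j
          by_cases hj : j = c f'.1
          · rw [hj, hwr, hwr']
          · have hjA : j ∈ A := by
              rw [hAu, ← hcc]; exact Finset.mem_erase.2 ⟨hj, Finset.mem_univ _⟩
            rcases hSc _ (Finset.mem_filter.1 hjA).2 with h3 | h3
            · exact absurd (by rw [← hwt' j, h3, hcc]) hj
            · rw [h3, hwt']
      refine le_trans ?_ (Finset.single_le_sum hnn (Finset.mem_univ A))
      rw [if_pos ⟨hAadm, hAsub, fun j hj => (Finset.mem_filter.1 hj).2⟩]
      exact pow_le_pow_of_le_one hp0 hp1 (Nat.sub_le_sub_left hcap _)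
    refine (Finset.sum_le_sum hterm).trans ?_
    rw [Finset.sum_comm]
    refine Finset.sum_le_sum fun A _ => ?_
    by_cases hA : adm (b f') A.card ∧ A ⊆ Finset.univ.erase (c f'.1)
    · rw [if_pos hA.1]
      have hx : 0 ≤ p ^ (e - (A.card.choose 2 + A.card * b f')) := pow_nonneg hp0 _
      have h3 := card_rootedTransversals_meet_le hU hUk f' f.2 hwt hA.2
      have h4 : (((rootedTransversals c U f').filter fun w' => ∀ j ∈ A, w' j ∈ S).card : ℝ) ≤
          2 ^ r * k ^ (r - 1 - A.card) := by exact_mod_cast h3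
      simp only [hA.1, hA.2, true_and]
      rw [← Finset.sum_filter, Finset.sum_const, nsmul_eq_mul, ← mul_assoc]
      exact mul_le_mul_of_nonneg_right h4 hx
    · rw [Finset.sum_eq_zero]
      · split_ifs <;> positivity
      · intro w' _
        rw [if_neg fun h => hA ⟨h.1, h.2.1⟩]
  have hGsum : ∀ (β : ℕ) (m : ℝ), 0 ≤ m →
      (∀ a, adm β a → q * m * k ^ (r - 1 - a) * p ^ (e - (a.choose 2 + a * β)) ≤ θ) →
      q * (m * G β) ≤ 4 ^ r * θ := by
    intro β m hm hbd
    have : ∀ A ∈ (Finset.univ : Finset (Finset (Fin r))), q * (m * (if adm β A.card then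
        2 ^ r * (k ^ (r - 1 - A.card) * p ^ (e - (A.card.choose 2 + A.card * β))) else 0)) ≤
        2 ^ r * θ := by
      intro A _
      split_ifs with h
      · have := hbd _ h
        calc _ = 2 ^ r * (q * m * k ^ (r - 1 - A.card) *
            p ^ (e - (A.card.choose 2 + A.card * β))) := by ring
          _ ≤ _ := mul_le_mul_of_nonneg_left this (by positivity)
      · rw [mul_zero, mul_zero]; positivity
    rw [hG, Finset.mul_sum, Finset.mul_sum]
    refine (Finset.sum_le_card_nsmul _ _ _ this).trans (le_of_eq ?_)
    rw [Finset.card_univ, Fintype.card_finset, Fintype.card_fin, nsmul_eq_mul]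
    push_cast
    rw [← mul_assoc, ← mul_pow]
    norm_num
  have hn1 : ((τ.filter fun f' => b f' = 1).card : ℝ) ≤ (r + 1) * D := by
    have hsub : (τ.filter fun f' => b f' = 1) ⊆
        S.biUnion fun x => τ.filter fun f' => f'.1 = x ∨ f'.2 = x := by
      intro f' hf'
      obtain ⟨h3, h4⟩ := Finset.mem_filter.1 hf'
      obtain ⟨x, hx⟩ := Finset.card_pos.1 (by rw [hb] at h4; dsimp only at h4; omega :
        0 < (({f'.1, f'.2} : Finset V).filter (· ∈ S)).card)
      obtain ⟨h5, h6⟩ := Finset.mem_filter.1 hx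
      refine Finset.mem_biUnion.2 ⟨x, h6, Finset.mem_filter.2 ⟨h3, ?_⟩⟩
      rcases Finset.mem_insert.1 h5 with h | h
      · exact Or.inl h.symm
      · exact Or.inr (Finset.mem_singleton.1 h).symm
    have h3 := (Finset.card_le_card hsub).trans
      (Finset.card_biUnion_le_card_mul S _ D fun x _ => hD x)
    have h4 : S.card ≤ r + 1 := (Finset.card_insert_le _ _).trans
      (Nat.succ_le_succ (Finset.card_image_le.trans (by simp)))
    exact_mod_cast h3.trans (Nat.mul_le_mul_right _ h4)
  have hn2 : ((τ.filter fun f' => b f' = 2).card : ℝ) ≤ 1 := by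
    have : (τ.filter fun f' => b f' = 2) ⊆ {f} := fun f' hf' =>
      Finset.mem_singleton.2 (hb2 f' (Finset.mem_filter.1 hf').1 (Finset.mem_filter.1 hf').2)
    exact_mod_cast Finset.card_le_card this
  have hn0 : ((τ.filter fun f' => b f' = 0).card : ℝ) ≤ τ.card := by
    exact_mod_cast Finset.card_filter_le _ _
  have htot : ∑ f' ∈ τ, G (b f') ≤ τ.card * G 0 + (r + 1) * (D * G 1) + 1 * G 2 := by
    have hsplit : ∀ f' ∈ τ, G (b f') ≤ (if b f' = 0 then G 0 else 0) +
        (if b f' = 1 then G 1 else 0) + (if b f' = 2 then G 2 else 0) := by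
      intro f' _
      have := hb_le f'
      interval_cases h : b f' <;> simp
    refine (Finset.sum_le_sum hsplit).trans ?_
    rw [Finset.sum_add_distrib, Finset.sum_add_distrib, ← Finset.sum_filter, ← Finset.sum_filter,
      ← Finset.sum_filter, Finset.sum_const, Finset.sum_const, Finset.sum_const, nsmul_eq_mul,
      nsmul_eq_mul, nsmul_eq_mul, ← mul_assoc]
    gcongr
  have hb0 := hGsum 0 τ.card (by positivity) fun a ha => by
    have := h0 a (ha.2.1 rfl) ha.1
    simpa using this
  have hb1 := hGsum 1 D (by positivity) fun a ha => by
    have := h1 a ha.2.2.1 ha.1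
    simpa using this
  have hb2' := hGsum 2 1 (by positivity) fun a ha => by
    have := h2 a ha.2.2.1 (ha.2.2.2 rfl)
    simpa using this
  have hsum : ∑ x ∈ I.filter (fun x => (⟨f, w⟩ : Σ _ : V × V, Fin r → V) ≠ x ∧
      ¬ Disjoint (K ⟨f, w⟩) (K x)), p ^ (e - (K ⟨f, w⟩ ∩ K x).card) ≤ ∑ f' ∈ τ, G (b f') := by
    rw [Finset.sum_filter, hI, Finset.sum_sigma]
    exact Finset.sum_le_sum hinner
  refine (mul_le_mul_of_nonneg_left (hsum.trans htot) hq0).trans ?_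
  have h5 : (0 : ℝ) ≤ r + 1 := by positivity
  have := mul_le_mul_of_nonneg_left hb1 h5
  linarith

end RootedCopies

/-! ### Tuples of vertex sets without a transversal clique -/

section CliqueFreeTuples

variable {V : Type*} [Fintype V] {r : ℕ}

/-- The colour class of `j`. -/
def colorClass (c : V → Fin r) (j : Fin r) : Finset V := Finset.univ.filter fun v => c v = j

/-- The transversals of the colour classes. -/
def transversals (c : V → Fin r) : Finset (Fin r → V) := Fintype.piFinset (colorClass c)

lemma mem_transversals {c : V → Fin r} {w : Fin r → V} :
    w ∈ transversals c ↔ ∀ j, c (w j) = j := by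
  simp [transversals, Fintype.mem_piFinset, colorClass]

lemma card_transversals (c : V → Fin r) :
    (transversals c).card = ∏ j, (colorClass c j).card := Fintype.card_piFinset _

variable [DecidableEq V]

/-- Families of `d` distinct vertices in each colour class. They stand for the `r`-tuples of `d`-sets,
each of which is counted `d ! ^ r` times. -/
def classTuples (c : V → Fin r) (d : ℕ) : Finset (Fin r → Fin d → V) :=
  Finset.univ.filter fun x => (∀ j l, c (x j l) = j) ∧ ∀ j, Function.Injective (x j)

lemma mem_classTuples {c : V → Fin r} {d : ℕ} {x : Fin r → Fin d → V} :
    x ∈ classTuples c d ↔ (∀ j l, c (x j l) = j) ∧ ∀ j, Function.Injective (x j) := by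
  simp [classTuples]

/-- Those families of vertices across which `H` has no `K_r`. -/
def cliqueFreeTuples (c : V → Fin r) (d : ℕ) (H : Finset (Sym2 V)) :
    Finset (Fin r → Fin d → V) :=
  (classTuples c d).filter fun x =>
    ∀ t : Fin r → Fin d, ¬ pairsOn (fun j => x j (t j)) Finset.univ ⊆ H

/-- If half of the index tuples lie in a set `B`, then so does half of some shifted diagonal: the
diagonals `l ↦ l + s` cover every index tuple equally often. -/
lemma exists_diagonal {r d : ℕ} [NeZero d] (B : (Fin r → Fin d) → Prop) [DecidablePred B]
    (h : d ^ r ≤ 2 * (Finset.univ.filter B).card) :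
    ∃ s : Fin r → Fin d, d ≤ 2 * (Finset.univ.filter fun l : Fin d => B fun j => l + s j).card := by
  by_contra! hcon
  have h1 : ∑ s : Fin r → Fin d, (Finset.univ.filter fun l : Fin d => B fun j => l + s j).card =
      d * (Finset.univ.filter B).card := by
    simp only [Finset.card_filter]
    rw [Finset.sum_comm]
    have : ∀ l : Fin d, ∑ s : Fin r → Fin d, (if B fun j => l + s j then 1 else 0) =
        ∑ s : Fin r → Fin d, if B s then 1 else 0 := fun l =>
      Fintype.sum_equiv (Equiv.addLeft (fun _ : Fin r => l)) _ _ fun s => rfl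
    rw [Finset.sum_congr rfl fun l _ => this l]
    simp
  have h2 : ∑ s : Fin r → Fin d, 2 * (Finset.univ.filter fun l : Fin d => B fun j => l + s j).card <
      ∑ _s : Fin r → Fin d, d :=
    Finset.sum_lt_sum_of_nonempty ⟨fun _ => 0, Finset.mem_univ _⟩ fun s _ => hcon s
  rw [← Finset.mul_sum, h1] at h2
  simp only [Finset.sum_const, Finset.card_univ, Fintype.card_fun, Fintype.card_fin,
    smul_eq_mul] at h2
  nlinarith

/-- There are few sequences of `d` elements of `X`, half of which lie in the small set `B`. -/
lemma card_sequences_le {α : Type*} [DecidableEq α] (X B : Finset α) (hB : B ⊆ X) {τ : ℝ}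
    (hτ : 0 < τ) (hτ1 : τ ≤ 1) (hBX : (B.card : ℝ) ≤ τ ^ 2 * X.card) (d : ℕ) :
    (((Fintype.piFinset fun _ : Fin d => X).filter fun z =>
      d ≤ 2 * (Finset.univ.filter fun l => z l ∈ B).card).card : ℝ) ≤
      (2 * τ * X.card) ^ d := by
  -- weight each entry in `B` by `τ⁻²`, and each sequence by `τ ^ d`
  have h1 : ∀ z ∈ (Fintype.piFinset fun _ : Fin d => X), (if d ≤ 2 * (Finset.univ.filter
      fun l => z l ∈ B).card then (1 : ℝ) else 0) ≤
      τ ^ d * ∏ l, if z l ∈ B then (τ ^ 2)⁻¹ else 1 := by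
    intro z _
    rw [Finset.prod_ite, Finset.prod_const_one, mul_one, Finset.prod_const]
    set m := (Finset.univ.filter fun l => z l ∈ B).card
    split_ifs with h
    · rw [inv_pow, ← pow_mul, ← div_eq_mul_inv, le_div_iff₀ (by positivity), one_mul]
      exact pow_le_pow_of_le_one hτ.le hτ1 h
    · positivity
  rw [Finset.card_filter]
  push_cast
  refine (Finset.sum_le_sum h1).trans ?_
  rw [← Finset.mul_sum, ← Finset.prod_univ_sum (fun _ : Fin d => X)
    (fun _ w => if w ∈ B then (τ ^ 2)⁻¹ else (1 : ℝ)), Finset.prod_const, Finset.card_univ,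
    Fintype.card_fin, ← mul_pow]
  refine pow_le_pow_left₀ (mul_nonneg hτ.le (Finset.sum_nonneg fun w _ => ?_)) ?_ d
  · split_ifs <;> positivity
  · have h2 : ∑ w ∈ X, (if w ∈ B then (τ ^ 2)⁻¹ else (1 : ℝ)) ≤ 2 * X.card := by
      have h3 : ∀ w ∈ X, (if w ∈ B then (τ ^ 2)⁻¹ else (1 : ℝ)) ≤
          (if w ∈ B then (τ ^ 2)⁻¹ else 0) + 1 := by
        intro w _
        split_ifs <;> simp
      refine (Finset.sum_le_sum h3).trans ?_
      rw [Finset.sum_add_distrib, ← Finset.sum_filter, Finset.sum_const, Finset.sum_const,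
        Finset.filter_mem_eq_inter, Finset.inter_eq_right.2 hB, nsmul_eq_mul, nsmul_eq_mul,
        ← div_eq_mul_inv]
      have : (B.card : ℝ) / τ ^ 2 ≤ X.card := by
        rw [div_le_iff₀ (by positivity)]; linarith
      linarith
    nlinarith

/-- Only a tiny proportion of the families have half of their transversals in a small set. -/
lemma card_classTuples_half_le (c : V → Fin r) {d : ℕ} (hd : 0 < d) (B : Finset (Fin r → V))
    (hB : B ⊆ transversals c) {τ : ℝ} (hτ : 0 < τ) (hτ1 : τ ≤ 1)
    (hBX : (B.card : ℝ) ≤ τ ^ 2 * (transversals c).card) :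
    (((classTuples c d).filter fun x => d ^ r ≤
      2 * (Finset.univ.filter fun t : Fin r → Fin d => (fun j => x j (t j)) ∈ B).card).card : ℝ) ≤
      d ^ r * (2 * τ * (transversals c).card) ^ d := by
  have : NeZero d := ⟨hd.ne'⟩
  set Z := (Fintype.piFinset fun _ : Fin d => transversals c).filter fun z =>
      d ≤ 2 * (Finset.univ.filter fun l => z l ∈ B).card with hZ
  have hsub : ((classTuples c d).filter fun x => d ^ r ≤
      2 * (Finset.univ.filter fun t : Fin r → Fin d => (fun j => x j (t j)) ∈ B).card) ⊆
      (Finset.univ : Finset (Fin r → Fin d)).biUnion fun s => (classTuples c d).filter fun x =>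
        (fun l : Fin d => fun j => x j (l + s j)) ∈ Z := by
    intro x hx
    obtain ⟨h1, h2⟩ := Finset.mem_filter.1 hx
    obtain ⟨s, hs⟩ := exists_diagonal (fun t : Fin r → Fin d => (fun j => x j (t j)) ∈ B) h2
    refine Finset.mem_biUnion.2 ⟨s, Finset.mem_univ _, Finset.mem_filter.2 ⟨h1, ?_⟩⟩
    refine Finset.mem_filter.2 ⟨Fintype.mem_piFinset.2 fun l => mem_transversals.2 fun j => ?_, hs⟩
    exact (mem_classTuples.1 h1).1 j _
  have hcard : ∀ s ∈ (Finset.univ : Finset (Fin r → Fin d)), ((classTuples c d).filter fun x =>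
        (fun l : Fin d => fun j => x j (l + s j)) ∈ Z).card ≤ Z.card := by
    intro s _
    refine Finset.card_le_card_of_injOn (fun x => fun l : Fin d => fun j => x j (l + s j))
      (fun x hx => (Finset.mem_filter.1 hx).2) ?_
    intro x _ y _ hxy
    funext j l
    have := congrFun (congrFun hxy (l - s j)) j
    simpa using this
  have h1 := (Finset.card_le_card hsub).trans (Finset.card_biUnion_le_card_mul _ _ _ hcard)
  rw [Finset.card_univ, Fintype.card_fun, Fintype.card_fin, Fintype.card_fin] at h1
  refine (Nat.cast_le.2 h1).trans ?_
  push_cast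
  exact mul_le_mul_of_nonneg_left (card_sequences_le _ B hB hτ hτ1 hBX d) (by positivity)

/-- Tuples in the colour classes are sequences of `d` transversals, read along the diagonal. -/
lemma card_classTuples_le (c : V → Fin r) {d : ℕ} :
    (classTuples c d).card ≤ (transversals c).card ^ d := by
  have : (Fintype.piFinset fun _ : Fin d => transversals c).card = (transversals c).card ^ d := by
    rw [Fintype.card_piFinset]; simp
  rw [← this]
  refine Finset.card_le_card_of_injOn (fun x => fun l : Fin d => fun j => x j l) ?_ ?_
  · intro x hx
    refine Finset.mem_coe.2 (Fintype.mem_piFinset.2 fun l => mem_transversals.2 fun j => ?_)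
    exact (mem_classTuples.1 hx).1 j l
  · intro x _ y _ hxy
    funext j l
    exact congrFun (congrFun hxy l) j

/-- The number of transversals of a labelled family that agree with `w` on the colours in `A`. The
labels in `ℕ` let the same transversal occur several times. -/
def degOn (𝒦 : Finset (ℕ × (Fin r → V))) (A : Finset (Fin r)) (w : Fin r → V) : ℕ :=
  (𝒦.filter fun i => ∀ j ∈ A, i.2 j = w j).card

lemma sum_degOn (c : V → Fin r) (𝒦 : Finset (ℕ × (Fin r → V))) (A : Finset (Fin r)) :
    ∑ w ∈ transversals c, (degOn 𝒦 A w : ℝ) =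
      ∑ i ∈ 𝒦, (((transversals c).filter fun w => ∀ j ∈ A, i.2 j = w j).card : ℝ) := by
  have := Finset.sum_card_bipartiteAbove_eq_sum_card_bipartiteBelow (s := transversals c) (t := 𝒦)
    fun w i => ∀ j ∈ A, i.2 j = w j
  exact_mod_cast this

lemma card_transversals_agree_mul_le (c : V → Fin r) {v₀ : ℝ} (hv₀ : 0 < v₀)
    (hv : ∀ j, v₀ ≤ (colorClass c j).card) (A : Finset (Fin r)) (u : Fin r → V) :
    (((transversals c).filter fun w => ∀ j ∈ A, u j = w j).card : ℝ) * v₀ ^ A.card ≤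
      (transversals c).card := by
  have hsub : ((transversals c).filter fun w => ∀ j ∈ A, u j = w j) ⊆
      Fintype.piFinset fun j => if j ∈ A then {u j} else colorClass c j := by
    intro w hw
    obtain ⟨h3, h4⟩ := Finset.mem_filter.1 hw
    refine Fintype.mem_piFinset.2 fun j => ?_
    split_ifs with hj
    · exact Finset.mem_singleton.2 (h4 j hj).symm
    · exact Fintype.mem_piFinset.1 h3 j
  have h3 := Finset.card_le_card hsub
  have h4 : ∀ j ∈ A, (if j ∈ A then {u j} else colorClass c j).card = 1 := fun j hj => by
    rw [if_pos hj, Finset.card_singleton]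
  have h5 : ∀ j ∈ Aᶜ, (if j ∈ A then {u j} else colorClass c j).card =
      (colorClass c j).card := fun j hj => by
    rw [if_neg (Finset.mem_compl.1 hj)]
  rw [Fintype.card_piFinset, ← Finset.prod_mul_prod_compl A, Finset.prod_congr rfl h4,
    Finset.prod_congr rfl h5, Finset.prod_const_one, one_mul] at h3
  have h6 : v₀ ^ A.card ≤ ∏ j ∈ A, ((colorClass c j).card : ℝ) := by
    rw [← Finset.prod_const]
    exact Finset.prod_le_prod (fun _ _ => hv₀.le) fun j _ => hv j
  have h7 : ((transversals c).card : ℝ) = (∏ j ∈ A, ((colorClass c j).card : ℝ)) *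
      ∏ j ∈ Aᶜ, ((colorClass c j).card : ℝ) := by
    rw [Finset.prod_mul_prod_compl, card_transversals]; push_cast; rfl
  rw [h7, mul_comm]
  refine mul_le_mul h6 (by exact_mod_cast h3) (by positivity) (by positivity)

/-- The transversals that agree on `A` with more than `κ #A` members of the family, for some set
`A` of at least two colours. -/
noncomputable def saturated (c : V → Fin r) (κ : ℕ → ℝ) (𝒦 : Finset (ℕ × (Fin r → V))) :
    Finset (Fin r → V) := by
  classical
  exact (transversals c).filter fun w => ∃ A : Finset (Fin r), 2 ≤ A.card ∧ κ A.card < degOn 𝒦 A w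

/-- Few transversals are saturated, by double counting of the agreeing pairs for each set `A`. -/
lemma card_saturated_le (c : V → Fin r) {κ : ℕ → ℝ} {𝒦 : Finset (ℕ × (Fin r → V))} {v₀ τ m : ℝ}
    (hv₀ : 0 < v₀) (hv : ∀ j, v₀ ≤ (colorClass c j).card) (hm : (𝒦.card : ℝ) ≤ m)
    (hκ0 : ∀ a, 0 < κ a)
    (hκ : ∀ a, 2 ≤ a → a ≤ r → 2 ^ r * m ≤ τ ^ 2 * κ a * v₀ ^ a) :
    ((saturated c κ 𝒦).card : ℝ) ≤ τ ^ 2 * (transversals c).card := by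
  classical
  set Y := (transversals c).card with hY
  have hA : ∀ A : Finset (Fin r), 2 ≤ A.card →
      (((transversals c).filter fun w => κ A.card < degOn 𝒦 A w).card : ℝ) ≤
        τ ^ 2 * Y / 2 ^ r := by
    intro A hA2
    set n := ((transversals c).filter fun w => κ A.card < degOn 𝒦 A w).card with hn
    have h1 : κ A.card * n ≤ ∑ w ∈ transversals c, (degOn 𝒦 A w : ℝ) := by
      refine le_trans ?_ (Finset.sum_le_sum_of_subset_of_nonneg (Finset.filter_subset
        (fun w => κ A.card < degOn 𝒦 A w) _) fun _ _ _ => Nat.cast_nonneg _)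
      rw [mul_comm, ← nsmul_eq_mul]
      exact Finset.card_nsmul_le_sum _ _ _ fun w hw => (Finset.mem_filter.1 hw).2.le
    have h2 : ∀ i : ℕ × (Fin r → V), (((transversals c).filter fun w => ∀ j ∈ A, i.2 j = w j).card
        : ℝ) * v₀ ^ A.card ≤ Y := by
      intro i
      exact card_transversals_agree_mul_le c hv₀ hv A i.2
    have h3 : (∑ w ∈ transversals c, (degOn 𝒦 A w : ℝ)) * v₀ ^ A.card ≤ m * Y := by
      rw [sum_degOn, Finset.sum_mul]
      refine (Finset.sum_le_card_nsmul _ _ _ fun i _ => h2 i).trans ?_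
      rw [nsmul_eq_mul]
      exact mul_le_mul_of_nonneg_right hm (by positivity)
    have h4 := hκ A.card hA2 ((Finset.card_le_univ A).trans_eq (Fintype.card_fin r))
    have h5 : κ A.card * v₀ ^ A.card * n ≤ m * Y :=
      le_trans (le_of_eq (by ring)) ((mul_le_mul_of_nonneg_right h1 (by positivity)).trans h3)
    have hpos : 0 < κ A.card * v₀ ^ A.card := mul_pos (hκ0 _) (by positivity)
    rw [le_div_iff₀ (by positivity)]
    refine le_of_mul_le_mul_left ?_ hpos
    have h6 : (0 : ℝ) ≤ Y := by positivity
    have h7 : (0 : ℝ) < 2 ^ r := by positivity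
    calc κ A.card * v₀ ^ A.card * (n * 2 ^ r) = 2 ^ r * (κ A.card * v₀ ^ A.card * n) := by ring
      _ ≤ 2 ^ r * (m * Y) := mul_le_mul_of_nonneg_left h5 h7.le
      _ = 2 ^ r * m * Y := by ring
      _ ≤ τ ^ 2 * κ A.card * v₀ ^ A.card * Y := mul_le_mul_of_nonneg_right h4 h6
      _ = κ A.card * v₀ ^ A.card * (τ ^ 2 * Y) := by ring
  have hsub : saturated c κ 𝒦 ⊆ ((Finset.univ : Finset (Finset (Fin r))).filter
      fun A => 2 ≤ A.card).biUnion fun A =>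
        (transversals c).filter fun w => κ A.card < degOn 𝒦 A w := by
    intro w hw
    simp only [saturated, Finset.mem_filter] at hw
    obtain ⟨h1, A, hA2, h2⟩ := hw
    exact Finset.mem_biUnion.2 ⟨A, Finset.mem_filter.2 ⟨Finset.mem_univ _, hA2⟩,
      Finset.mem_filter.2 ⟨h1, h2⟩⟩
  have h1 : ((saturated c κ 𝒦).card : ℝ) ≤ ∑ A ∈ (Finset.univ : Finset (Finset (Fin r))).filter
      (fun A => 2 ≤ A.card), (((transversals c).filter fun w =>
        κ A.card < degOn 𝒦 A w).card : ℝ) := by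
    exact_mod_cast (Finset.card_le_card hsub).trans Finset.card_biUnion_le
  refine h1.trans ((Finset.sum_le_card_nsmul _ _ _ fun A hA' =>
    hA A (Finset.mem_filter.1 hA').2).trans ?_)
  rw [nsmul_eq_mul]
  have h2 : (((Finset.univ : Finset (Finset (Fin r))).filter fun A => 2 ≤ A.card).card : ℝ) ≤
      2 ^ r := by
    have := Finset.card_filter_le (Finset.univ : Finset (Finset (Fin r))) fun A => 2 ≤ A.card
    rw [Finset.card_univ, Fintype.card_finset, Fintype.card_fin] at this
    exact_mod_cast this
  refine (mul_le_mul_of_nonneg_right h2 (by positivity)).trans (le_of_eq ?_)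
  field_simp

/-- A labelled family of `g * b` transversals, with labels below `g`, in which every partial
transversal on a set `A` of at least two colours is contained in at most `d ^ (r - #A) + κ #A`
members. -/
def IsSpread (c : V → Fin r) (d b : ℕ) (κ : ℕ → ℝ) (g : ℕ) (𝒦 : Finset (ℕ × (Fin r → V))) : Prop :=
  (∀ i ∈ 𝒦, i.1 < g ∧ ∀ j, c (i.2 j) = j) ∧ 𝒦.card = g * b ∧
    ∀ A : Finset (Fin r), 2 ≤ A.card → ∀ w, (degOn 𝒦 A w : ℝ) ≤ d ^ (r - A.card) + κ A.card

/-- A spread family can be extended by `b` unsaturated transversals of a tuple of vertex sets: a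
partial transversal on `A` gains at most `d ^ (r - #A)` extensions inside the tuple, and it gains
none if its degree exceeded `κ #A`. -/
lemma IsSpread.extend {c : V → Fin r} {d b g : ℕ} {κ : ℕ → ℝ}
    {𝒦 : Finset (ℕ × (Fin r → V))} (h𝒦 : IsSpread c d b κ g 𝒦) {x : Fin r → Fin d → V}
    (hx : x ∈ classTuples c d) (T : Finset (Fin r → Fin d)) (hTb : T.card = b)
    (hT : ∀ t ∈ T, (fun j => x j (t j)) ∉ saturated c κ 𝒦) :
    IsSpread c d b κ (g + 1) (𝒦 ∪ T.image fun t => (g, fun j => x j (t j))) := by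
  obtain ⟨hx1, hx2⟩ := mem_classTuples.1 hx
  obtain ⟨h1, h2, h3⟩ := h𝒦
  have hinj : Function.Injective fun t : Fin r → Fin d => (g, fun j => x j (t j)) := by
    intro t t' h
    funext j
    exact hx2 j (congrFun (Prod.ext_iff.1 h).2 j)
  refine ⟨fun i hi => ?_, ?_, fun A hA w => ?_⟩
  · rcases Finset.mem_union.1 hi with h | h
    · exact ⟨(h1 i h).1.trans (Nat.lt_succ_self g), (h1 i h).2⟩
    · obtain ⟨t, -, rfl⟩ := Finset.mem_image.1 h
      exact ⟨Nat.lt_succ_self g, fun j => hx1 j _⟩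
  · rw [Finset.card_union_of_disjoint, Finset.card_image_of_injective _ hinj, h2, hTb]
    · ring
    · rw [Finset.disjoint_left]
      intro i hi h
      obtain ⟨t, -, rfl⟩ := Finset.mem_image.1 h
      exact lt_irrefl _ (h1 _ hi).1
  · have hdeg : degOn (𝒦 ∪ T.image fun t => (g, fun j => x j (t j))) A w ≤ degOn 𝒦 A w +
        (T.filter fun t => ∀ j ∈ A, x j (t j) = w j).card := by
      unfold degOn
      rw [Finset.filter_union, Finset.filter_image]
      exact (Finset.card_union_le _ _).trans (Nat.add_le_add_left Finset.card_image_le _)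
    rcases Finset.eq_empty_or_nonempty (T.filter fun t => ∀ j ∈ A, x j (t j) = w j) with h0 | h0
    · rw [h0, Finset.card_empty, add_zero] at hdeg
      exact (Nat.cast_le.2 hdeg).trans (h3 A hA w)
    · obtain ⟨t₀, ht₀⟩ := h0
      obtain ⟨h4, h5⟩ := Finset.mem_filter.1 ht₀
      have hsat : (degOn 𝒦 A w : ℝ) ≤ κ A.card := by
        by_contra hcon
        refine hT t₀ h4 ?_
        simp only [saturated, Finset.mem_filter]
        refine ⟨mem_transversals.2 fun j => hx1 j _, A, hA, ?_⟩
        have : degOn 𝒦 A (fun j => x j (t₀ j)) = degOn 𝒦 A w := by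
          unfold degOn
          congr 1
          refine Finset.filter_congr fun i _ => forall₂_congr fun j hj => ?_
          change i.2 j = x j (t₀ j) ↔ _
          rw [h5 j hj]
        rw [this]
        exact not_le.1 hcon
      have hnew : (T.filter fun t => ∀ j ∈ A, x j (t j) = w j).card ≤ d ^ (r - A.card) := by
        have hsub : (T.filter fun t => ∀ j ∈ A, x j (t j) = w j) ⊆
            Fintype.piFinset fun j => if j ∈ A then {t₀ j} else Finset.univ := by
          intro t ht
          refine Fintype.mem_piFinset.2 fun j => ?_
          split_ifs with hj
          · refine Finset.mem_singleton.2 (hx2 j ?_)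
            rw [(Finset.mem_filter.1 ht).2 j hj, h5 j hj]
          · exact Finset.mem_univ _
        refine (Finset.card_le_card hsub).trans (le_of_eq ?_)
        rw [Fintype.card_piFinset, ← Finset.prod_mul_prod_compl A,
          Finset.prod_congr rfl (g := fun _ => 1) fun j hj => by
            rw [if_pos hj, Finset.card_singleton],
          Finset.prod_congr rfl (s₁ := Aᶜ) (g := fun _ => d) fun j hj => by
            rw [if_neg (Finset.mem_compl.1 hj), Finset.card_univ, Fintype.card_fin]]
        rw [Finset.prod_const_one, one_mul, Finset.prod_const, Finset.card_compl, Fintype.card_fin]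
      have h6 : (degOn (𝒦 ∪ T.image fun t => (g, fun j => x j (t j))) A w : ℝ) ≤
          degOn 𝒦 A w + d ^ (r - A.card) := by
        exact_mod_cast hdeg.trans (Nat.add_le_add_left hnew _)
      linarith

/-- Janson's inequality for a spread family of transversal copies of `K_r`. -/
lemma card_avoid_spread_le {c : V → Fin r} {d b g : ℕ} {κ : ℕ → ℝ}
    {𝒦 : Finset (ℕ × (Fin r → V))} (h𝒦 : IsSpread c d b κ g 𝒦)
    (M : ℕ) {p q η : ℝ} (hp0 : 0 ≤ p) (hp1 : p ≤ 1) (hq0 : 0 ≤ q) (hq1 : q ≤ 1) (hη : 0 < η)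
    (hp : p * (crossPairs c).card ≤ (1 - η) * (M + 1))
    (hJ : ∀ a, 2 ≤ a → a ≤ r →
      2 ^ r * (q * (d ^ (r - a) + κ a) * p ^ (r.choose 2 - a.choose 2)) ≤ 1) :
    ((((crossPairs c).powersetCard M).filter fun H => ∀ i ∈ 𝒦,
      ¬ pairsOn i.2 Finset.univ ⊆ H).card : ℝ) ≤
      η⁻¹ * (crossPairs c).card.choose M * Real.exp (-(q * b * p ^ r.choose 2 / 2)) ^ g := by
  obtain ⟨h1, h2, h3⟩ := h𝒦
  have hmain := card_powersetCard_avoid_le (crossPairs c) M (r.choose 2) (θ := 1) hp0 hp1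
    hq0 hq1 hη hp 𝒦 (fun i => pairsOn i.2 Finset.univ)
    (fun i hi => pairsOn_subset_crossPairs (h1 i hi).2 _)
    (fun i hi => by
      rw [card_pairsOn (injective_of_transversal (h1 i hi).2), Finset.card_univ,
        Fintype.card_fin]) ?_
  · refine hmain.trans (le_of_eq ?_)
    rw [← Real.exp_nat_mul, h2]
    congr 2
    push_cast
    ring
  intro i hi
  have hterm : ∀ i' ∈ 𝒦, (if i ≠ i' ∧ ¬ Disjoint (pairsOn i.2 Finset.univ)
      (pairsOn i'.2 Finset.univ) then p ^ (r.choose 2 - (pairsOn i.2 Finset.univ ∩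
        pairsOn i'.2 Finset.univ).card) else 0) ≤
      ∑ A ∈ (Finset.univ : Finset (Finset (Fin r))).filter (fun A => 2 ≤ A.card),
        if ∀ j ∈ A, i'.2 j = i.2 j then p ^ (r.choose 2 - A.card.choose 2) else 0 := by
    intro i' hi'
    have hnn : ∀ A ∈ (Finset.univ : Finset (Finset (Fin r))).filter (fun A => 2 ≤ A.card),
        (0 : ℝ) ≤ if ∀ j ∈ A, i'.2 j = i.2 j then p ^ (r.choose 2 - A.card.choose 2) else 0 := by
      intro A _
      split_ifs <;> positivity
    split_ifs with hcond
    swap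
    · exact Finset.sum_nonneg hnn
    set A := Finset.univ.filter fun j => i.2 j = i'.2 j with hA
    have hcap : (pairsOn i.2 Finset.univ ∩ pairsOn i'.2 Finset.univ).card ≤ A.card.choose 2 :=
      (Finset.card_le_card (pairsOn_inter_subset (h1 i hi).2 (h1 i' hi').2)).trans
        (card_pairsOn_le _ _)
    have hA2 : 2 ≤ A.card := by
      by_contra hlt
      rw [Nat.choose_eq_zero_of_lt (not_le.1 hlt), Nat.le_zero, Finset.card_eq_zero] at hcap
      exact hcond.2 (Finset.disjoint_iff_inter_eq_empty.2 hcap)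
    refine le_trans ?_ (Finset.single_le_sum hnn
      (Finset.mem_filter.2 ⟨Finset.mem_univ A, hA2⟩))
    rw [if_pos fun j hj => (Finset.mem_filter.1 hj).2.symm]
    exact pow_le_pow_of_le_one hp0 hp1 (Nat.sub_le_sub_left hcap _)
  rw [Finset.sum_filter]
  refine (mul_le_mul_of_nonneg_left (Finset.sum_le_sum hterm) hq0).trans ?_
  rw [Finset.sum_comm, Finset.mul_sum]
  have hA : ∀ A ∈ (Finset.univ : Finset (Finset (Fin r))).filter (fun A => 2 ≤ A.card),
      q * ∑ i' ∈ 𝒦, (if ∀ j ∈ A, i'.2 j = i.2 j then p ^ (r.choose 2 - A.card.choose 2) else 0) ≤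
        1 / 2 ^ r := by
    intro A hA
    have hA2 := (Finset.mem_filter.1 hA).2
    have hpA : 0 ≤ p ^ (r.choose 2 - A.card.choose 2) := pow_nonneg hp0 _
    rw [← Finset.sum_filter, Finset.sum_const, nsmul_eq_mul, le_div_iff₀ (by positivity)]
    have h4 := hJ A.card hA2 ((Finset.card_le_univ A).trans_eq (Fintype.card_fin r))
    refine le_trans ?_ h4
    rw [mul_comm _ ((2 : ℝ) ^ r), mul_assoc q]
    refine mul_le_mul_of_nonneg_left (mul_le_mul_of_nonneg_left
      (mul_le_mul_of_nonneg_right (h3 A hA2 i.2) hpA) hq0) (by positivity)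
  refine (Finset.sum_le_card_nsmul _ _ _ hA).trans ?_
  rw [nsmul_eq_mul, mul_one_div, div_le_one (by positivity)]
  have := Finset.card_filter_le (Finset.univ : Finset (Finset (Fin r))) fun A => 2 ≤ A.card
  rw [Finset.card_univ, Fintype.card_finset, Fintype.card_fin] at this
  exact_mod_cast this

/-- The moments of the number of tuples across which a random `H` has no `K_r`, over the sets `H`
that avoid the cliques of a spread family. The induction
exposes one tuple at a time: most tuples contain `b` unsaturated transversals, and each such tuple
costs a factor `exp (-q b p ^ (r choose 2) / 2)` by Janson's inequality. -/
lemma sum_cliqueFreeTuples_pow_le_aux {c : V → Fin r} {d b smax : ℕ} (hd : 0 < d)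
    (hb : 2 * b ≤ d ^ r + 1) {κ : ℕ → ℝ} (hκ0 : ∀ a, 0 < κ a) {v₀ τ : ℝ} (hv₀ : 0 < v₀)
    (hv : ∀ j, v₀ ≤ (colorClass c j).card) (hτ : 0 < τ) (hτ1 : τ ≤ 1)
    (hκ : ∀ a, 2 ≤ a → a ≤ r → 2 ^ r * (smax * b : ℝ) ≤ τ ^ 2 * κ a * v₀ ^ a)
    (M : ℕ) {p q η : ℝ} (hp0 : 0 ≤ p) (hp1 : p ≤ 1) (hq0 : 0 ≤ q) (hq1 : q ≤ 1) (hη : 0 < η)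
    (hp : p * (crossPairs c).card ≤ (1 - η) * (M + 1))
    (hJ : ∀ a, 2 ≤ a → a ≤ r →
      2 ^ r * (q * (d ^ (r - a) + κ a) * p ^ (r.choose 2 - a.choose 2)) ≤ 1)
    (s : ℕ) : ∀ (g : ℕ) (𝒦 : Finset (ℕ × (Fin r → V))), g + s ≤ smax → IsSpread c d b κ g 𝒦 →
      ∑ H ∈ ((crossPairs c).powersetCard M).filter (fun H => ∀ i ∈ 𝒦,
        ¬ pairsOn i.2 Finset.univ ⊆ H), ((cliqueFreeTuples c d H).card : ℝ) ^ s ≤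
      η⁻¹ * (crossPairs c).card.choose M * Real.exp (-(q * b * p ^ r.choose 2 / 2)) ^ g *
        ((transversals c).card ^ d * (Real.exp (-(q * b * p ^ r.choose 2 / 2)) +
          d ^ r * (2 * τ) ^ d)) ^ s := by
  set y := Real.exp (-(q * b * p ^ r.choose 2 / 2)) with hy
  have hy0 : 0 ≤ y := (Real.exp_pos _).le
  set Y := ((transversals c).card : ℝ) with hY
  induction s with
  | zero =>
    intro g 𝒦 _ h𝒦
    simp only [pow_zero, Finset.sum_const, nsmul_eq_mul, mul_one]
    exact card_avoid_spread_le h𝒦 M hp0 hp1 hq0 hq1 hη hp hJ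
  | succ s ih =>
    intro g 𝒦 hg h𝒦
    set 𝒜 := ((crossPairs c).powersetCard M).filter (fun H => ∀ i ∈ 𝒦,
        ¬ pairsOn i.2 Finset.univ ⊆ H) with h𝒜
    set C := η⁻¹ * ((crossPairs c).card.choose M : ℝ) with hC
    have hC0 : 0 ≤ C := by positivity
    set Z := (Y ^ d * (y + d ^ r * (2 * τ) ^ d)) ^ s with hZ
    have hZ0 : 0 ≤ Z := by positivity
    have hswap : ∑ H ∈ 𝒜, ((cliqueFreeTuples c d H).card : ℝ) ^ (s + 1) =
        ∑ x ∈ classTuples c d, ∑ H ∈ 𝒜.filter (fun H => x ∈ cliqueFreeTuples c d H),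
          ((cliqueFreeTuples c d H).card : ℝ) ^ s := by
      have : ∀ H ∈ 𝒜, ((cliqueFreeTuples c d H).card : ℝ) ^ (s + 1) =
          ∑ x ∈ classTuples c d, if x ∈ cliqueFreeTuples c d H then
            ((cliqueFreeTuples c d H).card : ℝ) ^ s else 0 := by
        intro H _
        rw [← Finset.sum_filter, Finset.filter_mem_eq_inter,
          Finset.inter_eq_right.2 (show cliqueFreeTuples c d H ⊆ classTuples c d from
            Finset.filter_subset _ _), Finset.sum_const, nsmul_eq_mul,
          pow_succ']
      rw [Finset.sum_congr rfl this, Finset.sum_comm]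
      exact Finset.sum_congr rfl fun x _ => (Finset.sum_filter _ _).symm
    set good : (Fin r → Fin d → V) → Prop := fun x => b ≤
      (Finset.univ.filter fun t : Fin r → Fin d => (fun j => x j (t j)) ∉ saturated c κ 𝒦).card
      with hgood
    have hgoodx : ∀ x ∈ classTuples c d, good x →
        ∑ H ∈ 𝒜.filter (fun H => x ∈ cliqueFreeTuples c d H),
          ((cliqueFreeTuples c d H).card : ℝ) ^ s ≤ C * y ^ (g + 1) * Z := by
      intro x hx hgx
      obtain ⟨T, hT, hTb⟩ := Finset.exists_subset_card_eq hgx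
      have hsp := h𝒦.extend hx T hTb fun t ht => (Finset.mem_filter.1 (hT ht)).2
      refine le_trans (Finset.sum_le_sum_of_subset_of_nonneg ?_ fun _ _ _ => by positivity)
        (ih (g + 1) _ (by omega) hsp)
      intro H hH
      obtain ⟨h1, h2⟩ := Finset.mem_filter.1 hH
      obtain ⟨h3, h4⟩ := Finset.mem_filter.1 h1
      refine Finset.mem_filter.2 ⟨h3, fun i hi => ?_⟩
      rcases Finset.mem_union.1 hi with h | h
      · exact h4 i h
      · obtain ⟨t, -, rfl⟩ := Finset.mem_image.1 h
        exact (Finset.mem_filter.1 h2).2 t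
    have hbadx : ∀ x ∈ classTuples c d,
        ∑ H ∈ 𝒜.filter (fun H => x ∈ cliqueFreeTuples c d H),
          ((cliqueFreeTuples c d H).card : ℝ) ^ s ≤ C * y ^ g * Z := by
      intro x _
      exact le_trans (Finset.sum_le_sum_of_subset_of_nonneg (Finset.filter_subset _ _)
        fun _ _ _ => by positivity) (ih g 𝒦 (by omega) h𝒦)
    have hsat := card_saturated_le c (κ := κ) (𝒦 := 𝒦) (m := smax * b) (τ := τ) hv₀ hv (by
      rw [h𝒦.2.1]; push_cast
      have : (g : ℝ) ≤ smax := by exact_mod_cast (by omega : g ≤ smax)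
      gcongr) hκ0 hκ
    have hnbad : (((classTuples c d).filter fun x => ¬ good x).card : ℝ) ≤
        d ^ r * (2 * τ * Y) ^ d := by
      refine le_trans ?_ (card_classTuples_half_le c hd (saturated c κ 𝒦)
        (Finset.filter_subset _ _) hτ hτ1 hsat)
      refine Nat.cast_le.2 (Finset.card_le_card fun x hx => ?_)
      obtain ⟨h1, h2⟩ := Finset.mem_filter.1 hx
      refine Finset.mem_filter.2 ⟨h1, ?_⟩
      have h3 := Finset.card_filter_add_card_filter_not (s := (Finset.univ : Finset (Fin r → Fin d)))
        (fun t => (fun j => x j (t j)) ∈ saturated c κ 𝒦)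
      rw [Finset.card_univ, Fintype.card_fun, Fintype.card_fin, Fintype.card_fin] at h3
      have h4 := not_le.1 h2
      omega
    rw [hswap, ← Finset.sum_filter_add_sum_filter_not _ good]
    have hs1 := Finset.sum_le_card_nsmul ((classTuples c d).filter good) _ _ fun x hx =>
      hgoodx x (Finset.mem_filter.1 hx).1 (Finset.mem_filter.1 hx).2
    have hs2 := Finset.sum_le_card_nsmul ((classTuples c d).filter fun x => ¬ good x) _ _
      fun x hx => hbadx x (Finset.mem_filter.1 hx).1
    rw [nsmul_eq_mul] at hs1 hs2
    have hn1 : (((classTuples c d).filter good).card : ℝ) ≤ Y ^ d := by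
      rw [hY]
      exact_mod_cast (Finset.card_filter_le _ _).trans (card_classTuples_le c)
    calc _ ≤ Y ^ d * (C * y ^ (g + 1) * Z) + d ^ r * (2 * τ * Y) ^ d * (C * y ^ g * Z) :=
          add_le_add (hs1.trans (mul_le_mul_of_nonneg_right hn1 (by positivity)))
            (hs2.trans (mul_le_mul_of_nonneg_right hnbad (by positivity)))
      _ = _ := by
        rw [pow_succ (Y ^ d * (y + d ^ r * (2 * τ) ^ d)) s, mul_pow (2 * τ) Y d]
        ring

/-- Markov's inequality for the `smax`-th moment: few `M`-subsets `H` of the crossing pairs have no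
`K_r` across more than `β * Y ^ d` tuples of vertex sets, where `Y` is the number of
transversals. -/
theorem card_many_cliqueFreeTuples_le {c : V → Fin r} {d b smax : ℕ} (hd : 0 < d)
    (hb : 2 * b ≤ d ^ r + 1) {κ : ℕ → ℝ} (hκ0 : ∀ a, 0 < κ a) {v₀ τ : ℝ} (hv₀ : 0 < v₀)
    (hv : ∀ j, v₀ ≤ (colorClass c j).card) (hτ : 0 < τ) (hτ1 : τ ≤ 1)
    (hκ : ∀ a, 2 ≤ a → a ≤ r → 2 ^ r * (smax * b : ℝ) ≤ τ ^ 2 * κ a * v₀ ^ a)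
    (M : ℕ) {p q η : ℝ} (hp0 : 0 ≤ p) (hp1 : p ≤ 1) (hq0 : 0 ≤ q) (hq1 : q ≤ 1) (hη : 0 < η)
    (hp : p * (crossPairs c).card ≤ (1 - η) * (M + 1))
    (hJ : ∀ a, 2 ≤ a → a ≤ r →
      2 ^ r * (q * (d ^ (r - a) + κ a) * p ^ (r.choose 2 - a.choose 2)) ≤ 1)
    {β : ℝ} (hβ : 0 < β) :
    ((((crossPairs c).powersetCard M).filter fun H =>
      β * (transversals c).card ^ d < (cliqueFreeTuples c d H).card).card : ℝ) ≤
      η⁻¹ * (crossPairs c).card.choose M *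
        ((Real.exp (-(q * b * p ^ r.choose 2 / 2)) + d ^ r * (2 * τ) ^ d) / β) ^ smax := by
  have h := sum_cliqueFreeTuples_pow_le_aux hd hb hκ0 hv₀ hv hτ hτ1 hκ M hp0 hp1 hq0 hq1 hη hp hJ
    smax 0 ∅ (by simp) ⟨by simp, by simp, fun A _ w => by
      simp only [degOn, Finset.filter_empty, Finset.card_empty, Nat.cast_zero]
      have := hκ0 A.card
      positivity⟩
  simp only [Finset.notMem_empty, false_imp_iff, implies_true, Finset.filter_true, pow_zero,
    mul_one] at h
  set Y := ((transversals c).card : ℝ) ^ d with hY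
  have hY0 : 0 < Y := by
    have : 0 < (transversals c).card := by
      rw [card_transversals]
      refine Finset.prod_pos fun j _ => ?_
      exact_mod_cast hv₀.trans_le (hv j)
    positivity
  set y := Real.exp (-(q * b * p ^ r.choose 2 / 2)) + d ^ r * (2 * τ) ^ d with hy
  set B := ((crossPairs c).powersetCard M).filter fun H => β * Y < (cliqueFreeTuples c d H).card
    with hB
  have h1 : B.card * (β * Y) ^ smax ≤ ∑ H ∈ (crossPairs c).powersetCard M,
      ((cliqueFreeTuples c d H).card : ℝ) ^ smax := by
    refine le_trans ?_ (Finset.sum_le_sum_of_subset_of_nonneg (Finset.filter_subset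
      (fun H => β * Y < (cliqueFreeTuples c d H).card) _) fun _ _ _ => by positivity)
    rw [← nsmul_eq_mul]
    refine Finset.card_nsmul_le_sum _ _ _ fun H hH => ?_
    exact pow_le_pow_left₀ (by positivity) (Finset.mem_filter.1 hH).2.le _
  have h2 := h1.trans h
  have h3 : 0 < (β * Y) ^ smax := by positivity
  rw [← le_div_iff₀ h3] at h2
  refine h2.trans (le_of_eq ?_)
  rw [div_pow, mul_pow, mul_pow]
  field_simp

end CliqueFreeTuples

/-! ### Graphs covered by few vertices -/

section Covers

variable {V : Type*} [Fintype V] [DecidableEq V] {r : ℕ}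

/-- The pairs of distinct vertices of the same colour. -/
def monoPairs (c : V → Fin r) : Finset (Sym2 V) :=
  Finset.univ.filter fun e => ¬ e.IsDiag ∧ (Sym2.map c e).IsDiag

lemma mk_mem_monoPairs {c : V → Fin r} {a b : V} :
    s(a, b) ∈ monoPairs c ↔ a ≠ b ∧ c a = c b := by
  simp [monoPairs]

lemma card_sym2_le (F : Finset (Sym2 V)) : F.card ≤ Fintype.card V ^ 2 := by
  have : F ⊆ (Finset.univ : Finset (V × V)).image fun x => s(x.1, x.2) := by
    intro e _
    induction e with
    | h a b => exact Finset.mem_image.2 ⟨(a, b), Finset.mem_univ _, rfl⟩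
  refine (Finset.card_le_card this).trans (Finset.card_image_le.trans (le_of_eq ?_))
  rw [Finset.card_univ, Fintype.card_prod, sq]

/-- The pairs of `F` that contain `v`. -/
def edgesAt (F : Finset (Sym2 V)) (v : V) : Finset (Sym2 V) := F.filter fun e => v ∈ e

/-- The neighbours of `v` in the graph with edge set `F`. -/
def nbrs (F : Finset (Sym2 V)) (v : V) : Finset V := Finset.univ.filter fun w => s(v, w) ∈ F

lemma mem_nbrs {F : Finset (Sym2 V)} {v w : V} : w ∈ nbrs F v ↔ s(v, w) ∈ F := by
  simp [nbrs]

lemma card_edgesAt (F : Finset (Sym2 V)) (v : V) : (edgesAt F v).card = (nbrs F v).card := by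
  symm
  refine Finset.card_bij (fun w _ => s(v, w)) ?_ ?_ ?_
  · intro w hw
    exact Finset.mem_filter.2 ⟨mem_nbrs.1 hw, Sym2.mem_mk_left _ _⟩
  · intro w _ w' _ h
    exact Sym2.congr_right.1 h
  · intro e he
    obtain ⟨h1, h2⟩ := Finset.mem_filter.1 he
    obtain ⟨w, rfl⟩ := h2
    exact ⟨w, mem_nbrs.2 h1, rfl⟩

lemma card_edgesAt_le (F : Finset (Sym2 V)) (v : V) : (edgesAt F v).card ≤ Fintype.card V := by
  rw [card_edgesAt]
  exact Finset.card_le_univ _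

lemma sum_card_edgesAt_le (F : Finset (Sym2 V)) (S : Finset V) :
    ∑ v ∈ S, (edgesAt F v).card ≤ 2 * F.card := by
  have h1 : ∑ v ∈ S, (edgesAt F v).card = ∑ e ∈ F, (S.filter fun v => v ∈ e).card :=
    Finset.sum_card_bipartiteAbove_eq_sum_card_bipartiteBelow (s := S) (t := F) fun v e => v ∈ e
  rw [h1, mul_comm, ← smul_eq_mul]
  refine Finset.sum_le_card_nsmul _ _ _ fun e _ => ?_
  induction e with
  | h a b =>
    refine (Finset.card_le_card (t := {a, b}) fun x hx => ?_).trans Finset.card_le_two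
    simpa using (Finset.mem_filter.1 hx).2

/-- The pairs of `F` that meet `Q`. -/
def edgesTouching (F : Finset (Sym2 V)) (Q : Finset V) : Finset (Sym2 V) :=
  Q.biUnion fun v => edgesAt F v

lemma mem_edgesTouching {F : Finset (Sym2 V)} {Q : Finset V} {e : Sym2 V} :
    e ∈ edgesTouching F Q ↔ e ∈ F ∧ ∃ v ∈ Q, v ∈ e := by
  simp only [edgesTouching, edgesAt, Finset.mem_biUnion, Finset.mem_filter]
  exact ⟨fun ⟨v, h1, h2, h3⟩ => ⟨h2, v, h1, h3⟩, fun ⟨h2, v, h1, h3⟩ => ⟨v, h1, h2, h3⟩⟩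

lemma card_edgesTouching_le (F : Finset (Sym2 V)) (Q : Finset V) :
    (edgesTouching F Q).card ≤ Q.card * Fintype.card V :=
  Finset.card_biUnion_le_card_mul _ _ _ fun v _ => card_edgesAt_le F v

/-- A maximal subgraph with at most `t` edges and maximum degree at most `D`: if it has fewer than
`t` edges, then each further edge meets a vertex of degree `D`. -/
lemma exists_bounded_degree_subgraph (T : Finset (Sym2 V)) (D t : ℕ) :
    ∃ T' ⊆ T, (∀ v, (edgesAt T' v).card ≤ D) ∧ T'.card ≤ t ∧
      (T'.card < t → ∀ e ∈ T \ T', ∃ v ∈ e, (edgesAt T' v).card = D) := by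
  obtain ⟨T', hT', hmax⟩ := Finset.exists_max_image
    (T.powerset.filter fun T' => (∀ v, (edgesAt T' v).card ≤ D) ∧ T'.card ≤ t) Finset.card
    ⟨∅, Finset.mem_filter.2 ⟨Finset.empty_mem_powerset _, by simp [edgesAt], by simp⟩⟩
  obtain ⟨h1, h2, h3⟩ := Finset.mem_filter.1 hT'
  refine ⟨T', Finset.mem_powerset.1 h1, h2, h3, fun hlt e he => ?_⟩
  obtain ⟨heT, heT'⟩ := Finset.mem_sdiff.1 he
  by_contra! hcon
  have := hmax (insert e T') (Finset.mem_filter.2 ⟨Finset.mem_powerset.2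
    (Finset.insert_subset heT (Finset.mem_powerset.1 h1)), fun v => ?_, ?_⟩)
  · rw [Finset.card_insert_of_notMem heT'] at this
    omega
  · unfold edgesAt
    rw [Finset.filter_insert]
    split_ifs with hv
    · exact (Finset.card_insert_le _ _).trans (lt_of_le_of_ne (h2 v) (hcon v hv))
    · exact h2 v
  · rw [Finset.card_insert_of_notMem heT']
    exact hlt

/-- `T` splits into at most `t` pairs, further pairs that meet a set of at most `h` vertices, and
at most `l` further pairs that meet a set of at most `s` vertices. -/
def HasCover (T : Finset (Sym2 V)) (t h s l : ℕ) : Prop :=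
  ∃ A B₁ B₂ : Finset (Sym2 V), T = A ∪ (B₁ ∪ B₂) ∧ Disjoint A (B₁ ∪ B₂) ∧ Disjoint B₁ B₂ ∧
    A.card ≤ t ∧ (∃ Q : Finset V, Q.card ≤ h ∧ ∀ e ∈ B₁, ∃ v ∈ Q, v ∈ e) ∧
    (∃ Q : Finset V, Q.card ≤ s ∧ ∀ e ∈ B₂, ∃ v ∈ Q, v ∈ e) ∧ B₂.card ≤ l

lemma HasCover.mono {T : Finset (Sym2 V)} {t h s l t' h' s' l' : ℕ} (hT : HasCover T t h s l)
    (ht : t ≤ t') (hh : h ≤ h') (hs : s ≤ s') (hl : l ≤ l') : HasCover T t' h' s' l' := by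
  obtain ⟨A, B₁, B₂, h1, h2, h3, h4, ⟨Q, h5, h6⟩, ⟨Q', h7, h8⟩, h9⟩ := hT
  exact ⟨A, B₁, B₂, h1, h2, h3, h4.trans ht, ⟨Q, h5.trans hh, h6⟩, ⟨Q', h7.trans hs, h8⟩,
    h9.trans hl⟩

lemma HasCover.subset {T T₀ : Finset (Sym2 V)} {t h s l : ℕ} (hT : HasCover T t h s l)
    (hsub : T₀ ⊆ T) : HasCover T₀ t h s l := by
  obtain ⟨A, B₁, B₂, h1, h2, h3, h4, ⟨Q, h5, h6⟩, ⟨Q', h7, h8⟩, h9⟩ := hT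
  refine ⟨T₀ ∩ A, T₀ ∩ B₁, T₀ ∩ B₂, ?_, ?_, ?_, ?_, ⟨Q, h5, ?_⟩, ⟨Q', h7, ?_⟩, ?_⟩
  · rw [← Finset.inter_union_distrib_left, ← Finset.inter_union_distrib_left, ← h1,
      Finset.inter_eq_left.2 hsub]
  · rw [← Finset.inter_union_distrib_left]
    exact h2.mono Finset.inter_subset_right Finset.inter_subset_right
  · exact h3.mono Finset.inter_subset_right Finset.inter_subset_right
  · exact (Finset.card_le_card Finset.inter_subset_right).trans h4
  · exact fun e he => h6 e (Finset.mem_inter.1 he).2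
  · exact fun e he => h8 e (Finset.mem_inter.1 he).2
  · exact (Finset.card_le_card Finset.inter_subset_right).trans h9

/-- The cover of `T` given by a maximal subgraph `T'` of bounded degree. The set `Q` contains the
vertices of large degree in `T`. -/
lemma hasCover_of_saturated {T T' : Finset (Sym2 V)} (hT' : T' ⊆ T) {D d₂ : ℕ}
    (hsat : ∀ e ∈ T \ T', ∃ v ∈ e, (edgesAt T' v).card = D) {s : ℕ}
    (hs : ∀ S : Finset V, S.card * D ≤ 2 * T'.card → S.card ≤ s) (Q : Finset V)
    (hQ : ∀ v, d₂ ≤ (edgesAt T v).card → v ∈ Q) :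
    HasCover T T'.card Q.card s (s * d₂) := by
  set S := Finset.univ.filter fun v => (edgesAt T' v).card = D with hS
  have hScard : S.card ≤ s := by
    refine hs S (le_trans ?_ (sum_card_edgesAt_le T' S))
    rw [← smul_eq_mul]
    exact Finset.card_nsmul_le_sum _ _ _ fun v hv => (Finset.mem_filter.1 hv).2.ge
  refine ⟨T', (T \ T') ∩ edgesTouching T Q, (T \ T') \ edgesTouching T Q, ?_, ?_, ?_, le_rfl,
    ⟨Q, le_rfl, ?_⟩, ⟨S, hScard, ?_⟩, ?_⟩
  · rw [Finset.union_comm (_ ∩ _), Finset.sdiff_union_inter, Finset.union_sdiff_of_subset hT']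
  · rw [Finset.union_comm (_ ∩ _), Finset.sdiff_union_inter]
    exact Finset.disjoint_sdiff
  · rw [Finset.disjoint_left]
    intro e he he'
    exact (Finset.mem_sdiff.1 he').2 (Finset.mem_inter.1 he).2
  · exact fun e he => (mem_edgesTouching.1 (Finset.mem_inter.1 he).2).2
  · intro e he
    obtain ⟨v, h1, h2⟩ := hsat e (Finset.mem_sdiff.1 he).1
    exact ⟨v, Finset.mem_filter.2 ⟨Finset.mem_univ _, h2⟩, h1⟩
  · have hsub : (T \ T') \ edgesTouching T Q ⊆ (S \ Q).biUnion fun v => edgesAt T v := by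
      intro e he
      obtain ⟨h1, h2⟩ := Finset.mem_sdiff.1 he
      have heT := (Finset.mem_sdiff.1 h1).1
      obtain ⟨v, h3, h4⟩ := hsat e h1
      refine Finset.mem_biUnion.2 ⟨v, Finset.mem_sdiff.2 ⟨Finset.mem_filter.2
        ⟨Finset.mem_univ _, h4⟩, fun hvQ => h2 (mem_edgesTouching.2 ⟨heT, v, hvQ, h3⟩)⟩,
        Finset.mem_filter.2 ⟨heT, h3⟩⟩
    refine (Finset.card_le_card hsub).trans ((Finset.card_biUnion_le_card_mul _ _ d₂
      fun v hv => ?_).trans (Nat.mul_le_mul_right _ ((Finset.card_le_card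
        Finset.sdiff_subset).trans hScard)))
    by_contra hlt
    exact (Finset.mem_sdiff.1 hv).2 (hQ v (not_le.1 hlt).le)

lemma sum_pow_card_le_exp {α : Type*} [DecidableEq α] (X : Finset α) {x : ℝ} (hx : 0 ≤ x) :
    ∑ A ∈ X.powerset, x ^ A.card ≤ Real.exp (x * X.card) := by
  have : ∑ A ∈ X.powerset, x ^ A.card = (x + 1) ^ X.card := by
    rw [← Finset.sum_pow_mul_eq_add_pow]
    simp
  rw [this, mul_comm, Real.exp_nat_mul]
  exact pow_le_pow_left₀ (by positivity) (Real.add_one_le_exp x) _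

lemma sum_biUnion_le {α ι : Type*} [DecidableEq α] (s : Finset ι) (t : ι → Finset α) {f : α → ℝ}
    (hf : ∀ a, 0 ≤ f a) : ∑ a ∈ s.biUnion t, f a ≤ ∑ i ∈ s, ∑ a ∈ t i, f a := by
  classical
  induction s using Finset.induction_on with
  | empty => simp
  | insert i s hi ih =>
    rw [Finset.biUnion_insert, Finset.sum_insert hi]
    have := Finset.sum_union_inter (s₁ := t i) (s₂ := s.biUnion t) (f := f)
    have h2 : 0 ≤ ∑ a ∈ t i ∩ s.biUnion t, f a := Finset.sum_nonneg fun a _ => hf a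
    linarith

/-- Chernoff-type bound for the weight of the small subsets. -/
lemma sum_pow_card_small_le_exp {α : Type*} [DecidableEq α] (X : Finset α) {x y : ℝ} (hx : 0 ≤ x)
    (hy : 0 < y) (hy1 : y ≤ 1) {l : ℝ} :
    ∑ A ∈ X.powerset.filter (fun A => (A.card : ℝ) ≤ l), x ^ A.card ≤
      Real.exp (l * Real.log y⁻¹ + y * x * X.card) := by
  have hlog : 0 ≤ Real.log y⁻¹ := Real.log_nonneg ((one_le_inv₀ hy).2 hy1)
  rw [Real.exp_add]
  calc _ ≤ ∑ A ∈ X.powerset.filter (fun A => (A.card : ℝ) ≤ l),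
        Real.exp (l * Real.log y⁻¹) * (y * x) ^ A.card := by
        refine Finset.sum_le_sum fun A hA => ?_
        have h1 := (Finset.mem_filter.1 hA).2
        have h2 : (y ^ A.card)⁻¹ ≤ Real.exp (l * Real.log y⁻¹) := by
          rw [← inv_pow, ← Real.exp_log (pow_pos (inv_pos.2 hy) A.card), Real.log_pow]
          exact Real.exp_le_exp.2 (mul_le_mul_of_nonneg_right h1 hlog)
        rw [mul_pow, ← mul_assoc]
        refine le_mul_of_one_le_left (by positivity) ?_
        rwa [inv_le_iff_one_le_mul₀ (by positivity)] at h2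
    _ ≤ Real.exp (l * Real.log y⁻¹) * ∑ A ∈ X.powerset, (y * x) ^ A.card := by
        rw [Finset.mul_sum]
        exact Finset.sum_le_sum_of_subset_of_nonneg (Finset.filter_subset _ _)
          fun _ _ _ => by positivity
    _ ≤ _ := mul_le_mul_of_nonneg_left (sum_pow_card_le_exp X (by positivity))
        (Real.exp_pos _).le

/-- Adding up to `t` elements one at a time gives each subset of size at most `t`. -/
lemma sum_pow_card_small_le {α : Type*} [DecidableEq α] (X : Finset α) {x : ℝ} (hx : 0 ≤ x)
    (t : ℕ) : ∑ A ∈ X.powerset.filter (fun A => A.card ≤ t), x ^ A.card ≤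
      (1 + X.card * x) ^ t := by
  induction X using Finset.induction_on generalizing t with
  | empty =>
    simp [Finset.filter_singleton]
  | insert a X ha ih =>
    cases t with
    | zero =>
      have : (insert a X).powerset.filter (fun A => A.card ≤ 0) = {∅} := by
        ext A
        simp only [Finset.mem_filter, Finset.mem_powerset, Nat.le_zero, Finset.card_eq_zero,
          Finset.mem_singleton]
        exact ⟨fun h => h.2, fun h => ⟨h ▸ Finset.empty_subset _, h⟩⟩
      rw [this]
      simp
    | succ t =>
      have h1 : ∑ A ∈ (insert a X).powerset.filter (fun A => A.card ≤ t + 1), x ^ A.card =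
          (∑ A ∈ X.powerset.filter (fun A => A.card ≤ t + 1), x ^ A.card) +
          x * ∑ A ∈ X.powerset.filter (fun A => A.card ≤ t), x ^ A.card := by
        rw [Finset.sum_filter, Finset.sum_powerset_insert ha, Finset.sum_filter, Finset.sum_filter,
          Finset.mul_sum]
        congr 1
        refine Finset.sum_congr rfl fun A hA => ?_
        have : a ∉ A := fun h => ha (Finset.mem_powerset.1 hA h)
        rw [Finset.card_insert_of_notMem this]
        simp only [Nat.add_le_add_iff_right, pow_succ']
        split_ifs <;> simp
      rw [h1, Finset.card_insert_of_notMem ha]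
      push_cast
      have h2 := ih (t + 1)
      have h3 := mul_le_mul_of_nonneg_left (ih t) hx
      have h4 : (1 + X.card * x) ^ t ≤ (1 + (X.card + 1) * x) ^ t :=
        pow_le_pow_left₀ (by positivity) (by nlinarith) t
      calc _ ≤ (1 + X.card * x) ^ (t + 1) + x * (1 + X.card * x) ^ t := add_le_add h2 h3
        _ = (1 + X.card * x) ^ t * (1 + (X.card + 1) * x) := by ring
        _ ≤ (1 + (X.card + 1) * x) ^ t * (1 + (X.card + 1) * x) := by gcongr
        _ = _ := by ring

lemma card_small_subsets_le {α : Type*} [DecidableEq α] (X : Finset α) (t : ℕ) :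
    ((X.powerset.filter fun A => A.card ≤ t).card : ℝ) ≤ (1 + X.card : ℝ) ^ t := by
  have := sum_pow_card_small_le X (x := 1) zero_le_one t
  simpa using this

/-- The weight of a family of sets that split into a member of `𝒜` and a member of `ℬ`. -/
lemma sum_pow_card_split_le {α : Type*} [DecidableEq α] (𝒯 𝒜 ℬ : Finset (Finset α)) {x : ℝ}
    (hx : 0 ≤ x) (h : ∀ T ∈ 𝒯, ∃ A ∈ 𝒜, ∃ B ∈ ℬ, T = A ∪ B ∧ Disjoint A B) :
    ∑ T ∈ 𝒯, x ^ T.card ≤ (∑ A ∈ 𝒜, x ^ A.card) * ∑ B ∈ ℬ, x ^ B.card := by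
  choose! f hf g hg hfg hd using h
  rw [Finset.sum_mul_sum, ← Finset.sum_product']
  have hinj : Set.InjOn (fun T => (f T, g T)) (𝒯 : Set (Finset α)) := by
    intro T hT T' hT' he
    obtain ⟨h1, h2⟩ := Prod.ext_iff.1 he
    dsimp only at h1 h2
    rw [hfg T hT, hfg T' hT', h1, h2]
  calc ∑ T ∈ 𝒯, x ^ T.card = ∑ T ∈ 𝒯, x ^ (f T).card * x ^ (g T).card := by
        refine Finset.sum_congr rfl fun T hT => ?_
        rw [← pow_add, ← Finset.card_union_of_disjoint (hd T hT), ← hfg T hT]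
    _ = ∑ y ∈ 𝒯.image fun T => (f T, g T), x ^ y.1.card * x ^ y.2.card := by
        rw [Finset.sum_image hinj]
    _ ≤ _ := by
        refine Finset.sum_le_sum_of_subset_of_nonneg ?_ fun _ _ _ => by positivity
        intro y hy
        obtain ⟨T, hT, rfl⟩ := Finset.mem_image.1 hy
        exact Finset.mem_product.2 ⟨hf T hT, hg T hT⟩

open Classical in
/-- The total weight of the sets of monochromatic pairs with a given kind of cover. The parameter `y`
can be chosen to balance the cost of the at most `l` pairs at the `s` vertices. -/
theorem sum_pow_card_hasCover_le (c : V → Fin r) {x y : ℝ} (hx : 0 ≤ x) (hy : 0 < y) (hy1 : y ≤ 1)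
    (t h s l : ℕ) :
    ∑ T ∈ (monoPairs c).powerset.filter (fun T => HasCover T t h s l), x ^ T.card ≤
      (1 + (Fintype.card V : ℝ) ^ 2 * x) ^ t *
      ((1 + Fintype.card V : ℝ) ^ h * Real.exp (x * (h * Fintype.card V)) *
      ((1 + Fintype.card V : ℝ) ^ s *
        Real.exp (l * Real.log y⁻¹ + y * x * (s * Fintype.card V)))) := by
  set n := Fintype.card V with hn
  set 𝒜 := (monoPairs c).powerset.filter fun A => A.card ≤ t with h𝒜
  set ℬ₁ := ((Finset.univ : Finset V).powerset.filter fun Q => Q.card ≤ h).biUnion fun Q =>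
    (edgesTouching (monoPairs c) Q).powerset with hℬ₁
  set ℬ₂ := ((Finset.univ : Finset V).powerset.filter fun Q => Q.card ≤ s).biUnion fun Q =>
    (edgesTouching (monoPairs c) Q).powerset.filter fun B => (B.card : ℝ) ≤ l with hℬ₂
  set 𝒯 := (monoPairs c).powerset.filter (fun T => HasCover T t h s l) with h𝒯
  set ℬ := (monoPairs c).powerset.filter fun B => ∃ B₁ ∈ ℬ₁, ∃ B₂ ∈ ℬ₂, B = B₁ ∪ B₂ ∧
    Disjoint B₁ B₂ with hℬ
  have hsplit : ∀ T ∈ 𝒯, ∃ A ∈ 𝒜, ∃ B ∈ ℬ, T = A ∪ B ∧ Disjoint A B := by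
    intro T hT
    obtain ⟨hTm, A, B₁, B₂, h1, h2, h3, h4, ⟨Q, h5, h6⟩, ⟨Q', h7, h8⟩, h9⟩ := Finset.mem_filter.1 hT
    rw [Finset.mem_powerset] at hTm
    have hA : A ⊆ monoPairs c := (h1 ▸ Finset.subset_union_left : A ⊆ T).trans hTm
    have hB : B₁ ∪ B₂ ⊆ monoPairs c := (h1 ▸ Finset.subset_union_right : B₁ ∪ B₂ ⊆ T).trans hTm
    refine ⟨A, Finset.mem_filter.2 ⟨Finset.mem_powerset.2 hA, h4⟩, B₁ ∪ B₂,
      Finset.mem_filter.2 ⟨Finset.mem_powerset.2 hB, B₁, ?_, B₂, ?_, rfl, h3⟩, h1, h2⟩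
    · refine Finset.mem_biUnion.2 ⟨Q, by simpa using h5, Finset.mem_powerset.2 fun e he => ?_⟩
      exact mem_edgesTouching.2 ⟨hB (Finset.mem_union_left _ he), h6 e he⟩
    · refine Finset.mem_biUnion.2 ⟨Q', by simpa using h7, Finset.mem_filter.2
        ⟨Finset.mem_powerset.2 fun e he => ?_, by exact_mod_cast h9⟩⟩
      exact mem_edgesTouching.2 ⟨hB (Finset.mem_union_right _ he), h8 e he⟩
  have hX : ∀ (b : ℕ) (Q : Finset V), Q.card ≤ b →
      ((edgesTouching (monoPairs c) Q).card : ℝ) ≤ b * n := by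
    intro b Q hQ
    exact_mod_cast (card_edgesTouching_le _ Q).trans (Nat.mul_le_mul_right _ hQ)
  have hsA : ∑ A ∈ 𝒜, x ^ A.card ≤ (1 + (n : ℝ) ^ 2 * x) ^ t := by
    refine (sum_pow_card_small_le _ hx t).trans (pow_le_pow_left₀ (by positivity) ?_ t)
    have : ((monoPairs c).card : ℝ) ≤ (n : ℝ) ^ 2 := by exact_mod_cast card_sym2_le _
    gcongr
  have hs1 : ∑ B ∈ ℬ₁, x ^ B.card ≤ (1 + n : ℝ) ^ h * Real.exp (x * (h * n)) := by
    refine (sum_biUnion_le _ _ fun _ => by positivity).trans ?_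
    refine (Finset.sum_le_card_nsmul _ _ (Real.exp (x * (h * n))) fun Q hQ => ?_).trans ?_
    · refine (sum_pow_card_le_exp _ hx).trans (Real.exp_le_exp.2 ?_)
      exact mul_le_mul_of_nonneg_left (hX h Q (Finset.mem_filter.1 hQ).2) hx
    · rw [nsmul_eq_mul]
      have := card_small_subsets_le (Finset.univ : Finset V) h
      rw [Finset.card_univ] at this
      gcongr
  have hs2 : ∑ B ∈ ℬ₂, x ^ B.card ≤ (1 + n : ℝ) ^ s *
      Real.exp (l * Real.log y⁻¹ + y * x * (s * n)) := by
    refine (sum_biUnion_le _ _ fun _ => by positivity).trans ?_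
    refine (Finset.sum_le_card_nsmul _ _ (Real.exp (l * Real.log y⁻¹ + y * x * (s * n)))
      fun Q hQ => ?_).trans ?_
    · refine (sum_pow_card_small_le_exp _ hx hy hy1).trans (Real.exp_le_exp.2 ?_)
      have := mul_le_mul_of_nonneg_left (hX s Q (Finset.mem_filter.1 hQ).2)
        (by positivity : 0 ≤ y * x)
      linarith
    · rw [nsmul_eq_mul]
      have := card_small_subsets_le (Finset.univ : Finset V) s
      rw [Finset.card_univ] at this
      gcongr
  have hsB : ∑ B ∈ ℬ, x ^ B.card ≤ (∑ B ∈ ℬ₁, x ^ B.card) * ∑ B ∈ ℬ₂, x ^ B.card :=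
    sum_pow_card_split_le ℬ ℬ₁ ℬ₂ hx fun B hB => (Finset.mem_filter.1 hB).2
  refine (sum_pow_card_split_le 𝒯 𝒜 ℬ hx hsplit).trans ?_
  refine mul_le_mul hsA (hsB.trans ?_) (Finset.sum_nonneg fun _ _ => by positivity) (by positivity)
  exact mul_le_mul hs1 hs2 (Finset.sum_nonneg fun _ _ => by positivity) (by positivity)

/-- Some half of `Q` leaves at least half of the neighbours of each of its vertices outside. It is a
part of a bipartition of `Q` with the fewest edges inside its parts. -/
lemma exists_half_few_inner_nbrs {T : Finset (Sym2 V)} (hT : ∀ v, v ∉ nbrs T v) (Q : Finset V) :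
    ∃ A ⊆ Q, Q.card ≤ 2 * A.card ∧ ∀ v ∈ A, (nbrs T v).card ≤ 2 * (nbrs T v \ A).card := by
  classical
  set I : Finset V → Finset (Sym2 V) := fun A => T.filter fun e => ∀ x ∈ e, x ∈ A with hI
  obtain ⟨A, hA, hmin⟩ := Finset.exists_min_image Q.powerset
    (fun A => (I A).card + (I (Q \ A)).card) ⟨∅, Finset.empty_mem_powerset _⟩
  have hAQ := Finset.mem_powerset.1 hA
  -- a minimiser has the desired property on both sides
  have key : ∀ A ⊆ Q, (∀ A' ∈ Q.powerset, (I A).card + (I (Q \ A)).card ≤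
      (I A').card + (I (Q \ A')).card) →
      ∀ v ∈ A, (nbrs T v).card ≤ 2 * (nbrs T v \ A).card := by
    intro A hAQ hmin v hv
    by_contra! hcon
    have h1 := Finset.card_sdiff_add_card_inter (nbrs T v) A
    have hlt : (nbrs T v \ A).card < (nbrs T v ∩ A).card := by omega
    have h2 := hmin (A.erase v) (Finset.mem_powerset.2 ((Finset.erase_subset _ _).trans hAQ))
    have h3 : (I (A.erase v)).card + (nbrs T v ∩ A).card ≤ (I A).card := by
      rw [← Finset.card_image_of_injective (f := fun w => s(v, w)) (nbrs T v ∩ A)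
        fun a b h => Sym2.congr_right.1 h, ← Finset.card_union_of_disjoint]
      · refine Finset.card_le_card (Finset.union_subset ?_ ?_)
        · intro e he
          obtain ⟨h4, h5⟩ := Finset.mem_filter.1 he
          exact Finset.mem_filter.2 ⟨h4, fun x hx => Finset.mem_of_mem_erase (h5 x hx)⟩
        · intro e he
          obtain ⟨w, hw, rfl⟩ := Finset.mem_image.1 he
          obtain ⟨h4, h5⟩ := Finset.mem_inter.1 hw
          refine Finset.mem_filter.2 ⟨mem_nbrs.1 h4, fun x hx => ?_⟩
          rcases Sym2.mem_iff.1 hx with rfl | rfl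
          · exact hv
          · exact h5
      · rw [Finset.disjoint_left]
        intro e he he'
        obtain ⟨w, -, rfl⟩ := Finset.mem_image.1 he'
        exact Finset.notMem_erase v A ((Finset.mem_filter.1 he).2 v (Sym2.mem_mk_left _ _))
    have h4 : (I (Q \ A.erase v)).card ≤ (I (Q \ A)).card + (nbrs T v \ A).card := by
      have hsub : I (Q \ A.erase v) ⊆ I (Q \ A) ∪ (nbrs T v \ A).image (fun w => s(v, w)) := by
        intro e he
        obtain ⟨h5, h6⟩ := Finset.mem_filter.1 he
        by_cases hve : v ∈ e
        · obtain ⟨w, rfl⟩ := hve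
          have hw := mem_nbrs.2 h5
          have hwv : w ≠ v := fun h => hT v (h ▸ hw)
          have h7 := h6 w (Sym2.mem_mk_right _ _)
          rw [Finset.mem_sdiff, Finset.mem_erase] at h7
          exact Finset.mem_union_right _ (Finset.mem_image.2
            ⟨w, Finset.mem_sdiff.2 ⟨hw, fun h => h7.2 ⟨hwv, h⟩⟩, rfl⟩)
        · refine Finset.mem_union_left _ (Finset.mem_filter.2 ⟨h5, fun x hx => ?_⟩)
          have h7 := h6 x hx
          rw [Finset.mem_sdiff, Finset.mem_erase] at h7
          exact Finset.mem_sdiff.2 ⟨h7.1, fun h => h7.2 ⟨fun hxv => hve (hxv ▸ hx), h⟩⟩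
      exact (Finset.card_le_card hsub).trans ((Finset.card_union_le _ _).trans
        (Nat.add_le_add_left Finset.card_image_le _))
    omega
  rcases le_total (Q \ A).card A.card with h | h
  · refine ⟨A, hAQ, ?_, key A hAQ hmin⟩
    have := Finset.card_sdiff_add_card_eq_card hAQ
    omega
  · refine ⟨Q \ A, Finset.sdiff_subset, ?_, key _ Finset.sdiff_subset ?_⟩
    · have := Finset.card_sdiff_add_card_eq_card hAQ
      omega
    · rw [Finset.sdiff_sdiff_eq_self hAQ, add_comm]
      exact hmin

end Covers

/-! ### Vertices of high degree -/

section HighDegree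

variable {V : Type*} [Fintype V] [DecidableEq V] {r : ℕ}

/-- The loss in the number of `m`-sets when `x` of their elements are given up. -/
lemma choose_sub_le {N m x : ℕ} (hm : m < N) (hx : x ≤ m) :
    (N.choose (m - x) : ℝ) ≤ ((m : ℝ) / (N - m)) ^ x * N.choose m := by
  have hNm : (0 : ℝ) < N - m := sub_pos.2 (by exact_mod_cast hm)
  induction x with
  | zero => simp
  | succ x ih =>
    have h1 := Nat.choose_succ_right_eq N (m - (x + 1))
    have e1 : m - (x + 1) + 1 = m - x := by omega
    rw [e1] at h1
    have h2 : (N.choose (m - x) : ℝ) * (m - x : ℕ) =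
        N.choose (m - (x + 1)) * ((N - (m - (x + 1)) : ℕ) : ℝ) := by exact_mod_cast h1
    have h3 : (N : ℝ) - m ≤ ((N - (m - (x + 1)) : ℕ) : ℝ) := by
      rw [← Nat.cast_sub hm.le]; exact_mod_cast (by omega)
    have h4 : ((m - x : ℕ) : ℝ) ≤ m := by exact_mod_cast Nat.sub_le _ _
    have h5 : (N.choose (m - (x + 1)) : ℝ) * (N - m) ≤ N.choose (m - x) * m :=
      calc _ ≤ (N.choose (m - (x + 1)) : ℝ) * ((N - (m - (x + 1)) : ℕ) : ℝ) := by gcongr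
        _ = N.choose (m - x) * (m - x : ℕ) := h2.symm
        _ ≤ _ := by gcongr
    rw [← le_div_iff₀ hNm] at h5
    refine h5.trans ?_
    rw [pow_succ, mul_div_assoc]
    calc (N.choose (m - x) : ℝ) * (m / (N - m)) ≤
        (((m : ℝ) / (N - m)) ^ x * N.choose m) * (m / (N - m)) := by
          have := ih (by omega)
          gcongr
      _ = _ := by ring

lemma factorial_le_card_injective {d : ℕ} {S : Finset V} (hS : d ≤ S.card) :
    d.factorial ≤ ((Fintype.piFinset fun _ : Fin d => S).filter Function.Injective).card := by
  have h1 : d.factorial ≤ Fintype.card (Fin d ↪ S) := by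
    rw [Fintype.card_embedding_eq, Fintype.card_fin, Fintype.card_coe]
    have h2 := Nat.descFactorial_le d hS
    rwa [Nat.descFactorial_self] at h2
  refine h1.trans ?_
  rw [← Finset.card_univ]
  refine Finset.card_le_card_of_injOn (fun f l => (f l : V)) ?_ ?_
  · intro f _
    refine Finset.mem_coe.2 (Finset.mem_filter.2 ⟨Fintype.mem_piFinset.2 fun l => (f l).2, ?_⟩)
    exact fun a b h => f.injective (Subtype.ext h)
  · intro f _ g _ h
    ext l
    exact congrFun h l

/-- Adding the monochromatic pairs `T` to the crossing pairs `H` creates no `K_{r+1}` that has a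
single monochromatic pair. -/
def NoRootedClique (c : V → Fin r) (T H : Finset (Sym2 V)) : Prop :=
  ∀ v w, (∀ j, c (w j) = j) → s(v, w (c v)) ∈ T → (∀ j, j ≠ c v → s(v, w j) ∈ H) →
    ¬ pairsOn w Finset.univ ⊆ H

/-- The pairs joining each `v ∈ Q` to the vertices of its tuple `y v`. -/
def starPairs {Q : Finset V} {d : ℕ} (y : Q → Fin r → Fin d → V) : Finset (Sym2 V) :=
  (Finset.univ : Finset (Q × Fin r × Fin d)).image fun z => s((z.1 : V), y z.1 z.2.1 z.2.2)

lemma card_starPairs {c : V → Fin r} {Q : Finset V} {d : ℕ} {y : Q → Fin r → Fin d → V}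
    (hy : ∀ v, y v ∈ classTuples c d) (hyQ : ∀ v j l, y v j l ∉ Q) :
    (starPairs y).card = r * d * Q.card := by
  rw [starPairs, Finset.card_image_of_injective, Finset.card_univ]
  · simp; ring
  · rintro ⟨v, j, l⟩ ⟨v', j', l'⟩ h
    rcases Sym2.eq_iff.1 h with ⟨h1, h2⟩ | ⟨h1, -⟩
    · obtain rfl : v = v' := Subtype.ext h1
      dsimp only at h2
      obtain ⟨h3, h4⟩ := mem_classTuples.1 (hy v)
      obtain rfl : j = j' := by rw [← h3 j l, h2, h3]
      rw [h4 j h2]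
    · exact absurd (h1 ▸ v.2) (hyQ _ _ _)

lemma notMem_starPairs {Q : Finset V} {d : ℕ} {y : Q → Fin r → Fin d → V}
    {e : Sym2 V} (he : ∀ x ∈ e, x ∉ Q) : e ∉ starPairs y := by
  intro h
  obtain ⟨z, -, rfl⟩ := Finset.mem_image.1 h
  exact he _ (Sym2.mem_mk_left _ _) z.1.2

/-- The tuples avoiding `Q` across which `H` has no `K_r`. Deleting pairs that meet `Q` from `H` does
not affect them. -/
def cliqueFreeTuplesOff (c : V → Fin r) (d : ℕ) (Q : Finset V) (H : Finset (Sym2 V)) :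
    Finset (Fin r → Fin d → V) :=
  (cliqueFreeTuples c d H).filter fun x => ∀ j l, x j l ∉ Q

lemma cliqueFreeTuplesOff_sdiff_subset (c : V → Fin r) {d : ℕ} {Q : Finset V}
    (H : Finset (Sym2 V)) (y : Q → Fin r → Fin d → V) :
    cliqueFreeTuplesOff c d Q (H \ starPairs y) ⊆ cliqueFreeTuples c d H := by
  intro x hx
  obtain ⟨h1, h2⟩ := Finset.mem_filter.1 hx
  obtain ⟨h3, h4⟩ := Finset.mem_filter.1 h1
  refine Finset.mem_filter.2 ⟨h3, fun t ht => h4 t fun e he => Finset.mem_sdiff.2 ⟨ht he, ?_⟩⟩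
  refine notMem_starPairs fun v hv => ?_
  obtain ⟨j, -, k, -, -, rfl⟩ := mem_pairsOn.1 he
  rcases Sym2.mem_iff.1 hv with rfl | rfl
  · exact h2 _ _
  · exact h2 _ _

open Classical in
/-- Counting the pairs `(T, H)` in which each vertex of `Q` has many neighbours in each colour class.
Choose for each vertex of `Q` a tuple of `d` neighbours per class, and delete the pairs from `Q` to
these tuples. No tuple has a `K_r` of `H` across it, so `(T, H)` with the choice is recovered from
the remaining pairs and one of at most `B` tuples for each vertex of `Q`. -/
theorem card_high_degree_le (c : V → Fin r) (i : Fin r) (Q : Finset V) (hQ : ∀ v ∈ Q, c v = i)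
    (d m : ℕ) {B : ℝ} (hB : 0 ≤ B) (P : Finset (Sym2 V) → Prop)
    (hP : ∀ T T₀, P T → T₀ ⊆ T → P T₀) (𝒢 : Finset (Finset (Sym2 V) × Finset (Sym2 V)))
    (h𝒢 : ∀ x ∈ 𝒢, x.1 ⊆ monoPairs c ∧ x.2 ⊆ crossPairs c ∧ x.1.card + x.2.card = m ∧ P x.1 ∧
      ((cliqueFreeTuples c d x.2).card : ℝ) ≤ B ∧ NoRootedClique c x.1 x.2 ∧
      ∀ v ∈ Q, d ≤ (nbrs x.1 v \ Q).card ∧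
        ∀ j, j ≠ i → d ≤ ((nbrs x.2 v).filter fun u => c u = j).card) :
    (𝒢.card : ℝ) * ((d.factorial : ℝ) ^ r) ^ Q.card ≤ B ^ Q.card *
      ∑ T ∈ (monoPairs c).powerset.filter P, (if T.card + r * d * Q.card ≤ m then
        ((crossPairs c).card.choose (m - (T.card + r * d * Q.card)) : ℝ) else 0) := by
  set N : Finset (Sym2 V) × Finset (Sym2 V) → V → Fin r → Finset V := fun x v j =>
    (nbrs (x.1 ∪ x.2) v \ Q).filter fun u => c u = j with hN
  set Val : Finset (Sym2 V) × Finset (Sym2 V) → Finset (Q → Fin r → Fin d → V) := fun x =>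
    Fintype.piFinset fun v : Q => Fintype.piFinset fun j =>
      (Fintype.piFinset fun _ : Fin d => N x v j).filter Function.Injective with hVal
  have hNd : ∀ x ∈ 𝒢, ∀ v ∈ Q, ∀ j, d ≤ (N x v j).card := by
    intro x hx v hv j
    obtain ⟨h1, h2, -, -, -, -, h7⟩ := h𝒢 x hx
    obtain ⟨h8, h9⟩ := h7 v hv
    by_cases hj : j = i
    · refine h8.trans (Finset.card_le_card fun u hu => ?_)
      obtain ⟨h10, h11⟩ := Finset.mem_sdiff.1 hu
      refine Finset.mem_filter.2 ⟨Finset.mem_sdiff.2 ⟨mem_nbrs.2 (Finset.mem_union_left _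
        (mem_nbrs.1 h10)), h11⟩, ?_⟩
      rw [hj, ← hQ v hv]
      exact (mk_mem_monoPairs.1 (h1 (mem_nbrs.1 h10))).2.symm
    · refine (h9 j hj).trans (Finset.card_le_card fun u hu => ?_)
      obtain ⟨h10, h11⟩ := Finset.mem_filter.1 hu
      refine Finset.mem_filter.2 ⟨Finset.mem_sdiff.2 ⟨mem_nbrs.2 (Finset.mem_union_right _
        (mem_nbrs.1 h10)), fun h => hj ?_⟩, h11⟩
      rw [← h11, hQ u h]
  have hValcard : ∀ x ∈ 𝒢, ((d.factorial : ℝ) ^ r) ^ Q.card ≤ (Val x).card := by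
    intro x hx
    have : (d.factorial ^ r) ^ Q.card ≤ (Val x).card := by
      simp only [hVal]
      rw [Fintype.card_piFinset]
      calc (d.factorial ^ r) ^ Q.card = ∏ _v : Q, ∏ _j : Fin r, d.factorial := by simp
        _ ≤ _ := by
          refine Finset.prod_le_prod' fun v _ => ?_
          rw [Fintype.card_piFinset]
          exact Finset.prod_le_prod' fun j _ => factorial_le_card_injective (hNd x hx v v.2 j)
    exact_mod_cast this
  set 𝒟 := (((monoPairs c).powerset.filter P) ×ˢ (crossPairs c).powerset).filter fun z =>
    z.1.card + r * d * Q.card + z.2.card = m ∧ ((cliqueFreeTuplesOff c d Q z.2).card : ℝ) ≤ B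
    with h𝒟
  -- double counting: `src` holds the pairs `(T, H)` with a choice of tuples, and `tgt` what is left
  -- of `(T, H)` with a choice of clique-free tuples
  set src : Finset (Σ _ : Finset (Sym2 V) × Finset (Sym2 V), Q → Fin r → Fin d → V) :=
    𝒢.sigma Val with hsrc
  set tgt : Finset (Σ _ : Finset (Sym2 V) × Finset (Sym2 V), Q → Fin r → Fin d → V) :=
    𝒟.sigma fun z => Fintype.piFinset fun _ : Q => cliqueFreeTuplesOff c d Q z.2 with htgt
  -- the chosen neighbours form legitimate tuples, joined to `Q` inside `T ∪ H`
  have hy : ∀ x ∈ 𝒢, ∀ y ∈ Val x, (∀ v, y v ∈ classTuples c d) ∧ (∀ v j l, y v j l ∉ Q) ∧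
      starPairs y ⊆ x.1 ∪ x.2 ∧ ∀ v, y v ∈ cliqueFreeTuples c d x.2 := by
    intro x hx y hyx
    obtain ⟨h1, h2, h3, h4, h5, h6, h7⟩ := h𝒢 x hx
    have hmem : ∀ (v : Q) j l, y v j l ∈ N x v j := fun v j l =>
      Fintype.mem_piFinset.1 (Finset.mem_filter.1 (Fintype.mem_piFinset.1
        (Fintype.mem_piFinset.1 hyx v) j)).1 l
    have hinj : ∀ v j, Function.Injective (y v j) := fun v j =>
      (Finset.mem_filter.1 (Fintype.mem_piFinset.1 (Fintype.mem_piFinset.1 hyx v) j)).2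
    have hcol : ∀ (v : Q) j l, c (y v j l) = j := fun v j l => (Finset.mem_filter.1 (hmem v j l)).2
    have hedge : ∀ (v : Q) j l, s((v : V), y v j l) ∈ x.1 ∪ x.2 := fun v j l =>
      mem_nbrs.1 (Finset.mem_sdiff.1 (Finset.mem_filter.1 (hmem v j l)).1).1
    have hcl : ∀ v, y v ∈ classTuples c d := fun v => mem_classTuples.2 ⟨hcol v, hinj v⟩
    refine ⟨hcl, fun v j l => (Finset.mem_sdiff.1 (Finset.mem_filter.1 (hmem v j l)).1).2, ?_,
      fun v => Finset.mem_filter.2 ⟨hcl v, fun t => ?_⟩⟩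
    · intro e he
      obtain ⟨z, -, rfl⟩ := Finset.mem_image.1 he
      exact hedge _ _ _
    · refine h6 v (fun j => y v j (t j)) (fun j => hcol v j _) ?_ fun j hj => ?_
      · refine (Finset.mem_union.1 (hedge v (c v) (t (c v)))).resolve_right fun h => ?_
        exact mk_mem_crossPairs.1 (h2 h) (hcol _ _ _).symm
      · refine (Finset.mem_union.1 (hedge v j (t j))).resolve_left fun h => hj ?_
        rw [(mk_mem_monoPairs.1 (h1 h)).2, hcol]
  have hinj : src.card ≤ tgt.card := by
    refine Finset.card_le_card_of_injOn (fun z => ⟨(z.1.1 \ starPairs z.2, z.1.2 \ starPairs z.2),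
      z.2⟩) ?_ ?_
    · rintro ⟨x, y⟩ hz
      obtain ⟨hx, hyx⟩ := Finset.mem_sigma.1 (Finset.mem_coe.1 hz)
      dsimp only at hx hyx
      obtain ⟨h1, h2, h3, h4, h5, h6, h7⟩ := h𝒢 x hx
      obtain ⟨k1, k2, k3, k4⟩ := hy x hx y hyx
      refine Finset.mem_coe.2 (Finset.mem_sigma.2 ⟨Finset.mem_filter.2 ⟨Finset.mem_product.2
        ⟨Finset.mem_filter.2 ⟨Finset.mem_powerset.2 (Finset.sdiff_subset.trans h1),
          hP _ _ h4 Finset.sdiff_subset⟩, Finset.mem_powerset.2 (Finset.sdiff_subset.trans h2)⟩,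
          ?_, ?_⟩, Fintype.mem_piFinset.2 fun v => Finset.mem_filter.2 ⟨?_, k2 v⟩⟩)
      · dsimp only
        have hdisj : Disjoint x.1 x.2 := by
          rw [Finset.disjoint_left]
          intro e he he'
          exact (Finset.mem_filter.1 (h2 he')).2 (Finset.mem_filter.1 (h1 he)).2.2
        rw [← card_starPairs k1 k2, add_right_comm, ← Finset.card_union_of_disjoint
          (hdisj.mono Finset.sdiff_subset Finset.sdiff_subset), ← Finset.union_sdiff_distrib,
          Finset.card_sdiff_add_card_eq_card k3, Finset.card_union_of_disjoint hdisj, h3]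
      · exact (Nat.cast_le.2 (Finset.card_le_card
          (cliqueFreeTuplesOff_sdiff_subset c x.2 y))).trans h5
      · obtain ⟨k5, k6⟩ := Finset.mem_filter.1 (k4 v)
        exact Finset.mem_filter.2 ⟨k5, fun t ht => k6 t (ht.trans Finset.sdiff_subset)⟩
    · rintro ⟨x, y⟩ hz ⟨x', y'⟩ hz' h
      obtain ⟨hx, hyx⟩ := Finset.mem_sigma.1 (Finset.mem_coe.1 hz)
      obtain ⟨hx', hyx'⟩ := Finset.mem_sigma.1 (Finset.mem_coe.1 hz')
      dsimp only at hx hyx hx' hyx' h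
      simp only [Sigma.mk.injEq, heq_eq_eq, Prod.mk.injEq] at h
      obtain ⟨⟨e1, e2⟩, rfl⟩ := h
      obtain ⟨-, -, k3, -⟩ := hy x hx y hyx
      obtain ⟨-, -, k3', -⟩ := hy x' hx' y hyx'
      obtain ⟨h1, h2, -⟩ := h𝒢 x hx
      obtain ⟨h1', h2', -⟩ := h𝒢 x' hx'
      have hT : ∀ z : Finset (Sym2 V) × Finset (Sym2 V), z.1 ⊆ monoPairs c → z.2 ⊆ crossPairs c →
          starPairs y ⊆ z.1 ∪ z.2 →
          z.1 = (z.1 \ starPairs y) ∪ (starPairs y ∩ monoPairs c) ∧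
          z.2 = (z.2 \ starPairs y) ∪ (starPairs y ∩ crossPairs c) := by
        intro z hz1 hz2 hz3
        constructor
        · ext e
          simp only [Finset.mem_union, Finset.mem_sdiff, Finset.mem_inter]
          constructor
          · intro he
            by_cases h : e ∈ starPairs y
            · exact Or.inr ⟨h, hz1 he⟩
            · exact Or.inl ⟨he, h⟩
          · rintro (⟨he, -⟩ | ⟨he, hm⟩)
            · exact he
            · refine (Finset.mem_union.1 (hz3 he)).resolve_right fun h => ?_
              exact (Finset.mem_filter.1 (hz2 h)).2 (Finset.mem_filter.1 hm).2.2
        · ext e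
          simp only [Finset.mem_union, Finset.mem_sdiff, Finset.mem_inter]
          constructor
          · intro he
            by_cases h : e ∈ starPairs y
            · exact Or.inr ⟨h, hz2 he⟩
            · exact Or.inl ⟨he, h⟩
          · rintro (⟨he, -⟩ | ⟨he, hm⟩)
            · exact he
            · refine (Finset.mem_union.1 (hz3 he)).resolve_left fun h => ?_
              exact (Finset.mem_filter.1 hm).2 (Finset.mem_filter.1 (hz1 h)).2.2
      obtain ⟨t1, t2⟩ := hT x h1 h2 k3
      obtain ⟨t1', t2'⟩ := hT x' h1' h2' k3'
      have : x = x' := Prod.ext (by rw [t1, t1', e1]) (by rw [t2, t2', e2])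
      rw [this]
  have hsrc_card : (𝒢.card : ℝ) * ((d.factorial : ℝ) ^ r) ^ Q.card ≤ src.card := by
    rw [hsrc, Finset.card_sigma]
    push_cast
    rw [← nsmul_eq_mul]
    exact Finset.card_nsmul_le_sum _ _ _ hValcard
  have htgt_card : (tgt.card : ℝ) ≤ B ^ Q.card * 𝒟.card := by
    rw [htgt, Finset.card_sigma]
    push_cast
    rw [mul_comm, ← nsmul_eq_mul]
    refine Finset.sum_le_card_nsmul _ _ _ fun z hz => ?_
    rw [Fintype.card_piFinset]
    simp only [Finset.prod_const, Finset.card_univ, Fintype.card_coe]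
    push_cast
    exact pow_le_pow_left₀ (by positivity) (Finset.mem_filter.1 hz).2.2 _
  have h𝒟_card : (𝒟.card : ℝ) ≤ ∑ T ∈ (monoPairs c).powerset.filter P,
      (if T.card + r * d * Q.card ≤ m then
        ((crossPairs c).card.choose (m - (T.card + r * d * Q.card)) : ℝ) else 0) := by
    have hsub : 𝒟 ⊆ ((monoPairs c).powerset.filter P).biUnion fun T =>
        if T.card + r * d * Q.card ≤ m then
          ((crossPairs c).powersetCard (m - (T.card + r * d * Q.card))).image fun H => (T, H)
        else ∅ := by
      intro z hz
      obtain ⟨h1, h2, -⟩ := Finset.mem_filter.1 hz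
      obtain ⟨h3, h4⟩ := Finset.mem_product.1 h1
      refine Finset.mem_biUnion.2 ⟨z.1, h3, ?_⟩
      rw [if_pos (by omega)]
      exact Finset.mem_image.2 ⟨z.2, Finset.mem_powersetCard.2 ⟨Finset.mem_powerset.1 h4,
        by omega⟩, rfl⟩
    have h1 := (Finset.card_le_card hsub).trans Finset.card_biUnion_le
    refine (Nat.cast_le.2 h1).trans ?_
    push_cast
    refine Finset.sum_le_sum fun T _ => ?_
    split_ifs
    · exact_mod_cast Finset.card_image_le.trans (Finset.card_powersetCard _ _).le
    · simp
  calc _ ≤ (src.card : ℝ) := hsrc_card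
    _ ≤ tgt.card := by exact_mod_cast hinj
    _ ≤ _ := htgt_card
    _ ≤ _ := by gcongr

end HighDegree

/-! ### Almost all crossing pairs present -/

section Dense

variable {V : Type*} [Fintype V] [DecidableEq V] {r : ℕ}

/-- If every transversal of the sets `W j` has a pair of `X` on the colours in `A`, then `X` is
large, since each pair lies on at most a proportion `1 / d ^ 2` of the transversals. -/
lemma sq_le_card_of_blocking {c : V → Fin r} {W : Fin r → Finset V}
    (hW : ∀ j, ∀ v ∈ W j, c v = j) (hne : ∀ j, (W j).Nonempty) (A : Finset (Fin r)) {d : ℕ}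
    (hd : ∀ j ∈ A, d ≤ (W j).card) (X : Finset (Sym2 V))
    (hX : ∀ w : Fin r → V, (∀ j, w j ∈ W j) → ∃ e ∈ X, e ∈ pairsOn w A) : d ^ 2 ≤ X.card := by
  set P := Fintype.piFinset W with hP
  have hPpos : 0 < P.card := by
    rw [hP, Fintype.card_piFinset]
    exact Finset.prod_pos fun j _ => (hne j).card_pos
  have hfib : ∀ e ∈ X, (P.filter fun w => e ∈ pairsOn w A).card * d ^ 2 ≤ P.card := by
    intro e _
    rcases (P.filter fun w => e ∈ pairsOn w A).eq_empty_or_nonempty with h | ⟨w₀, hw₀⟩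
    · rw [h]; simp
    obtain ⟨h1, h2⟩ := Finset.mem_filter.1 hw₀
    obtain ⟨j, hj, k, hk, hjk, rfl⟩ := mem_pairsOn.1 h2
    have hcol : ∀ w ∈ P, ∀ l, c (w l) = l := fun w hw l => hW l _ (Fintype.mem_piFinset.1 hw l)
    have hfix : ∀ w ∈ P.filter (fun w => s(w₀ j, w₀ k) ∈ pairsOn w A), w j = w₀ j ∧ w k = w₀ k := by
      intro w hw
      obtain ⟨h3, h4⟩ := Finset.mem_filter.1 hw
      obtain ⟨j', -, k', -, -, h⟩ := mem_pairsOn.1 h4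
      rcases Sym2.eq_iff.1 h with ⟨h5, h6⟩ | ⟨h5, h6⟩
      · have e1 : j' = j := by rw [← hcol w h3 j', h5, hcol _ h1]
        have e2 : k' = k := by rw [← hcol w h3 k', h6, hcol _ h1]
        exact ⟨e1 ▸ h5, e2 ▸ h6⟩
      · have e1 : j' = k := by rw [← hcol w h3 j', h5, hcol _ h1]
        have e2 : k' = j := by rw [← hcol w h3 k', h6, hcol _ h1]
        exact ⟨e2 ▸ h6, e1 ▸ h5⟩
    calc _ ≤ (P.filter fun w => s(w₀ j, w₀ k) ∈ pairsOn w A).card *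
          ((W j).card * (W k).card) := by
          rw [sq]; gcongr
          · exact hd j hj
          · exact hd k hk
      _ = ((P.filter fun w => s(w₀ j, w₀ k) ∈ pairsOn w A) ×ˢ (W j ×ˢ W k)).card := by
          rw [Finset.card_product, Finset.card_product]
      _ ≤ P.card := by
          refine Finset.card_le_card_of_injOn
            (fun z => Function.update (Function.update z.1 j z.2.1) k z.2.2) ?_ ?_
          · rintro ⟨w, a, b⟩ hz
            obtain ⟨h3, h4⟩ := Finset.mem_product.1 (Finset.mem_coe.1 hz)
            obtain ⟨h5, h6⟩ := Finset.mem_product.1 h4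
            refine Finset.mem_coe.2 (Fintype.mem_piFinset.2 fun l => ?_)
            dsimp only at h3 h5 h6 ⊢
            by_cases hl : l = k
            · subst hl; simpa using h6
            · rw [Function.update_of_ne hl]
              by_cases hl' : l = j
              · subst hl'; simpa using h5
              · rw [Function.update_of_ne hl']
                exact Fintype.mem_piFinset.1 (Finset.mem_filter.1 h3).1 l
          · rintro ⟨w, a, b⟩ hz ⟨w', a', b'⟩ hz' h
            obtain ⟨h3, -⟩ := Finset.mem_product.1 (Finset.mem_coe.1 hz)
            obtain ⟨h3', -⟩ := Finset.mem_product.1 (Finset.mem_coe.1 hz')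
            obtain ⟨f1, f2⟩ := hfix w h3
            obtain ⟨f1', f2'⟩ := hfix w' h3'
            dsimp only at h
            have hb : b = b' := by simpa using congrFun h k
            have ha : a = a' := by
              have := congrFun h j
              rw [Function.update_of_ne hjk, Function.update_of_ne hjk] at this
              simpa using this
            refine Prod.ext (funext fun l => ?_) (Prod.ext ha hb)
            dsimp only
            by_cases hl : l = k
            · rw [hl, f2, f2']
            by_cases hl' : l = j
            · rw [hl', f1, f1']
            have := congrFun h l
            rwa [Function.update_of_ne hl, Function.update_of_ne hl, Function.update_of_ne hl',
              Function.update_of_ne hl'] at this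
  have hcov : P ⊆ X.biUnion fun e => P.filter fun w => e ∈ pairsOn w A := by
    intro w hw
    obtain ⟨e, h1, h2⟩ := hX w (Fintype.mem_piFinset.1 hw)
    exact Finset.mem_biUnion.2 ⟨e, h1, Finset.mem_filter.2 ⟨hw, h2⟩⟩
  have h1 : P.card ≤ ∑ e ∈ X, (P.filter fun w => e ∈ pairsOn w A).card :=
    (Finset.card_le_card hcov).trans Finset.card_biUnion_le
  have h2 : P.card * d ^ 2 ≤ X.card * P.card := by
    calc P.card * d ^ 2 ≤ (∑ e ∈ X, (P.filter fun w => e ∈ pairsOn w A).card) * d ^ 2 := by gcongr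
      _ = ∑ e ∈ X, (P.filter fun w => e ∈ pairsOn w A).card * d ^ 2 := Finset.sum_mul _ _ _
      _ ≤ _ := by
        rw [← smul_eq_mul]
        exact Finset.sum_le_card_nsmul _ _ _ hfib
  rw [mul_comm] at h2
  exact Nat.le_of_mul_le_mul_right h2 hPpos

/-- The monochromatic pairs `T` and the crossing pairs `H` of a graph with `m` edges, not properly
coloured by `c`, in which each vertex has at least as many neighbours in each other colour class as
in its own, and which has no `K_{r+1}` with a single monochromatic pair. -/
structure IsBadPair (c : V → Fin r) (m : ℕ) (T H : Finset (Sym2 V)) : Prop where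
  subset_mono : T ⊆ monoPairs c
  subset_cross : H ⊆ crossPairs c
  card_add : T.card + H.card = m
  nonempty : T.Nonempty
  noClique : NoRootedClique c T H
  unfriendly : ∀ v j, j ≠ c v → (nbrs T v).card ≤ ((nbrs H v).filter fun u => c u = j).card

/-- If `H` misses few crossing pairs, then degrees in `T` are small: a vertex of degree at least `d`
in `T` has at least `d` neighbours in each class, and `H` has a `K_r` across these. -/
lemma card_nbrs_lt_of_dense {c : V → Fin r} {m : ℕ} {T H : Finset (Sym2 V)}
    (h : IsBadPair c m T H) {d : ℕ} (hd : (crossPairs c \ H).card < d ^ 2) (v : V) :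
    (nbrs T v).card < d := by
  by_contra! hcon
  have hd0 : 0 < d := by
    rcases Nat.eq_zero_or_pos d with rfl | h0
    · simp at hd
    · exact h0
  set W : Fin r → Finset V := fun j =>
    if j = c v then nbrs T v else (nbrs H v).filter fun u => c u = j with hWdef
  have hWd : ∀ j, d ≤ (W j).card := by
    intro j
    simp only [hWdef]
    split_ifs with hj
    · exact hcon
    · exact hcon.trans (h.unfriendly v j hj)
  have hWc : ∀ j, ∀ u ∈ W j, c u = j := by
    intro j u hu
    simp only [hWdef] at hu
    split_ifs at hu with hj
    · rw [hj]; exact (mk_mem_monoPairs.1 (h.subset_mono (mem_nbrs.1 hu))).2.symm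
    · exact (Finset.mem_filter.1 hu).2
  refine absurd (sq_le_card_of_blocking hWc (fun j => Finset.card_pos.1 (hd0.trans_le (hWd j)))
    Finset.univ (fun j _ => hWd j) (crossPairs c \ H) fun w hw => ?_) (not_le.2 hd)
  have hcol : ∀ j, c (w j) = j := fun j => hWc j _ (hw j)
  have h1 := h.noClique v w hcol (mem_nbrs.1 (by have := hw (c v); simpa [hWdef] using this))
    fun j hj => by
      have := hw j
      simp only [hWdef, if_neg hj] at this
      exact mem_nbrs.1 (Finset.mem_filter.1 this).1
  obtain ⟨e, he, he'⟩ := Finset.not_subset.1 h1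
  exact ⟨e, Finset.mem_sdiff.2 ⟨pairsOn_subset_crossPairs hcol _ he, he'⟩, he⟩

/-- If `H` misses few crossing pairs, then each pair of `T` has an end that misses many: otherwise
its ends have at least `d` common neighbours in each other class, and `H` has a clique across
these. -/
lemma exists_many_missing_of_dense {c : V → Fin r} {m : ℕ} {T H : Finset (Sym2 V)}
    (h : IsBadPair c m T H) {d : ℕ} (hd0 : 0 < d) (hd : (crossPairs c \ H).card < d ^ 2)
    (hcl : ∀ j, 3 * d ≤ (colorClass c j).card) {e : Sym2 V} (he : e ∈ T) :
    ∃ v ∈ e, d ≤ (edgesAt (crossPairs c \ H) v).card := by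
  induction e with
  | h u v =>
  by_contra! hcon
  have hu := hcon u (Sym2.mem_mk_left _ _)
  have hv := hcon v (Sym2.mem_mk_right _ _)
  rw [card_edgesAt] at hu hv
  obtain ⟨huv, hcuv⟩ := mk_mem_monoPairs.1 (h.subset_mono he)
  set X := crossPairs c \ H with hX
  set W : Fin r → Finset V := fun j =>
    if j = c u then {v} else (colorClass c j \ nbrs X u) \ nbrs X v with hWdef
  have hWd : ∀ j ∈ Finset.univ.erase (c u), d ≤ (W j).card := by
    intro j hj
    simp only [hWdef, if_neg (Finset.ne_of_mem_erase hj)]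
    have h1 := Finset.le_card_sdiff (nbrs X u) (colorClass c j)
    have h2 := Finset.le_card_sdiff (nbrs X v) (colorClass c j \ nbrs X u)
    have := hcl j
    omega
  have hWc : ∀ j, ∀ x ∈ W j, c x = j := by
    intro j x hx
    simp only [hWdef] at hx
    split_ifs at hx with hj
    · rw [hj, Finset.mem_singleton.1 hx, hcuv]
    · exact (Finset.mem_filter.1 (Finset.mem_sdiff.1 (Finset.mem_sdiff.1 hx).1).1).2
  have hadj : ∀ j, j ≠ c u → ∀ x ∈ W j, s(u, x) ∈ H ∧ s(v, x) ∈ H := by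
    intro j hj x hx
    have hxc := hWc j x hx
    simp only [hWdef, if_neg hj] at hx
    obtain ⟨h1, h2⟩ := Finset.mem_sdiff.1 hx
    obtain ⟨h3, h4⟩ := Finset.mem_sdiff.1 h1
    constructor
    · by_contra hH
      exact h4 (mem_nbrs.2 (Finset.mem_sdiff.2 ⟨mk_mem_crossPairs.2 (by rw [hxc]; exact hj.symm),
        hH⟩))
    · by_contra hH
      exact h2 (mem_nbrs.2 (Finset.mem_sdiff.2 ⟨mk_mem_crossPairs.2
        (by rw [hxc, ← hcuv]; exact hj.symm), hH⟩))
  refine absurd (sq_le_card_of_blocking hWc (fun j => ?_)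
    (Finset.univ.erase (c u)) hWd X fun w hw => ?_) (not_le.2 hd)
  · by_cases hj : j = c u
    · simp [hWdef, hj]
    · exact Finset.card_pos.1 (hd0.trans_le (hWd j (Finset.mem_erase.2 ⟨hj, Finset.mem_univ _⟩)))
  have hcol : ∀ j, c (w j) = j := fun j => hWc j _ (hw j)
  have hwu : w (c u) = v := by have := hw (c u); simpa [hWdef] using this
  have h1 := h.noClique u w hcol (by rwa [hwu]) fun j hj => (hadj j hj _ (hw j)).1
  obtain ⟨e, he, he'⟩ := Finset.not_subset.1 h1
  refine ⟨e, Finset.mem_sdiff.2 ⟨pairsOn_subset_crossPairs hcol _ he, he'⟩, ?_⟩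
  obtain ⟨j, -, k, -, hjk, rfl⟩ := mem_pairsOn.1 he
  refine mem_pairsOn.2 ⟨j, Finset.mem_erase.2 ⟨fun hj => he' ?_, Finset.mem_univ _⟩, k,
    Finset.mem_erase.2 ⟨fun hk => he' ?_, Finset.mem_univ _⟩, hjk, rfl⟩
  · subst hj
    rw [hwu]
    exact (hadj k hjk.symm _ (hw k)).2
  · subst hk
    rw [hwu, Sym2.eq_swap]
    exact (hadj j hjk _ (hw j)).2

/-- If the crossing pairs `B` are to be missing and `A` are the monochromatic pairs, then the set `R`
of the other missing crossing pairs is smaller by at least `z` than the complement of an `m`-set. As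
`m`-sets miss only few pairs, this costs a factor `Z ^ z`. -/
lemma card_extensions_le {E A B : Finset (Sym2 V)} {m z : ℕ} (hz : 0 < z)
    (hAB : A.card + z ≤ B.card) {Z : ℝ} (hZ1 : 1 ≤ Z) (hm : Z * ((E.card : ℝ) - m) ≤ m) :
    ((E.powerset.filter fun R => R.card + B.card + m = E.card + A.card).card : ℝ) ≤
      (Z⁻¹) ^ z * E.card.choose m := by
  rcases (E.powerset.filter fun R => R.card + B.card + m = E.card + A.card).eq_empty_or_nonempty
    with h | ⟨R₀, hR₀⟩
  · rw [h]; simp only [Finset.card_empty, Nat.cast_zero]; positivity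
  have h0 := (Finset.mem_filter.1 hR₀).2
  have hmN : m + z ≤ E.card := by omega
  have hm0 : 0 < m := by
    by_contra! hm0
    obtain rfl : m = 0 := by omega
    have : (0 : ℝ) < E.card := by exact_mod_cast (by omega : 0 < E.card)
    simp only [Nat.cast_zero, sub_zero] at hm
    nlinarith
  set x := B.card - A.card with hx
  have hsub : (E.powerset.filter fun R => R.card + B.card + m = E.card + A.card) ⊆
      E.powersetCard ((E.card - m) - x) := by
    intro R hR
    obtain ⟨h1, h2⟩ := Finset.mem_filter.1 hR
    exact Finset.mem_powersetCard.2 ⟨Finset.mem_powerset.1 h1, by omega⟩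
  have h1 := (Finset.card_le_card hsub).trans (Finset.card_powersetCard _ _).le
  have h2 := choose_sub_le (N := E.card) (m := E.card - m) (x := x) (by omega) (by omega)
  rw [Nat.choose_symm (by omega : m ≤ E.card), Nat.cast_sub (by omega : m ≤ E.card),
    sub_sub_cancel] at h2
  have hm0' : (0 : ℝ) < m := by exact_mod_cast hm0
  have hmN' : (m : ℝ) ≤ E.card := by exact_mod_cast (by omega : m ≤ E.card)
  have hZ0 : 0 < Z := by linarith
  have h3 : ((E.card : ℝ) - m) / m ≤ Z⁻¹ := by
    rw [div_le_iff₀ hm0', inv_mul_eq_div, le_div_iff₀ hZ0]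
    linarith
  calc ((E.powerset.filter fun R => R.card + B.card + m = E.card + A.card).card : ℝ)
      ≤ (E.card.choose ((E.card - m) - x) : ℝ) := by exact_mod_cast h1
    _ ≤ _ := h2
    _ ≤ (Z⁻¹) ^ x * E.card.choose m := by
        gcongr
    _ ≤ _ := by
        gcongr ?_ * _
        exact pow_le_pow_of_le_one (by positivity) (inv_le_one_of_one_le₀ hZ1) (by omega)

/-- The set `S` of the vertices missing at least `4 * u` crossing pairs meets every pair of `T`, and
the crossing pairs missing at `S` outnumber `T` by at least `u` for each vertex of `S`. -/
lemma dense_cover {c : V → Fin r} {m : ℕ} {T H : Finset (Sym2 V)}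
    (h : IsBadPair c m T H) {u : ℕ} (hu : 0 < u) (hcl : ∀ j, 12 * u ≤ (colorClass c j).card)
    (hd : (crossPairs c \ H).card < u ^ 2) :
    ∃ S : Finset V, S.Nonempty ∧ T ⊆ edgesTouching Finset.univ S ∧
      T.card + S.card * u ≤ (edgesTouching (crossPairs c \ H) S).card := by
  set X := crossPairs c \ H with hX
  set S := Finset.univ.filter fun v => 4 * u ≤ (edgesAt X v).card with hS
  have hTS : ∀ e ∈ T, ∃ v ∈ S, v ∈ e := by
    intro e he
    obtain ⟨v, hv, hv'⟩ := exists_many_missing_of_dense h (d := 4 * u) (by omega)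
      (hd.trans_le (by rw [mul_pow]; nlinarith [sq_nonneg u]))
      (fun j => by have := hcl j; omega) he
    exact ⟨v, Finset.mem_filter.2 ⟨Finset.mem_univ _, hv'⟩, hv⟩
  refine ⟨S, ?_, ?_, ?_⟩
  · obtain ⟨e, he⟩ := h.nonempty
    obtain ⟨v, hv, -⟩ := hTS e he
    exact ⟨v, hv⟩
  · exact fun e he => mem_edgesTouching.2 ⟨Finset.mem_univ _, hTS e he⟩
  · have h1 : T.card ≤ S.card * u := by
      have hsub : T ⊆ S.biUnion fun v => edgesAt T v := by
        intro e he
        obtain ⟨v, hv, hv'⟩ := hTS e he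
        exact Finset.mem_biUnion.2 ⟨v, hv, Finset.mem_filter.2 ⟨he, hv'⟩⟩
      refine (Finset.card_le_card hsub).trans (Finset.card_biUnion_le_card_mul _ _ _ fun v _ => ?_)
      rw [card_edgesAt]
      exact (card_nbrs_lt_of_dense h hd v).le
    have h2 : S.card * (4 * u) ≤ 2 * (edgesTouching X S).card := by
      refine le_trans ?_ (sum_card_edgesAt_le (edgesTouching X S) S)
      rw [← smul_eq_mul]
      refine Finset.card_nsmul_le_sum _ _ _ fun v hv => ?_
      refine (Finset.mem_filter.1 hv).2.trans (Finset.card_le_card fun e he => ?_)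
      obtain ⟨h3, h4⟩ := Finset.mem_filter.1 he
      exact Finset.mem_filter.2 ⟨mem_edgesTouching.2 ⟨h3, v, hv, h4⟩, h4⟩
    nlinarith

/-- Counting when almost all crossing pairs are present: the vertices missing many crossing pairs
cover `T`, and they miss far more crossing pairs than `T` has pairs. -/
theorem card_dense_le (c : V → Fin r) {m u : ℕ} (hu : 0 < u)
    (hcl : ∀ j, 12 * u ≤ (colorClass c j).card) {Z : ℝ} (hZ1 : 1 ≤ Z)
    (hZ : 8 ^ Fintype.card V ≤ Z ^ u) (hm : Z * (((crossPairs c).card : ℝ) - m) ≤ m)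
    (𝒢 : Finset (Finset (Sym2 V) × Finset (Sym2 V)))
    (h𝒢 : ∀ x ∈ 𝒢, IsBadPair c m x.1 x.2 ∧ (crossPairs c \ x.2).card < u ^ 2) :
    (𝒢.card : ℝ) ≤ (1 / 2) ^ Fintype.card V * (crossPairs c).card.choose m := by
  set n := Fintype.card V with hn
  set E := crossPairs c with hE
  have hex : ∀ x ∈ 𝒢, ∃ S : Finset V, S.Nonempty ∧ x.1 ⊆ edgesTouching Finset.univ S ∧
      x.1.card + S.card * u ≤ (edgesTouching (E \ x.2) S).card := fun x hx =>
    dense_cover (h𝒢 x hx).1 hu hcl (h𝒢 x hx).2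
  choose! S hSne hTS hS using hex
  set fib : Finset V → Finset (Sym2 V) → Finset (Finset (Sym2 V)) := fun Q A =>
    if (A ∩ monoPairs c).card + Q.card * u ≤ (A ∩ E).card then
      E.powerset.filter fun R => R.card + (A ∩ E).card + m = E.card + (A ∩ monoPairs c).card
    else ∅ with hfib
  set tgt : Finset (Σ _ : Finset V, Σ _ : Finset (Sym2 V), Finset (Sym2 V)) :=
    (Finset.univ.erase ∅).sigma fun Q => (edgesTouching Finset.univ Q).powerset.sigma fun A =>
      fib Q A with htgt
  have hdisj : Disjoint (monoPairs c) E := by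
    rw [Finset.disjoint_left]
    intro e he he'
    exact (Finset.mem_filter.1 he').2 (Finset.mem_filter.1 he).2.2
  have hA1 : ∀ x ∈ 𝒢, (x.1 ∪ edgesTouching (E \ x.2) (S x)) ∩ monoPairs c = x.1 := by
    intro x hx
    ext e
    simp only [Finset.mem_inter, Finset.mem_union]
    constructor
    · rintro ⟨h1 | h1, h2⟩
      · exact h1
      · exact absurd (Finset.mem_sdiff.1 (mem_edgesTouching.1 h1).1).1
          (Finset.disjoint_left.1 hdisj h2)
    · exact fun h1 => ⟨Or.inl h1, (h𝒢 x hx).1.subset_mono h1⟩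
  have hA2 : ∀ x ∈ 𝒢, (x.1 ∪ edgesTouching (E \ x.2) (S x)) ∩ E =
      edgesTouching (E \ x.2) (S x) := by
    intro x hx
    ext e
    simp only [Finset.mem_inter, Finset.mem_union]
    constructor
    · rintro ⟨h1 | h1, h2⟩
      · exact absurd h2 (Finset.disjoint_left.1 hdisj ((h𝒢 x hx).1.subset_mono h1))
      · exact h1
    · exact fun h1 => ⟨Or.inr h1, (Finset.mem_sdiff.1 (mem_edgesTouching.1 h1).1).1⟩
  -- encode `(T, H)` by `S`, by `T` with the missing pairs at `S`, and by the other missing pairs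
  have hsrc : 𝒢.card ≤ tgt.card := by
    refine Finset.card_le_card_of_injOn (fun x => ⟨S x, x.1 ∪ edgesTouching (E \ x.2) (S x),
      (E \ x.2) \ edgesTouching (E \ x.2) (S x)⟩) ?_ ?_
    · intro x hx
      have hx := Finset.mem_coe.1 hx
      refine Finset.mem_coe.2 (Finset.mem_sigma.2 ⟨Finset.mem_erase.2
        ⟨(hSne x hx).ne_empty, Finset.mem_univ _⟩, Finset.mem_sigma.2
        ⟨Finset.mem_powerset.2 (Finset.union_subset (hTS x hx) fun e he => ?_), ?_⟩⟩)
      · exact mem_edgesTouching.2 ⟨Finset.mem_univ _, (mem_edgesTouching.1 he).2⟩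
      · simp only [hfib]
        rw [hA1 x hx, hA2 x hx, if_pos (hS x hx)]
        refine Finset.mem_filter.2 ⟨Finset.mem_powerset.2
          (Finset.sdiff_subset.trans Finset.sdiff_subset), ?_⟩
        rw [Finset.card_sdiff_add_card_eq_card fun e he => (mem_edgesTouching.1 he).1]
        have h1 := Finset.card_sdiff_add_card_eq_card (h𝒢 x hx).1.subset_cross
        have h2 := (h𝒢 x hx).1.card_add
        rw [← hE] at h1
        omega
    · intro x hx x' hx' h
      have hx := Finset.mem_coe.1 hx
      have hx' := Finset.mem_coe.1 hx'
      simp only [Sigma.mk.injEq, heq_eq_eq] at h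
      obtain ⟨-, h2, h3⟩ := h
      have e1 : x.1 = x'.1 := by rw [← hA1 x hx, h2, hA1 x' hx']
      have e2 : edgesTouching (E \ x.2) (S x) = edgesTouching (E \ x'.2) (S x') := by
        rw [← hA2 x hx, h2, hA2 x' hx']
      have e3 : E \ x.2 = E \ x'.2 := by
        have h4 := Finset.sdiff_union_of_subset
          (fun e he => (mem_edgesTouching.1 he).1 : edgesTouching (E \ x.2) (S x) ⊆ E \ x.2)
        rw [← h4, h3, e2, Finset.sdiff_union_of_subset]
        exact fun e he => (mem_edgesTouching.1 he).1
      refine Prod.ext e1 ?_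
      rw [← Finset.sdiff_sdiff_eq_self (h𝒢 x hx).1.subset_cross, e3,
        Finset.sdiff_sdiff_eq_self (h𝒢 x' hx').1.subset_cross]
  have hfibcard : ∀ Q ∈ (Finset.univ.erase ∅ : Finset (Finset V)), ∀ A,
      ((fib Q A).card : ℝ) ≤ ((8 : ℝ) ^ n)⁻¹ ^ Q.card * E.card.choose m := by
    intro Q hQ A
    simp only [hfib]
    have hQ0 : 0 < Q.card := Finset.card_pos.2
      (Finset.nonempty_iff_ne_empty.2 (Finset.ne_of_mem_erase hQ))
    split_ifs with h
    · refine (card_extensions_le (by positivity) h hZ1 hm).trans ?_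
      rw [mul_comm Q.card u, pow_mul, inv_pow]
      gcongr
    · simp only [Finset.card_empty, Nat.cast_zero]; positivity
  have hQsum : ∀ Q ∈ (Finset.univ.erase ∅ : Finset (Finset V)),
      (∑ A ∈ (edgesTouching Finset.univ Q).powerset, ((fib Q A).card : ℝ)) ≤
        (1 / 4) ^ n * E.card.choose m := by
    intro Q hQ
    have hQ0 : 0 < Q.card := Finset.card_pos.2
      (Finset.nonempty_iff_ne_empty.2 (Finset.ne_of_mem_erase hQ))
    refine (Finset.sum_le_card_nsmul _ _ _ fun A _ => hfibcard Q hQ A).trans ?_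
    rw [Finset.card_powerset, nsmul_eq_mul, ← mul_assoc]
    gcongr
    push_cast
    calc (2 : ℝ) ^ (edgesTouching Finset.univ Q).card * ((8 : ℝ) ^ n)⁻¹ ^ Q.card
        ≤ 2 ^ (Q.card * n) * ((8 : ℝ) ^ n)⁻¹ ^ Q.card := by
          gcongr
          · norm_num
          · exact card_edgesTouching_le _ _
      _ = ((1 / 4 : ℝ) ^ n) ^ Q.card := by
          rw [mul_comm Q.card, pow_mul, ← mul_pow]
          congr 1
          rw [← inv_pow, ← mul_pow]
          norm_num
      _ ≤ (1 / 4 : ℝ) ^ n := by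
          refine pow_le_of_le_one (by positivity) (pow_le_one₀ (by norm_num) (by norm_num)) hQ0.ne'
  calc (𝒢.card : ℝ) ≤ tgt.card := by exact_mod_cast hsrc
    _ = ∑ Q ∈ (Finset.univ.erase ∅ : Finset (Finset V)),
        ∑ A ∈ (edgesTouching Finset.univ Q).powerset, ((fib Q A).card : ℝ) := by
        rw [htgt, Finset.card_sigma]
        push_cast
        refine Finset.sum_congr rfl fun Q _ => ?_
        rw [Finset.card_sigma]
        push_cast
        rfl
    _ ≤ (Finset.univ.erase ∅ : Finset (Finset V)).card • ((1 / 4) ^ n * E.card.choose m : ℝ) :=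
        Finset.sum_le_card_nsmul _ _ _ hQsum
    _ ≤ (2 : ℝ) ^ n * ((1 / 4) ^ n * E.card.choose m) := by
        rw [nsmul_eq_mul]
        gcongr
        have : (Finset.univ.erase ∅ : Finset (Finset V)).card ≤ 2 ^ n :=
          (Finset.card_le_univ _).trans (by rw [Fintype.card_finset])
        exact_mod_cast this
    _ = _ := by
        rw [← mul_assoc, ← mul_pow]
        norm_num

end Dense

/-! ### Summation over the monochromatic pairs -/

section SparseCount

variable {V : Type*} [Fintype V] [DecidableEq V] {r : ℕ}

open Classical in
/-- Summing a bound for the number of sets of crossing pairs over the sets of monochromatic pairs. -/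
lemma card_le_sum_fibers (c : V → Fin r) {m : ℕ} (hm : m < (crossPairs c).card)
    (P : Finset (Sym2 V) → Prop) {g : ℝ} (hg : 0 ≤ g)
    (𝒢 : Finset (Finset (Sym2 V) × Finset (Sym2 V)))
    (h𝒢 : ∀ x ∈ 𝒢, x.1 ⊆ monoPairs c ∧ x.2 ⊆ crossPairs c ∧ x.1.card + x.2.card = m ∧ P x.1)
    (hfib : ∀ T, T ⊆ monoPairs c → P T → ((((crossPairs c).powersetCard (m - T.card)).filter
      fun H => (T, H) ∈ 𝒢).card : ℝ) ≤ g * (crossPairs c).card.choose (m - T.card)) :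
    (𝒢.card : ℝ) ≤ g * (crossPairs c).card.choose m *
      ∑ T ∈ (monoPairs c).powerset.filter P,
        ((m : ℝ) / ((crossPairs c).card - m)) ^ T.card := by
  set N := (crossPairs c).card with hN
  have hNm : (0 : ℝ) < N - m := sub_pos.2 (by exact_mod_cast hm)
  have h1 : 𝒢.card = ∑ T ∈ (monoPairs c).powerset.filter P, (𝒢.filter fun x => x.1 = T).card :=
    Finset.card_eq_sum_card_fiberwise fun x hx => by
      obtain ⟨h1, -, -, h4⟩ := h𝒢 x hx
      exact Finset.mem_coe.2 (Finset.mem_filter.2 ⟨Finset.mem_powerset.2 h1, h4⟩)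
  rw [h1, Finset.mul_sum]
  push_cast
  refine Finset.sum_le_sum fun T hT => ?_
  obtain ⟨hT1, hT2⟩ := Finset.mem_filter.1 hT
  by_cases hTm : T.card ≤ m
  · have h2 : (𝒢.filter fun x => x.1 = T).card ≤
        (((crossPairs c).powersetCard (m - T.card)).filter fun H => (T, H) ∈ 𝒢).card := by
      refine Finset.card_le_card_of_injOn Prod.snd ?_ ?_
      · intro x hx
        obtain ⟨h3, rfl⟩ := Finset.mem_filter.1 (Finset.mem_coe.1 hx)
        obtain ⟨-, h5, h6, -⟩ := h𝒢 x h3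
        exact Finset.mem_coe.2 (Finset.mem_filter.2 ⟨Finset.mem_powersetCard.2
          ⟨h5, by omega⟩, h3⟩)
      · intro x hx y hy h
        obtain ⟨-, h3⟩ := Finset.mem_filter.1 (Finset.mem_coe.1 hx)
        obtain ⟨-, h4⟩ := Finset.mem_filter.1 (Finset.mem_coe.1 hy)
        exact Prod.ext (h3.trans h4.symm) h
    calc ((𝒢.filter fun x => x.1 = T).card : ℝ) ≤ _ := by exact_mod_cast h2
      _ ≤ g * N.choose (m - T.card) := hfib T (Finset.mem_powerset.1 hT1) hT2
      _ ≤ g * (((m : ℝ) / (N - m)) ^ T.card * N.choose m) := by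
          gcongr
          exact choose_sub_le hm hTm
      _ = _ := by ring
  · have h2 : (𝒢.filter fun x => x.1 = T) = ∅ := by
      refine Finset.filter_eq_empty_iff.2 fun x hx h => hTm ?_
      have := (h𝒢 x hx).2.2.1
      rw [h] at this
      omega
    rw [h2]
    simp only [Finset.card_empty, Nat.cast_zero]
    positivity

/-- An orientation of the pairs of `T`, as ordered pairs of vertices. -/
lemma exists_orientation {c : V → Fin r} {T : Finset (Sym2 V)} (hT : T ⊆ monoPairs c) :
    ∃ τ : Finset (V × V), τ.card = T.card ∧ (∀ f ∈ τ, s(f.1, f.2) ∈ T) ∧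
      (∀ f ∈ τ, c f.1 = c f.2 ∧ f.1 ≠ f.2) ∧ (∀ f ∈ τ, f.swap ∉ τ) ∧
      ∀ x, (τ.filter fun f => f.1 = x ∨ f.2 = x).card ≤ (edgesAt T x).card := by
  have hout : ∀ e : Sym2 V, s((Quot.out e).1, (Quot.out e).2) = e := fun e => Quot.out_eq e
  have hinj : Function.Injective (fun e : Sym2 V => (Quot.out e : V × V)) := fun e e' h => by
    rw [← hout e, ← hout e']
    dsimp only at h
    rw [h]
  set τ := T.image fun e => (Quot.out e : V × V) with hτ
  have hmem : ∀ f ∈ τ, s(f.1, f.2) ∈ T ∧ Quot.out s(f.1, f.2) = f := by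
    intro f hf
    obtain ⟨e, he, rfl⟩ := Finset.mem_image.1 hf
    rw [hout]
    exact ⟨he, rfl⟩
  have hmono : ∀ f ∈ τ, c f.1 = c f.2 ∧ f.1 ≠ f.2 := fun f hf => by
    have := mk_mem_monoPairs.1 (hT (hmem f hf).1)
    exact ⟨this.2, this.1⟩
  refine ⟨τ, Finset.card_image_of_injective _ hinj, fun f hf => (hmem f hf).1, hmono, ?_, ?_⟩
  · intro f hf hf'
    have h1 := (hmem f hf).2
    have h2 := (hmem _ hf').2
    rw [Prod.fst_swap, Prod.snd_swap, Sym2.eq_swap, h1] at h2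
    exact (hmono f hf).2 (congrArg Prod.fst h2)
  · intro x
    refine Finset.card_le_card_of_injOn (fun f => s(f.1, f.2)) ?_ ?_
    · intro f hf
      obtain ⟨h1, h2⟩ := Finset.mem_filter.1 (Finset.mem_coe.1 hf)
      refine Finset.mem_coe.2 (Finset.mem_filter.2 ⟨(hmem f h1).1, Sym2.mem_iff.2 ?_⟩)
      exact h2.imp Eq.symm Eq.symm
    · intro f hf f' hf' h
      dsimp only at h
      rw [← (hmem f (Finset.mem_filter.1 (Finset.mem_coe.1 hf)).1).2, h,
        (hmem f' (Finset.mem_filter.1 (Finset.mem_coe.1 hf')).1).2]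

open Classical in
/-- For most sets `H` of crossing pairs, some pair in `T' ⊆ T` completes a `K_{r+1}` with `H`. -/
lemma card_noRootedClique_le {c : V → Fin r} {k D t : ℕ} (hk : ∀ j, k ≤ (colorClass c j).card)
    {T T' : Finset (Sym2 V)} (hT : T ⊆ monoPairs c) (hT' : T' ⊆ T)
    (hD : ∀ v, (edgesAt T' v).card ≤ D) (ht : T'.card ≤ t)
    (M : ℕ) {p q η θ : ℝ} (hp0 : 0 ≤ p) (hp1 : p ≤ 1) (hq0 : 0 ≤ q) (hq1 : q ≤ 1) (hη : 0 < η)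
    (hp : p * (crossPairs c).card ≤ (1 - η) * (M + 1))
    (hθ : 0 ≤ θ)
    (h0 : ∀ a, 2 ≤ a → a + 1 ≤ r → q * t * k ^ (r - 1 - a) *
      p ^ (r.choose 2 + (r - 1) - a.choose 2) ≤ θ)
    (h1 : ∀ a, 1 ≤ a → a + 1 ≤ r → q * D * k ^ (r - 1 - a) *
      p ^ (r.choose 2 + (r - 1) - (a.choose 2 + a)) ≤ θ)
    (h2 : ∀ a, 1 ≤ a → a + 2 ≤ r → q * k ^ (r - 1 - a) *
      p ^ (r.choose 2 + (r - 1) - (a.choose 2 + a * 2)) ≤ θ) :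
    ((((crossPairs c).powersetCard M).filter fun H => NoRootedClique c T H).card : ℝ) ≤
      η⁻¹ * (crossPairs c).card.choose M *
        Real.exp (-((1 - 4 ^ r * (r + 3) * θ / 2) *
          (q * (T'.card * k ^ (r - 1)) * p ^ (r.choose 2 + (r - 1))))) := by
  obtain ⟨τ, hτc, hτT, hτm, hτs, hτd⟩ := exists_orientation (hT'.trans hT)
  have hU : ∀ j, ∃ U ⊆ colorClass c j, U.card = k := fun j => Finset.exists_subset_card_eq (hk j)
  choose U hUs hUk using hU
  have hUc : ∀ j, ∀ v ∈ U j, c v = j := fun j v hv => (Finset.mem_filter.1 (hUs j hv)).2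
  have key := card_avoid_rooted_le hUc hUk τ hτm hτs (fun x => (hτd x).trans (hD x)) M hp0 hp1 hq0
    hq1 hη hp hθ (fun a ha ha' => le_trans (by rw [hτc]; gcongr) (h0 a ha ha')) h1 h2
  rw [hτc] at key
  refine le_trans (Nat.cast_le.2 (Finset.card_le_card fun H hH => ?_)) key
  obtain ⟨h3, h4⟩ := Finset.mem_filter.1 hH
  refine Finset.mem_filter.2 ⟨h3, fun f hf w hw hsub => ?_⟩
  have hcol := transversal_of_mem_rootedTransversals hUc hw
  refine h4 f.2 w hcol ?_ (fun j hj => hsub ?_) (Finset.subset_union_left.trans hsub)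
  · rw [← (hτm f hf).1, (mem_rootedTransversals.1 hw).1, Sym2.eq_swap]
    exact hT' (hτT f hf)
  · exact Finset.mem_union_right _ (Finset.mem_image.2 ⟨j, Finset.mem_erase.2
      ⟨hj, Finset.mem_univ _⟩, rfl⟩)

/-- The bound of `sum_pow_card_hasCover_le` for the total weight, at weight `x` per pair, of the sets
of pairs of an `n`-set with a given kind of cover; `y` is the free parameter of that bound. -/
noncomputable def coverWeight (n : ℕ) (x y : ℝ) (t h s l : ℕ) : ℝ :=
  (1 + (n : ℝ) ^ 2 * x) ^ t * ((1 + n : ℝ) ^ h * Real.exp (x * (h * n)) *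
    ((1 + n : ℝ) ^ s * Real.exp (l * Real.log y⁻¹ + y * x * (s * n))))

lemma coverWeight_nonneg {n : ℕ} {x y : ℝ} (hx : 0 ≤ x) (t h s l : ℕ) :
    0 ≤ coverWeight n x y t h s l := by
  unfold coverWeight
  positivity

/-- Among the vertices of degree at least `2 * d` in `T`, a proportion of at least `1 / (2 * r)` lies
in one colour class and has at least `d` neighbours in `T` outside of the part that they form. -/
lemma exists_high_degree_part {c : V → Fin r} {m : ℕ} {T H : Finset (Sym2 V)}
    (h : IsBadPair c m T H) {d : ℕ} (hpos : (Finset.univ.filter fun v =>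
      2 * d ≤ (edgesAt T v).card).Nonempty) :
    ∃ i : Fin r, ∃ A : Finset V, A.Nonempty ∧ (∀ v ∈ A, c v = i) ∧
      (Finset.univ.filter fun v => 2 * d ≤ (edgesAt T v).card).card ≤ 2 * r * A.card ∧
      ∀ v ∈ A, d ≤ (nbrs T v \ A).card ∧
        ∀ j, j ≠ i → d ≤ ((nbrs H v).filter fun u => c u = j).card := by
  set Q := Finset.univ.filter fun v => 2 * d ≤ (edgesAt T v).card with hQ
  have hQr : ∃ i : Fin r, Q.card ≤ r * (Q.filter fun v => c v = i).card := by
    obtain ⟨v, -⟩ := hpos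
    have : Nonempty (Fin r) := ⟨c v⟩
    by_contra! hcon
    have h1 : Q.card = ∑ i, (Q.filter fun v => c v = i).card :=
      Finset.card_eq_sum_card_fiberwise fun _ _ => Finset.mem_coe.2 (Finset.mem_univ _)
    have h2 : ∑ i, r * (Q.filter fun v => c v = i).card < ∑ _i : Fin r, Q.card :=
      Finset.sum_lt_sum_of_nonempty Finset.univ_nonempty fun i _ => hcon i
    rw [← Finset.mul_sum, ← h1] at h2
    simp at h2
  obtain ⟨i, hi⟩ := hQr
  have hloop : ∀ v, v ∉ nbrs T v := fun v hv =>
    (mk_mem_monoPairs.1 (h.subset_mono (mem_nbrs.1 hv))).1 rfl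
  obtain ⟨A, hAQ, hA2, hAn⟩ := exists_half_few_inner_nbrs hloop (Q.filter fun v => c v = i)
  have hle : Q.card ≤ 2 * r * A.card := by
    calc Q.card ≤ r * (Q.filter fun v => c v = i).card := hi
      _ ≤ r * (2 * A.card) := by gcongr
      _ = _ := by ring
  refine ⟨i, A, ?_, fun v hv => (Finset.mem_filter.1 (hAQ hv)).2, hle, fun v hv => ?_⟩
  · rw [← Finset.card_pos]
    have := hpos.card_pos
    by_contra! h0
    rw [Nat.le_zero.1 h0, mul_zero] at hle
    omega
  · obtain ⟨h1, h2⟩ := Finset.mem_filter.1 (hAQ hv)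
    have h3 := (Finset.mem_filter.1 h1).2
    rw [card_edgesAt] at h3
    have h4 := hAn v hv
    refine ⟨by omega, fun j hj => ?_⟩
    have := h.unfriendly v j (by rw [h2]; exact hj)
    omega

open Classical in
/-- When only a proportion `g` of the sets `H` is possible for each `T`, and `T` has at most `l`
pairs. -/
lemma card_le_of_few_mono (c : V → Fin r) {m : ℕ} (hm : m < (crossPairs c).card)
    {g y l : ℝ} (hg : 0 ≤ g) (hy : 0 < y) (hy1 : y ≤ 1)
    (𝒢 : Finset (Finset (Sym2 V) × Finset (Sym2 V)))
    (h𝒢 : ∀ x ∈ 𝒢, IsBadPair c m x.1 x.2 ∧ (x.1.card : ℝ) ≤ l)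
    (hfib : ∀ T, T ⊆ monoPairs c → (T.card : ℝ) ≤ l →
      ((((crossPairs c).powersetCard (m - T.card)).filter fun H => (T, H) ∈ 𝒢).card : ℝ) ≤
        g * (crossPairs c).card.choose (m - T.card)) :
    (𝒢.card : ℝ) ≤ g * Real.exp (l * Real.log y⁻¹ +
      y * ((m : ℝ) / ((crossPairs c).card - m)) * (Fintype.card V : ℝ) ^ 2) *
      (crossPairs c).card.choose m := by
  have hNm : (0 : ℝ) < (crossPairs c).card - m := sub_pos.2 (by exact_mod_cast hm)
  have h1 := card_le_sum_fibers c hm (fun T => (T.card : ℝ) ≤ l) hg 𝒢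
    (fun x hx => ⟨(h𝒢 x hx).1.subset_mono, (h𝒢 x hx).1.subset_cross, (h𝒢 x hx).1.card_add,
      (h𝒢 x hx).2⟩) hfib
  have h2 := sum_pow_card_small_le_exp (monoPairs c)
    (x := (m : ℝ) / ((crossPairs c).card - m)) (by positivity) hy hy1 (l := l)
  have h3 : ((monoPairs c).card : ℝ) ≤ (Fintype.card V : ℝ) ^ 2 := by
    exact_mod_cast card_sym2_le _
  calc (𝒢.card : ℝ) ≤ _ := h1
    _ ≤ g * (crossPairs c).card.choose m * Real.exp (l * Real.log y⁻¹ +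
      y * ((m : ℝ) / ((crossPairs c).card - m)) * (monoPairs c).card) := by
        gcongr
    _ ≤ g * (crossPairs c).card.choose m * Real.exp (l * Real.log y⁻¹ +
      y * ((m : ℝ) / ((crossPairs c).card - m)) * (Fintype.card V : ℝ) ^ 2) := by gcongr
    _ = _ := by ring

open Classical in
/-- When only a proportion `g` of the sets `H` is possible for each `T`, and `T` has a cover. -/
lemma card_le_of_hasCover (c : V → Fin r) {m : ℕ} (hm : m < (crossPairs c).card)
    {g y : ℝ} (hg : 0 ≤ g) (hy : 0 < y) (hy1 : y ≤ 1) (P : Finset (Sym2 V) → Prop) {t h s l : ℕ}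
    (hP : ∀ T, P T → HasCover T t h s l)
    (𝒢 : Finset (Finset (Sym2 V) × Finset (Sym2 V)))
    (h𝒢 : ∀ x ∈ 𝒢, IsBadPair c m x.1 x.2 ∧ P x.1)
    (hfib : ∀ T, T ⊆ monoPairs c → P T →
      ((((crossPairs c).powersetCard (m - T.card)).filter fun H => (T, H) ∈ 𝒢).card : ℝ) ≤
        g * (crossPairs c).card.choose (m - T.card)) :
    (𝒢.card : ℝ) ≤ g * coverWeight (Fintype.card V) ((m : ℝ) / ((crossPairs c).card - m)) y t h s l
      * (crossPairs c).card.choose m := by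
  have hNm : (0 : ℝ) < (crossPairs c).card - m := sub_pos.2 (by exact_mod_cast hm)
  have h1 := card_le_sum_fibers c hm P hg 𝒢
    (fun x hx => ⟨(h𝒢 x hx).1.subset_mono, (h𝒢 x hx).1.subset_cross, (h𝒢 x hx).1.card_add,
      (h𝒢 x hx).2⟩) hfib
  have h2 := sum_pow_card_hasCover_le c
    (x := (m : ℝ) / ((crossPairs c).card - m)) (by positivity) hy hy1 t h s l
  calc (𝒢.card : ℝ) ≤ _ := h1
    _ ≤ g * (crossPairs c).card.choose m * coverWeight (Fintype.card V)
      ((m : ℝ) / ((crossPairs c).card - m)) y t h s l := by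
        gcongr
        refine le_trans ?_ h2
        refine Finset.sum_le_sum_of_subset_of_nonneg (fun T hT => ?_) fun _ _ _ => by positivity
        obtain ⟨h3, h4⟩ := Finset.mem_filter.1 hT
        exact Finset.mem_filter.2 ⟨h3, hP T h4⟩
    _ = _ := by ring

/-- In `card_high_degree_le`, the number `Y ^ d` of tuples, the weight of the `r * d` deleted pairs
and the number `d ! ^ r` of choices of neighbours cancel up to a factor `exp (r * n * w)`. -/
lemma tuples_weight_le {Y n w : ℝ} (hw : 0 ≤ w) (hn : 0 ≤ n) (hY0 : 0 ≤ Y) (r d : ℕ)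
    (hY : Y ≤ n ^ r) :
    Y ^ d * w ^ (r * d) ≤ Real.exp (r * (n * w)) * ((d.factorial : ℝ) ^ r) := by
  have h1 := Real.pow_div_factorial_le_exp (n * w) (by positivity) d
  rw [div_le_iff₀ (by positivity)] at h1
  calc Y ^ d * w ^ (r * d) ≤ (n ^ r) ^ d * w ^ (r * d) := by gcongr
    _ = ((n * w) ^ d) ^ r := by rw [← pow_mul, ← mul_pow, ← pow_mul, mul_comm d r]
    _ ≤ (Real.exp (n * w) * d.factorial) ^ r := by gcongr
    _ = _ := by rw [mul_pow, ← Real.exp_nat_mul]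

lemma card_transversals_le (c : V → Fin r) :
    ((transversals c).card : ℝ) ≤ (Fintype.card V : ℝ) ^ r := by
  rw [card_transversals]
  push_cast
  calc ∏ j, ((colorClass c j).card : ℝ) ≤ ∏ _j : Fin r, (Fintype.card V : ℝ) :=
        Finset.prod_le_prod (fun _ _ => by positivity) fun j _ => by
          exact_mod_cast Finset.card_le_univ _
    _ = _ := by simp

open Classical in
/-- When `A` is a set of vertices of high degree and few tuples have no `K_r` of `H` across them. -/
lemma card_le_of_high_degree_part (c : V → Fin r) {m : ℕ} (hm : m < (crossPairs c).card)
    {y β : ℝ} (hβ : 0 ≤ β) (hy : 0 < y) (hy1 : y ≤ 1) {d t h s l : ℕ} (i : Fin r) (A : Finset V)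
    (hA : ∀ v ∈ A, c v = i) (𝒢 : Finset (Finset (Sym2 V) × Finset (Sym2 V)))
    (h𝒢 : ∀ x ∈ 𝒢, IsBadPair c m x.1 x.2 ∧
      ((cliqueFreeTuples c d x.2).card : ℝ) ≤ β * (transversals c).card ^ d ∧
      HasCover x.1 t h s l ∧ ∀ v ∈ A, d ≤ (nbrs x.1 v \ A).card ∧
        ∀ j, j ≠ i → d ≤ ((nbrs x.2 v).filter fun u => c u = j).card) :
    (𝒢.card : ℝ) ≤ (β * Real.exp (r * (Fintype.card V *
      ((m : ℝ) / ((crossPairs c).card - m))))) ^ A.card *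
      coverWeight (Fintype.card V) ((m : ℝ) / ((crossPairs c).card - m)) y t h s l *
      (crossPairs c).card.choose m := by
  set N := (crossPairs c).card with hN
  set w := (m : ℝ) / (N - m) with hw
  set Y := ((transversals c).card : ℝ) with hY
  have hNm : (0 : ℝ) < N - m := sub_pos.2 (by exact_mod_cast hm)
  have hw0 : 0 ≤ w := by positivity
  have h1 := card_high_degree_le c i A hA d m (B := β * Y ^ d) (by positivity)
    (fun T => HasCover T t h s l) (fun T T₀ hT hT₀ => hT.subset hT₀) 𝒢 fun x hx => by
      obtain ⟨h1, h2, h3, h4⟩ := h𝒢 x hx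
      exact ⟨h1.subset_mono, h1.subset_cross, h1.card_add, h3, h2, h1.noClique, h4⟩
  have h2 : ∑ T ∈ (monoPairs c).powerset.filter (fun T => HasCover T t h s l),
      (if T.card + r * d * A.card ≤ m then (N.choose (m - (T.card + r * d * A.card)) : ℝ) else 0) ≤
      (w ^ (r * d)) ^ A.card * N.choose m * coverWeight (Fintype.card V) w y t h s l := by
    calc _ ≤ ∑ T ∈ (monoPairs c).powerset.filter (fun T => HasCover T t h s l),
          (w ^ (r * d)) ^ A.card * N.choose m * w ^ T.card := by
          refine Finset.sum_le_sum fun T _ => ?_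
          split_ifs with hT
          · refine (choose_sub_le hm hT).trans (le_of_eq ?_)
            rw [pow_add, pow_mul]
            ring
          · positivity
      _ = (w ^ (r * d)) ^ A.card * N.choose m *
          ∑ T ∈ (monoPairs c).powerset.filter (fun T => HasCover T t h s l), w ^ T.card := by
          rw [Finset.mul_sum]
      _ ≤ _ := by
          gcongr
          exact sum_pow_card_hasCover_le c hw0 hy hy1 t h s l
  have h3 := tuples_weight_le hw0 (Nat.cast_nonneg (Fintype.card V)) (Nat.cast_nonneg _) r d
    (card_transversals_le c)
  have hpos : (0 : ℝ) < ((d.factorial : ℝ) ^ r) ^ A.card := by positivity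
  refine le_of_mul_le_mul_right ?_ hpos
  have hW := coverWeight_nonneg (n := Fintype.card V) (y := y) hw0 t h s l
  calc (𝒢.card : ℝ) * ((d.factorial : ℝ) ^ r) ^ A.card ≤ _ := h1
    _ ≤ (β * Y ^ d) ^ A.card *
        ((w ^ (r * d)) ^ A.card * N.choose m * coverWeight (Fintype.card V) w y t h s l) := by
        gcongr
    _ = (β * (Y ^ d * w ^ (r * d))) ^ A.card * coverWeight (Fintype.card V) w y t h s l *
        N.choose m := by
        rw [mul_pow, mul_pow, mul_pow]; ring
    _ ≤ (β * (Real.exp (r * (Fintype.card V * w)) * ((d.factorial : ℝ) ^ r))) ^ A.card *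
        coverWeight (Fintype.card V) w y t h s l * N.choose m := by gcongr
    _ = _ := by
        rw [← mul_assoc, mul_pow]; ring

open Classical in
/-- The sum over all sets `A` of vertices of high degree. The factor `n ^ #A` in the hypothesis pays
for the choice of `A`. -/
lemma card_le_of_exists_high_degree_part (c : V → Fin r) {m : ℕ} (hm : m < (crossPairs c).card)
    {y β b : ℝ} (hβ : 0 ≤ β) (hb : 0 ≤ b) (hy : 0 < y) (hy1 : y ≤ 1) {d : ℕ} (t s l : ℕ → ℕ)
    (𝒢 : Finset (Finset (Sym2 V) × Finset (Sym2 V)))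
    (h𝒢 : ∀ x ∈ 𝒢, IsBadPair c m x.1 x.2 ∧
      ((cliqueFreeTuples c d x.2).card : ℝ) ≤ β * (transversals c).card ^ d ∧
      ∃ i : Fin r, ∃ A : Finset V, A.Nonempty ∧ (∀ v ∈ A, c v = i) ∧
        HasCover x.1 (t A.card) (2 * r * A.card) (s A.card) (l A.card) ∧
        ∀ v ∈ A, d ≤ (nbrs x.1 v \ A).card ∧
          ∀ j, j ≠ i → d ≤ ((nbrs x.2 v).filter fun u => c u = j).card)
    (hnum : ∀ a, 1 ≤ a → a ≤ Fintype.card V → (β * Real.exp (r * (Fintype.card V *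
      ((m : ℝ) / ((crossPairs c).card - m))))) ^ a *
      coverWeight (Fintype.card V) ((m : ℝ) / ((crossPairs c).card - m)) y (t a) (2 * r * a) (s a)
        (l a) * (Fintype.card V : ℝ) ^ a ≤ b) :
    (𝒢.card : ℝ) ≤ Real.exp 1 * b * (crossPairs c).card.choose m := by
  set n := Fintype.card V with hn
  set N := (crossPairs c).card with hN
  rcases 𝒢.eq_empty_or_nonempty with rfl | ⟨x₁, hx₁⟩
  · simp only [Finset.card_empty, Nat.cast_zero]; positivity
  have : Nonempty (Fin r) := ⟨(h𝒢 x₁ hx₁).2.2.choose⟩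
  choose! hbad hfew i A hAne hAi hcov hdeg using h𝒢
  have h1 : 𝒢.card = ∑ S ∈ (Finset.univ : Finset V).powerset,
      (𝒢.filter fun x => A x = S).card :=
    Finset.card_eq_sum_card_fiberwise fun _ _ => by simp
  have h2 : ∀ S ∈ (Finset.univ : Finset V).powerset, ((𝒢.filter fun x => A x = S).card : ℝ) ≤
      b * N.choose m * (n : ℝ)⁻¹ ^ S.card := by
    intro S _
    rcases (𝒢.filter fun x => A x = S).eq_empty_or_nonempty with h | ⟨x₀, hmem⟩
    · rw [h]; simp only [Finset.card_empty, Nat.cast_zero]; positivity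
    obtain ⟨hx₀, rfl⟩ := Finset.mem_filter.1 hmem
    have hn0 : (0 : ℝ) < n := by
      obtain ⟨v, -⟩ := hAne x₀ hx₀
      have : 0 < n := Fintype.card_pos_iff.2 ⟨v⟩
      exact_mod_cast this
    have hi : ∀ x ∈ 𝒢, A x = A x₀ → i x = i x₀ := by
      intro x hx h
      obtain ⟨v, hv⟩ := hAne x₀ hx₀
      rw [← hAi x₀ hx₀ v hv, ← hAi x hx v (h ▸ hv)]
    have h3 := card_le_of_high_degree_part c hm hβ hy hy1 (i x₀) (A x₀) (hAi x₀ hx₀)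
      (𝒢.filter fun x => A x = A x₀) (d := d) (t := t (A x₀).card) (h := 2 * r * (A x₀).card)
      (s := s (A x₀).card) (l := l (A x₀).card) fun x hx => by
        obtain ⟨h3, h4⟩ := Finset.mem_filter.1 hx
        have h5 := hcov x h3
        have h6 := hdeg x h3
        rw [h4] at h5 h6
        refine ⟨hbad x h3, hfew x h3, h5, fun v hv => ⟨(h6 v hv).1, fun j hj => (h6 v hv).2 j ?_⟩⟩
        rwa [hi x h3 h4]
    have h4 := hnum (A x₀).card (hAne x₀ hx₀).card_pos (Finset.card_le_univ _)
    rw [inv_pow, ← div_eq_mul_inv, le_div_iff₀ (by positivity)]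
    calc _ ≤ _ := mul_le_mul_of_nonneg_right h3 (by positivity)
      _ = _ := mul_right_comm _ _ _
      _ ≤ _ := by gcongr
  rw [h1]
  push_cast
  calc _ ≤ _ := Finset.sum_le_sum h2
    _ = b * N.choose m * ∑ S ∈ (Finset.univ : Finset V).powerset, (n : ℝ)⁻¹ ^ S.card := by
        rw [Finset.mul_sum]
    _ ≤ b * N.choose m * Real.exp 1 := by
        gcongr
        refine (sum_pow_card_le_exp _ (by positivity)).trans (Real.exp_le_exp.2 ?_)
        rw [Finset.card_univ]
        exact inv_mul_le_one
    _ = _ := by ring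

end SparseCount

/-! ### The four kinds of rare pairs -/

section Sparse

variable {V : Type*} [Fintype V] [DecidableEq V] {r : ℕ}

lemma geom_sum_exp_le {σ : ℝ} (hσ : Real.exp (-σ) ≤ 1 / 2) (t : ℕ) :
    ∑ k ∈ Finset.Icc 1 t, Real.exp (-(σ * k)) ≤ 2 * Real.exp (-σ) := by
  have h0 := Real.exp_pos (-σ)
  have h1 : ∀ k ∈ Finset.Icc 1 t, Real.exp (-(σ * k)) ≤
      Real.exp (-σ) * (1 / 2 : ℝ) ^ (k - 1) := by
    intro k hk
    obtain ⟨h1, -⟩ := Finset.mem_Icc.1 hk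
    obtain ⟨j, rfl⟩ := Nat.exists_eq_add_of_le' h1
    have : -(σ * ((j + 1 : ℕ) : ℝ)) = -σ + j * (-σ) := by push_cast; ring
    rw [this, Real.exp_add, Real.exp_nat_mul, Nat.add_sub_cancel]
    gcongr
  refine (Finset.sum_le_sum h1).trans ?_
  rw [← Finset.mul_sum, mul_comm]
  gcongr
  have h2 : Finset.Icc 1 t = Finset.Ico 1 (t + 1) := by
    ext; simp only [Finset.mem_Icc, Finset.mem_Ico]; omega
  rw [h2, Finset.sum_Ico_eq_sum_range]
  simp only [Nat.add_sub_cancel, Nat.add_sub_cancel_left]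
  have h3 := Summable.sum_le_tsum (f := fun n : ℕ => (1 / 2 : ℝ) ^ n) (Finset.range t)
    (fun _ _ => by positivity) summable_geometric_two
  rwa [tsum_geometric_two] at h3

open Classical in
/-- The four ways in which a pair can be rare: `H` is atypical, `T` contains a bounded-degree graph
with `tmax` edges, the maximal bounded-degree subgraph of `T` outweighs the vertices of high degree,
or it does not. Here `ρ` is the gain per pair of that subgraph and `σ` the part of it that is left
after paying for the choice of `T`; `hcap t` is the largest number of vertices of high degree that
`t` pairs outweigh, and `tm a` bounds the number of pairs outweighed by `a` vertices. -/
theorem card_sparse_le (c : V → Fin r) {m : ℕ} (hm : m < (crossPairs c).card) {D d tmax : ℕ}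
    {l y y' ρ σ g₀ gB β b₁ b₂ b₄ : ℝ} (s hcap tm : ℕ → ℕ) (hD : 1 ≤ D)
    (hg₀ : 0 ≤ g₀) (hgB : 0 ≤ gB) (hβ : 0 ≤ β) (hb₄ : 0 ≤ b₄) (hy : 0 < y) (hy1 : y ≤ 1)
    (hy' : 0 < y') (hy1' : y' ≤ 1) (hs : ∀ t a : ℕ, a * D ≤ 2 * t → a ≤ s t) (hsm : Monotone s)
    (htm : ∀ t a, hcap t < 2 * r * a → t ≤ tm a)
    (hA : ∀ T T' : Finset (Sym2 V), T ⊆ monoPairs c → T' ⊆ T → (∀ v, (edgesAt T' v).card ≤ D) →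
      T'.card ≤ tmax → (T.card : ℝ) ≤ l →
      ((((crossPairs c).powersetCard (m - T.card)).filter fun H => NoRootedClique c T H).card : ℝ) ≤
        g₀ * Real.exp (-(ρ * T'.card)) * (crossPairs c).card.choose (m - T.card))
    (hB : ∀ T : Finset (Sym2 V), T ⊆ monoPairs c → (T.card : ℝ) ≤ l →
      ((((crossPairs c).powersetCard (m - T.card)).filter fun H =>
        β * (transversals c).card ^ d < (cliqueFreeTuples c d H).card).card : ℝ) ≤
        gB * (crossPairs c).card.choose (m - T.card))
    (hn1 : gB * Real.exp (l * Real.log y'⁻¹ +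
      y' * ((m : ℝ) / ((crossPairs c).card - m)) * (Fintype.card V : ℝ) ^ 2) ≤ b₁)
    (hn2 : g₀ * Real.exp (-(ρ * tmax)) * Real.exp (l * Real.log y'⁻¹ +
      y' * ((m : ℝ) / ((crossPairs c).card - m)) * (Fintype.card V : ℝ) ^ 2) ≤ b₂)
    (hσ : Real.exp (-σ) ≤ 1 / 2)
    (hn3 : ∀ t, 1 ≤ t → t ≤ tmax → coverWeight (Fintype.card V)
      ((m : ℝ) / ((crossPairs c).card - m)) y t (hcap t) (s t) (s t * (2 * d)) *
        Real.exp (-(ρ * t)) ≤ Real.exp (-(σ * t)))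
    (hn4 : ∀ a, 1 ≤ a → a ≤ Fintype.card V → (β * Real.exp (r * (Fintype.card V *
      ((m : ℝ) / ((crossPairs c).card - m))))) ^ a *
      coverWeight (Fintype.card V) ((m : ℝ) / ((crossPairs c).card - m)) y (tm a) (2 * r * a)
        (s (tm a)) (s (tm a) * (2 * d)) * (Fintype.card V : ℝ) ^ a ≤ b₄)
    (𝒢 : Finset (Finset (Sym2 V) × Finset (Sym2 V)))
    (h𝒢 : ∀ x ∈ 𝒢, IsBadPair c m x.1 x.2 ∧ (x.1.card : ℝ) ≤ l) :
    (𝒢.card : ℝ) ≤ (b₁ + b₂ + 2 * g₀ * Real.exp (-σ) + Real.exp 1 * b₄) *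
      (crossPairs c).card.choose m := by
  set N := (crossPairs c).card with hN
  choose f hfT hfD hft hfsat using fun T : Finset (Sym2 V) =>
    exists_bounded_degree_subgraph T D tmax
  set high : Finset (Sym2 V) → Finset V := fun T =>
    Finset.univ.filter fun v => 2 * d ≤ (edgesAt T v).card with hhigh
  have hcov : ∀ T, (f T).card < tmax →
      HasCover T (f T).card (high T).card (s (f T).card) (s (f T).card * (2 * d)) := fun T hT =>
    hasCover_of_saturated (hfT T) (hfsat T hT) (fun S hS => hs _ _ hS) (high T) fun v hv =>
      Finset.mem_filter.2 ⟨Finset.mem_univ _, hv⟩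
  set 𝒢₀ := 𝒢.filter fun x =>
    β * (transversals c).card ^ d < (cliqueFreeTuples c d x.2).card with h𝒢₀
  set 𝒢₁ := 𝒢.filter fun x => (f x.1).card = tmax with h𝒢₁
  set 𝒢₂ : ℕ → Finset (Finset (Sym2 V) × Finset (Sym2 V)) := fun t => 𝒢.filter fun x =>
    (f x.1).card = t ∧ t < tmax ∧ (high x.1).card ≤ hcap t with h𝒢₂
  set 𝒢₃ := 𝒢.filter fun x => (cliqueFreeTuples c d x.2).card ≤ β * (transversals c).card ^ d ∧
    (f x.1).card < tmax ∧ hcap (f x.1).card < (high x.1).card with h𝒢₃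
  have hsplit : 𝒢 ⊆ ((𝒢₀ ∪ 𝒢₁) ∪ (Finset.Icc 1 tmax).biUnion 𝒢₂) ∪ 𝒢₃ := by
    intro x hx
    by_cases h0 : β * (transversals c).card ^ d < (cliqueFreeTuples c d x.2).card
    · exact Finset.mem_union_left _ (Finset.mem_union_left _ (Finset.mem_union_left _
        (Finset.mem_filter.2 ⟨hx, h0⟩)))
    by_cases h1 : (f x.1).card = tmax
    · exact Finset.mem_union_left _ (Finset.mem_union_left _ (Finset.mem_union_right _
        (Finset.mem_filter.2 ⟨hx, h1⟩)))
    have h1' : (f x.1).card < tmax := lt_of_le_of_ne (hft x.1) h1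
    by_cases h2 : (high x.1).card ≤ hcap (f x.1).card
    · refine Finset.mem_union_left _ (Finset.mem_union_right _ (Finset.mem_biUnion.2
        ⟨(f x.1).card, Finset.mem_Icc.2 ⟨?_, h1'.le⟩, Finset.mem_filter.2 ⟨hx, rfl, h1', h2⟩⟩))
      by_contra! h3
      have h4 : f x.1 = ∅ := Finset.card_eq_zero.1 (by omega)
      obtain ⟨e, he⟩ := (h𝒢 x hx).1.nonempty
      obtain ⟨v, -, hv⟩ := hfsat x.1 h1' e (by simpa [h4] using he)
      rw [h4] at hv
      simp only [edgesAt, Finset.filter_empty, Finset.card_empty] at hv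
      omega
    · exact Finset.mem_union_right _ (Finset.mem_filter.2 ⟨hx, not_lt.1 h0, h1', not_le.1 h2⟩)
  have c0 : (𝒢₀.card : ℝ) ≤ b₁ * N.choose m := by
    refine (card_le_of_few_mono c hm hgB hy' hy1' 𝒢₀
      (fun x hx => h𝒢 x (Finset.mem_filter.1 hx).1) fun T hT hTl => ?_).trans (by gcongr)
    refine le_trans (Nat.cast_le.2 (Finset.card_le_card fun H hH => ?_)) (hB T hT hTl)
    obtain ⟨h1, h2⟩ := Finset.mem_filter.1 hH
    exact Finset.mem_filter.2 ⟨h1, (Finset.mem_filter.1 h2).2⟩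
  have c1 : (𝒢₁.card : ℝ) ≤ b₂ * N.choose m := by
    refine (card_le_of_few_mono c hm (g := g₀ * Real.exp (-(ρ * tmax))) (by positivity) hy' hy1' 𝒢₁
      (fun x hx => h𝒢 x (Finset.mem_filter.1 hx).1) fun T hT hTl => ?_).trans (by gcongr)
    rcases (((crossPairs c).powersetCard (m - T.card)).filter
      fun H => (T, H) ∈ 𝒢₁).eq_empty_or_nonempty with h | ⟨H₀, hH₀⟩
    · rw [h]; simp only [Finset.card_empty, Nat.cast_zero]; positivity
    have hfull : (f T).card = tmax := (Finset.mem_filter.1 (Finset.mem_filter.1 hH₀).2).2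
    have := hA T (f T) hT (hfT T) (hfD T) (hft T) hTl
    rw [hfull] at this
    refine le_trans (Nat.cast_le.2 (Finset.card_le_card fun H hH => ?_)) this
    obtain ⟨h1, h2⟩ := Finset.mem_filter.1 hH
    exact Finset.mem_filter.2 ⟨h1, (h𝒢 _ (Finset.mem_filter.1 h2).1).1.noClique⟩
  have c2 : ∀ t ∈ Finset.Icc 1 tmax,
      ((𝒢₂ t).card : ℝ) ≤ g₀ * N.choose m * Real.exp (-(σ * t)) := by
    intro t ht
    obtain ⟨ht1, ht2⟩ := Finset.mem_Icc.1 ht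
    have h1 := card_le_of_hasCover c hm (g := g₀ * Real.exp (-(ρ * t))) (by positivity) hy hy1
      (fun T => (T.card : ℝ) ≤ l ∧ (f T).card = t ∧ t < tmax ∧ (high T).card ≤ hcap t)
      (t := t) (h := hcap t) (s := s t) (l := s t * (2 * d))
      (fun T hT => by
        obtain ⟨-, rfl, h2, h3⟩ := hT
        exact (hcov T h2).mono le_rfl h3 le_rfl le_rfl) (𝒢₂ t)
      (fun x hx => by
        obtain ⟨h2, h3⟩ := Finset.mem_filter.1 hx
        exact ⟨(h𝒢 x h2).1, (h𝒢 x h2).2, h3⟩)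
      (fun T hT hPT => by
        obtain ⟨h2, rfl, h3, h4⟩ := hPT
        refine le_trans (Nat.cast_le.2 (Finset.card_le_card fun H hH => ?_))
          (hA T (f T) hT (hfT T) (hfD T) (hft T) h2)
        obtain ⟨h5, h6⟩ := Finset.mem_filter.1 hH
        exact Finset.mem_filter.2 ⟨h5, (h𝒢 _ (Finset.mem_filter.1 h6).1).1.noClique⟩)
    refine h1.trans ?_
    have h2 := hn3 t ht1 ht2
    calc _ = g₀ * N.choose m * (coverWeight (Fintype.card V) ((m : ℝ) / (N - m)) y t (hcap t)
          (s t) (s t * (2 * d)) * Real.exp (-(ρ * t))) := by ring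
      _ ≤ _ := by gcongr
  have c2' : (((Finset.Icc 1 tmax).biUnion 𝒢₂).card : ℝ) ≤
      2 * g₀ * Real.exp (-σ) * N.choose m := by
    calc (((Finset.Icc 1 tmax).biUnion 𝒢₂).card : ℝ) ≤ ∑ t ∈ Finset.Icc 1 tmax, ((𝒢₂ t).card : ℝ) := by
          exact_mod_cast Finset.card_biUnion_le
      _ ≤ ∑ t ∈ Finset.Icc 1 tmax, g₀ * N.choose m * Real.exp (-(σ * t)) := Finset.sum_le_sum c2
      _ = g₀ * N.choose m * ∑ t ∈ Finset.Icc 1 tmax, Real.exp (-(σ * t)) := by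
          rw [Finset.mul_sum]
      _ ≤ g₀ * N.choose m * (2 * Real.exp (-σ)) := by
          gcongr
          exact geom_sum_exp_le hσ tmax
      _ = _ := by ring
  have c3 : (𝒢₃.card : ℝ) ≤ Real.exp 1 * b₄ * N.choose m := by
    refine card_le_of_exists_high_degree_part c hm hβ hb₄ hy hy1 (d := d) tm
      (fun a => s (tm a)) (fun a => s (tm a) * (2 * d)) 𝒢₃ (fun x hx => ?_) hn4
    obtain ⟨h1, h2, h3, h4⟩ := Finset.mem_filter.1 hx
    refine ⟨(h𝒢 x h1).1, h2, ?_⟩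
    obtain ⟨i, A, hA1, hA2, hA3, hA4⟩ := exists_high_degree_part (h𝒢 x h1).1 (d := d)
      (Finset.card_pos.1 (by simp only [hhigh] at h4; omega))
    have h5 : (f x.1).card ≤ tm A.card := htm _ _ (h4.trans_le hA3)
    exact ⟨i, A, hA1, hA2, (hcov x.1 h3).mono h5 hA3 (hsm h5)
      (Nat.mul_le_mul_right _ (hsm h5)), hA4⟩
  have hcard : (𝒢.card : ℝ) ≤ 𝒢₀.card + 𝒢₁.card + ((Finset.Icc 1 tmax).biUnion 𝒢₂).card +
      𝒢₃.card := by
    exact_mod_cast (Finset.card_le_card hsplit).trans ((Finset.card_union_le _ _).trans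
      (Nat.add_le_add_right ((Finset.card_union_le _ _).trans
        (Nat.add_le_add_right (Finset.card_union_le _ _) _)) _))
  calc (𝒢.card : ℝ) ≤ _ := hcard
    _ ≤ b₁ * N.choose m + b₂ * N.choose m + 2 * g₀ * Real.exp (-σ) * N.choose m +
        Real.exp 1 * b₄ * N.choose m := by gcongr
    _ = _ := by ring

end Sparse

/-! ### Subgraph counts above the threshold -/

section Asymptotics

lemma two_mul_choose_two (a : ℕ) : 2 * a.choose 2 = a * (a - 1) := by
  rw [Nat.choose_two_right, Nat.two_mul_div_two_of_even (Nat.even_mul_pred_self a)]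

lemma two_mul_exponent (r : ℕ) : 2 * (r.choose 2 + (r - 1)) = (r - 1) * (r + 2) := by
  rw [mul_add, two_mul_choose_two]
  ring

lemma eventually_le_log (B : ℝ) : ∀ᶠ n : ℕ in atTop, B ≤ Real.log n :=
  (Real.tendsto_log_atTop.comp tendsto_natCast_atTop_atTop).eventually_ge_atTop B

lemma eventually_log_pow_le_sqrt (B : ℝ) (j : ℕ) :
    ∀ᶠ n : ℕ in atTop, B * Real.log n ^ j ≤ √(n : ℝ) := by
  have h1 := (Real.isLittleO_pow_log_id_atTop (n := 2 * j)).comp_tendsto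
    tendsto_natCast_atTop_atTop
  have h2 := h1.bound (c := 1 / (B ^ 2 + 1)) (by positivity)
  filter_upwards [h2] with n hn
  simp only [Function.comp_apply, id_eq, Real.norm_eq_abs,
    abs_of_nonneg (Nat.cast_nonneg n : (0 : ℝ) ≤ n)] at hn
  apply Real.le_sqrt_of_sq_le
  have h3 := (le_abs_self _).trans hn
  rw [pow_mul, one_div, inv_mul_eq_div, le_div_iff₀ (by positivity)] at h3
  have h4 : 0 ≤ (Real.log n ^ 2) ^ j := by positivity
  calc (B * Real.log n ^ j) ^ 2 = B ^ 2 * (Real.log n ^ 2) ^ j := by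
        rw [mul_pow, ← pow_mul, ← pow_mul, mul_comm j]
    _ ≤ _ := by nlinarith

variable {r : ℕ}

/-- Once at least `log n` copies of `K_{r+1}` minus an edge are expected on each pair, the parameter
`n ^ 2 * p ^ (r + 2)` is large: its `(r - 1)`-st power is the square of that number. -/
lemma eventually_le_sq_mul_pow (B : ℝ) : ∀ᶠ n : ℕ in atTop, ∀ p : ℝ, 0 < p → p ≤ 1 →
    Real.log n ≤ (n : ℝ) ^ (r - 1) * p ^ (r.choose 2 + (r - 1)) →
      B ≤ (n : ℝ) ^ 2 * p ^ (r + 2) := by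
  filter_upwards [eventually_le_log ((max B 1) ^ (r - 1) + 1)] with n hn p hp hp1 h
  by_contra! hcon
  have hB1 : 1 ≤ max B 1 := le_max_right _ _
  have h1 : ((n : ℝ) ^ 2 * p ^ (r + 2)) ^ (r - 1) ≤ (max B 1) ^ (r - 1) := by
    gcongr
    exact hcon.le.trans (le_max_left _ _)
  have h2 : ((n : ℝ) ^ 2 * p ^ (r + 2)) ^ (r - 1) =
      ((n : ℝ) ^ (r - 1) * p ^ (r.choose 2 + (r - 1))) ^ 2 := by
    rw [mul_pow, mul_pow, ← pow_mul, ← pow_mul, ← pow_mul, ← pow_mul,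
      mul_comm (r.choose 2 + (r - 1)) 2, two_mul_exponent, mul_comm (r + 2), mul_comm 2]
  have h3 : 1 ≤ (max B 1) ^ (r - 1) := one_le_pow₀ hB1
  nlinarith

lemma sqrt_le_mul_of_one_le {n : ℕ} {p : ℝ} (hr : 2 ≤ r) (hn : 1 ≤ n) (hp : 0 < p)
    (h : 1 ≤ (n : ℝ) ^ 2 * p ^ (r + 2)) : √(n : ℝ) ≤ n * p := by
  have hn' : (1 : ℝ) ≤ n := by exact_mod_cast hn
  refine le_of_pow_le_pow_left₀ (n := r + 2) (by omega) (by positivity) ?_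
  calc √(n : ℝ) ^ (r + 2) ≤ √(n : ℝ) ^ (2 * r) :=
        pow_le_pow_right₀ (Real.one_le_sqrt.2 hn') (by omega)
    _ = (n : ℝ) ^ r := by rw [pow_mul, Real.sq_sqrt (by positivity)]
    _ ≤ (n : ℝ) ^ r * ((n : ℝ) ^ 2 * p ^ (r + 2)) := le_mul_of_one_le_right (by positivity) h
    _ = _ := by rw [mul_pow]; ring

lemma one_le_sq_mul_pow {n : ℕ} {p B : ℝ} (hp : 0 < p) (hp1 : p ≤ 1)
    (h : B ≤ (n : ℝ) ^ 2 * p ^ (r + 2)) {b : ℕ} (hb : b ≤ r + 2) : B ≤ (n : ℝ) ^ 2 * p ^ b :=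
  h.trans (mul_le_mul_of_nonneg_left (pow_le_pow_of_le_one hp.le hp1 hb) (by positivity))

/-- A single pair is the rarest subgraph of a clique on at most `r` vertices. -/
lemma sq_mul_le_pow_mul_pow {n : ℕ} {p : ℝ} (hp : 0 < p) (hp1 : p ≤ 1)
    (h : 1 ≤ (n : ℝ) ^ 2 * p ^ (r + 2)) {a : ℕ} (ha : 2 ≤ a) (har : a ≤ r) :
    (n : ℝ) ^ 2 * p ≤ n ^ a * p ^ a.choose 2 := by
  refine le_of_pow_le_pow_left₀ (n := 2) (by omega) (by positivity) ?_
  obtain ⟨j, rfl⟩ := Nat.exists_eq_add_of_le' ha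
  have h1 := one_le_sq_mul_pow hp hp1 h (b := j + 3) (by omega)
  calc ((n : ℝ) ^ 2 * p) ^ 2 ≤ ((n : ℝ) ^ 2 * p) ^ 2 * ((n : ℝ) ^ 2 * p ^ (j + 3)) ^ j :=
        le_mul_of_one_le_right (by positivity) (one_le_pow₀ h1)
    _ = (n : ℝ) ^ ((j + 2) * 2) * p ^ (2 * (j + 2).choose 2) := by
        rw [two_mul_choose_two, show (j + 2) * (j + 2 - 1) = 2 + (j + 3) * j by
          rw [show j + 2 - 1 = j + 1 by omega]; ring]
        rw [mul_pow, mul_pow, ← pow_mul, ← pow_mul, ← pow_mul, pow_add p]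
        ring
    _ = _ := by rw [mul_pow, ← pow_mul, ← pow_mul, mul_comm 2]

/-- A single pendant pair is the rarest subgraph of a clique with one vertex fixed. -/
lemma mul_le_pow_mul_pow {n : ℕ} {p B : ℝ} (hp : 0 < p) (hp1 : p ≤ 1) (hB : 1 ≤ B)
    (h : B ^ 2 ≤ (n : ℝ) ^ 2 * p ^ (r + 2)) {a : ℕ} (ha : 2 ≤ a) (har : a ≤ r) :
    B * (n * p) ≤ n ^ a * p ^ (a.choose 2 + a) := by
  refine le_of_pow_le_pow_left₀ (n := 2) (by omega) (by positivity) ?_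
  obtain ⟨j, rfl⟩ := Nat.exists_eq_add_of_le' ha
  have h1 := one_le_sq_mul_pow hp hp1 h (b := j + 4) (by omega)
  have h2 : B ^ 2 ≤ ((n : ℝ) ^ 2 * p ^ (j + 4)) ^ (j + 1) :=
    h1.trans (le_self_pow₀ ((one_le_pow₀ hB).trans h1) (by omega))
  calc (B * (n * p)) ^ 2 = (n * p) ^ 2 * B ^ 2 := by ring
    _ ≤ (n * p) ^ 2 * ((n : ℝ) ^ 2 * p ^ (j + 4)) ^ (j + 1) := by gcongr
    _ = (n : ℝ) ^ ((j + 2) * 2) * p ^ (2 * (j + 2).choose 2 + (j + 2) * 2) := by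
        rw [two_mul_choose_two, show (j + 2) * (j + 2 - 1) + (j + 2) * 2 = 2 + (j + 4) * (j + 1) by
          rw [show j + 2 - 1 = j + 1 by omega]; ring]
        rw [mul_pow, mul_pow, ← pow_mul, ← pow_mul, pow_add p]
        ring
    _ = _ := by
        rw [mul_pow, ← pow_mul, ← pow_mul]
        congr 2
        ring

lemma mul_le_pow_mul_pow' {n : ℕ} {p : ℝ} (hp : 0 < p) (hp1 : p ≤ 1)
    (h : 1 ≤ (n : ℝ) ^ 2 * p ^ (r + 2)) {a : ℕ} (ha : 1 ≤ a) (har : a ≤ r) :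
    n * p ≤ (n : ℝ) ^ a * p ^ (a.choose 2 + a) := by
  rcases ha.eq_or_lt with rfl | ha
  · simp
  · simpa using mul_le_pow_mul_pow hp hp1 le_rfl (by simpa using h) ha har

/-- Cliques with two non-adjacent vertices fixed are numerous. -/
lemma log_le_pow_mul_pow {n : ℕ} {p B : ℝ} (hp : 0 < p) (hp1 : p ≤ 1) (hB : 1 ≤ B)
    (h : B ^ 2 ≤ (n : ℝ) ^ 2 * p ^ (r + 1)) {a : ℕ} (ha : 1 ≤ a) (har : a + 2 ≤ r) :
    B ≤ (n : ℝ) ^ a * p ^ (a.choose 2 + a * 2) := by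
  refine le_of_pow_le_pow_left₀ (n := 2) (by omega) (by positivity) ?_
  obtain ⟨j, rfl⟩ := Nat.exists_eq_add_of_le' ha
  have h1 : B ^ 2 ≤ (n : ℝ) ^ 2 * p ^ (j + 4) := h.trans
    (mul_le_mul_of_nonneg_left (pow_le_pow_of_le_one hp.le hp1 (by omega)) (by positivity))
  have h2 : B ^ 2 ≤ ((n : ℝ) ^ 2 * p ^ (j + 4)) ^ (j + 1) :=
    h1.trans (le_self_pow₀ ((one_le_pow₀ hB).trans h1) (by omega))
  calc B ^ 2 ≤ _ := h2
    _ = (n : ℝ) ^ ((j + 1) * 2) * p ^ (2 * (j + 1).choose 2 + (j + 1) * 2 * 2) := by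
        rw [two_mul_choose_two, show (j + 1) * (j + 1 - 1) + (j + 1) * 2 * 2 = (j + 4) * (j + 1) by
          rw [show j + 1 - 1 = j by omega]; ring]
        rw [mul_pow, ← pow_mul, ← pow_mul, mul_comm 2]
    _ = _ := by
        rw [mul_pow, ← pow_mul, ← pow_mul]
        congr 2
        ring

lemma eventually_log_sq_le (B : ℝ) : ∀ᶠ n : ℕ in atTop, ∀ p : ℝ, 0 < p → p ≤ 1 →
    1 ≤ (n : ℝ) ^ 2 * p ^ (r + 2) → (B * Real.log n) ^ 2 ≤ (n : ℝ) ^ 2 * p ^ (r + 1) := by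
  filter_upwards [eventually_log_pow_le_sqrt (|B| ^ (r + 2)) (r + 2), eventually_ge_atTop 1]
    with n hn hn1 p hp hp1 h
  have hn1' : (1 : ℝ) ≤ n := by exact_mod_cast hn1
  refine le_of_pow_le_pow_left₀ (n := r + 2) (by omega) (by positivity) ?_
  have hL : 0 ≤ Real.log n := Real.log_nonneg hn1'
  calc ((B * Real.log n) ^ 2) ^ (r + 2) = (|B| ^ (r + 2) * Real.log n ^ (r + 2)) ^ 2 := by
        rw [← sq_abs, abs_mul, abs_of_nonneg hL, ← mul_pow, ← pow_mul, ← pow_mul, mul_comm 2]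
    _ ≤ √(n : ℝ) ^ 2 := by gcongr
    _ = n := Real.sq_sqrt (by positivity)
    _ ≤ (n : ℝ) ^ 2 := le_self_pow₀ hn1' (by omega)
    _ ≤ (n : ℝ) ^ 2 * ((n : ℝ) ^ 2 * p ^ (r + 2)) ^ (r + 1) :=
        le_mul_of_one_le_right (by positivity) (one_le_pow₀ h)
    _ = _ := by
        rw [mul_pow, mul_pow, ← pow_mul, ← pow_mul, ← pow_mul, ← pow_mul,
          mul_comm (r + 2) (r + 1), ← mul_assoc, ← pow_add]
        congr 2
        ring

end Asymptotics

/-! ### Janson's conditions and the gain per pair -/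

section Conditions

/-- Splitting the expected number of copies into the part shared with a fixed copy and the rest. -/
lemma mul_pow_sub_le {q s k p U W : ℝ} {b e a f : ℕ} (ha : a ≤ b) (hf : f ≤ e)
    (hq : 0 ≤ q * s * k ^ (b - a) * p ^ (e - f))
    (hU : s * (q * (k ^ b * p ^ e)) ≤ U) (hW : W ≤ k ^ a * p ^ f) (hW0 : 0 < W) :
    q * s * k ^ (b - a) * p ^ (e - f) ≤ U / W := by
  rw [le_div_iff₀ hW0]
  refine (mul_le_mul_of_nonneg_left hW hq).trans (le_trans (le_of_eq ?_) hU)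
  rw [← pow_sub_mul_pow k ha, ← pow_sub_mul_pow p hf]
  ring

lemma pow_le_mul_pow {n k : ℕ} {r : ℕ} (hr : 1 ≤ r) (h : (n : ℝ) ≤ 2 * r * k) {a : ℕ}
    (ha : a ≤ r) :
    (n : ℝ) ^ a ≤ (2 * r) ^ r * (k : ℝ) ^ a := by
  have h1 : (1 : ℝ) ≤ 2 * r := by
    have : (1 : ℝ) ≤ r := by exact_mod_cast hr
    linarith
  calc (n : ℝ) ^ a ≤ (2 * r * k) ^ a := by gcongr
    _ = (2 * r) ^ a * (k : ℝ) ^ a := mul_pow _ _ _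
    _ ≤ _ := by gcongr

variable {r : ℕ}

/-- The conditions of `card_avoid_rooted_le`, for graphs with `t` pairs and maximum degree `D`. The
thinning parameter `q` keeps the expected number of copies per pair at most `4 * log n`, which is
all that is ever needed. -/
lemma eventually_rooted_conditions (hr : 2 ≤ r) {θ : ℝ} (hθ : 0 < θ) :
    ∃ η : ℝ, 0 < η ∧ ∀ᶠ n : ℕ in atTop, ∀ (p q : ℝ) (k D t : ℕ), 0 < p → p ≤ 1 → 0 ≤ q →
      Real.log n ≤ (n : ℝ) ^ (r - 1) * p ^ (r.choose 2 + (r - 1)) → (n : ℝ) ≤ 2 * r * k →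
      q * ((k : ℝ) ^ (r - 1) * p ^ (r.choose 2 + (r - 1))) ≤ 4 * Real.log n →
      D * Real.log n ≤ η * (n * p) → t * Real.log n ≤ η * (n ^ 2 * p) →
      (∀ a, 2 ≤ a → a + 1 ≤ r → q * t * (k : ℝ) ^ (r - 1 - a) *
        p ^ (r.choose 2 + (r - 1) - a.choose 2) ≤ θ) ∧
      (∀ a, 1 ≤ a → a + 1 ≤ r → q * D * (k : ℝ) ^ (r - 1 - a) *
        p ^ (r.choose 2 + (r - 1) - (a.choose 2 + a)) ≤ θ) ∧
      (∀ a, 1 ≤ a → a + 2 ≤ r → q * (k : ℝ) ^ (r - 1 - a) *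
        p ^ (r.choose 2 + (r - 1) - (a.choose 2 + a * 2)) ≤ θ) := by
  set z : ℝ := (2 * r) ^ r with hz
  have hr0 : (0 : ℝ) < r := by exact_mod_cast (by omega : 0 < r)
  have hz0 : 0 < z := by positivity
  refine ⟨θ / (4 * z), by positivity, ?_⟩
  filter_upwards [eventually_le_sq_mul_pow (r := r) 1, eventually_log_sq_le (r := r) (4 * z / θ),
    eventually_le_log (max 1 (θ / (4 * z))), eventually_ge_atTop 1] with n h1 h2 h3 hn p q k D t
    hp hp1 hq hbase hk hqμ hD ht
  have hX := h1 p hp hp1 hbase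
  have hX2 := h2 p hp hp1 hX
  have hL1 : 1 ≤ Real.log n := (le_max_left _ _).trans h3
  have hL2 : θ / (4 * z) ≤ Real.log n := (le_max_right _ _).trans h3
  have hn0 : (0 : ℝ) < n := by exact_mod_cast hn
  have hch : ∀ a b : ℕ, a ≤ b → a.choose 2 ≤ b.choose 2 := fun a b h => Nat.choose_le_choose 2 h
  have hsucc : ∀ a : ℕ, (a + 1).choose 2 = a.choose 2 + a := fun a => by
    rw [Nat.choose_succ_succ' a 1, Nat.choose_one_right, add_comm]
  have hpow : ∀ a f, a ≤ r → (n : ℝ) ^ a * p ^ f / z ≤ k ^ a * p ^ f := by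
    intro a f ha
    rw [div_le_iff₀ hz0]
    have := pow_le_mul_pow (by omega) hk ha
    calc _ ≤ (z * (k : ℝ) ^ a) * p ^ f := by gcongr
      _ = _ := by ring
  refine ⟨fun a ha har => ?_, fun a ha har => ?_, fun a ha har => ?_⟩
  · have h5 := mul_pow_sub_le (q := q) (s := t) (k := k) (p := p) (b := r - 1)
      (e := r.choose 2 + (r - 1)) (a := a) (f := a.choose 2) (by omega)
      (by have := hch a r (by omega); omega) (by positivity) (U := 4 * (θ / (4 * z) * (n ^ 2 * p)))
      (W := n ^ 2 * p / z) (by nlinarith [Nat.cast_nonneg (α := ℝ) t])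
      (le_trans (div_le_div_of_nonneg_right (sq_mul_le_pow_mul_pow hp hp1 hX ha (by omega)) hz0.le)
        (hpow a _ (by omega))) (by positivity)
    refine h5.trans (le_of_eq ?_)
    field_simp
  · have h5 := mul_pow_sub_le (q := q) (s := D) (k := k) (p := p) (b := r - 1)
      (e := r.choose 2 + (r - 1)) (a := a) (f := a.choose 2 + a) (by omega)
      (by have := hch (a + 1) r (by omega); have := hsucc a; omega) (by positivity)
      (U := 4 * (θ / (4 * z) * (n * p)))
      (W := n * p / z) (by nlinarith [Nat.cast_nonneg (α := ℝ) D])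
      (le_trans (div_le_div_of_nonneg_right (mul_le_pow_mul_pow' hp hp1 hX ha (by omega)) hz0.le)
        (hpow a _ (by omega))) (by positivity)
    refine h5.trans (le_of_eq ?_)
    field_simp
  · have hB1 : 1 ≤ 4 * z / θ * Real.log n := by
      rw [div_mul_eq_mul_div, le_div_iff₀ hθ]
      rw [div_le_iff₀ (by positivity)] at hL2
      linarith
    have h5 := mul_pow_sub_le (q := q) (s := 1) (k := k) (p := p) (b := r - 1)
      (e := r.choose 2 + (r - 1)) (a := a) (f := a.choose 2 + a * 2) (by omega)
      (by
        have := hch (a + 2) r (by omega)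
        have := hsucc a
        have := hsucc (a + 1)
        rw [show a + 1 + 1 = a + 2 from rfl] at this
        omega)
      (by positivity) (U := 4 * Real.log n)
      (W := 4 * z / θ * Real.log n / z) (by rwa [one_mul])
      (le_trans (div_le_div_of_nonneg_right (log_le_pow_mul_pow hp hp1 hB1 hX2 ha (by omega)) hz0.le)
        (hpow a _ (by omega))) (by positivity)
    rw [mul_one] at h5
    refine h5.trans (le_of_eq ?_)
    field_simp

/-- The exponent of `n` in the threshold is the one for which `n ^ (r - 1) * p ^ e` is of constant
order, where `e` is the number of edges of `K_{r+1}` minus an edge. -/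
lemma exponent_identity (hr : 2 ≤ r) :
    (2 - 2 / ((r : ℝ) + 2)) * (r.choose 2 + (r - 1) : ℕ) =
      2 * (r.choose 2 + (r - 1) : ℕ) - (r - 1) := by
  have he2' : 2 * ((r.choose 2 + (r - 1) : ℕ) : ℝ) = (r - 1) * (r + 2) := by
    have h := congrArg (Nat.cast (R := ℝ)) (two_mul_exponent r)
    rw [Nat.cast_mul, Nat.cast_mul, Nat.cast_sub (by omega : 1 ≤ r)] at h
    push_cast at h ⊢
    exact h
  have h1 : 2 - 2 / ((r : ℝ) + 2) = (2 * r + 2) / (r + 2) := by field_simp; ring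
  rw [h1, div_mul_eq_mul_div, div_eq_iff (by positivity)]
  linear_combination (-1) * he2'

/-- If the expected number of copies on a pair is at most `4 log n`, then `p` is close to the
threshold. -/
lemma log_sq_mul_le (hr : 2 ≤ r) {n k : ℕ} {p : ℝ} (hn : 1 ≤ Real.log n) (hp : 0 < p)
    (hk : (n : ℝ) ≤ 2 * r * k)
    (h4 : (k : ℝ) ^ (r - 1) * p ^ (r.choose 2 + (r - 1)) ≤ 4 * Real.log n) :
    Real.log ((n : ℝ) ^ 2 * p) ≤
      (2 - 2 / ((r : ℝ) + 2)) * Real.log n + Real.log (4 * (2 * r) ^ r * Real.log n) := by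
  set z : ℝ := (2 * r) ^ r with hz
  set e := r.choose 2 + (r - 1) with he
  set L := Real.log n with hL
  have hn0 : (0 : ℝ) < n := by
    rcases Nat.eq_zero_or_pos n with rfl | h
    · simp [hL] at hn; linarith
    · exact_mod_cast h
  have hr0 : (2 : ℝ) ≤ r := by exact_mod_cast hr
  have hz1 : 1 ≤ z := one_le_pow₀ (by linarith)
  have he1 : (1 : ℝ) ≤ e := by exact_mod_cast (by omega : 1 ≤ e)
  have hlog2 : Real.log ((n : ℝ) ^ 2 * p) = 2 * L + Real.log p := by
    rw [Real.log_mul (by positivity) hp.ne', Real.log_pow]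
    push_cast; ring
  have h5 : (n : ℝ) ^ (r - 1) * p ^ e ≤ 4 * z * L := by
    have := pow_le_mul_pow (by omega) hk (a := r - 1) (by omega)
    calc (n : ℝ) ^ (r - 1) * p ^ e ≤ (z * (k : ℝ) ^ (r - 1)) * p ^ e := by gcongr
      _ = z * ((k : ℝ) ^ (r - 1) * p ^ e) := by ring
      _ ≤ z * (4 * L) := by gcongr
      _ = _ := by ring
  have h6 := Real.log_le_log (by positivity) h5
  rw [Real.log_mul (by positivity) (by positivity), Real.log_pow, Real.log_pow,
    Nat.cast_sub (by omega), Nat.cast_one, ← hL] at h6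
  have hpos : 0 ≤ Real.log (4 * z * L) := Real.log_nonneg (by nlinarith)
  refine le_of_mul_le_mul_left ?_ (by linarith : (0 : ℝ) < e)
  rw [hlog2]
  have h7 := exponent_identity hr
  rw [← he] at h7
  have h8 : (e : ℝ) * ((2 - 2 / ((r : ℝ) + 2)) * L + Real.log (4 * z * L)) =
      (2 * e - (r - 1)) * L + e * Real.log (4 * z * L) := by rw [← h7]; ring
  rw [h8]
  have h9 : Real.log (4 * z * L) ≤ e * Real.log (4 * z * L) := le_mul_of_one_le_left hpos he1
  linarith

lemma log_one_add_le {n : ℕ} {p C : ℝ} (hC : 1 ≤ C) (hn : 1 ≤ n) (hp : 0 < p)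
    (hnp : √(n : ℝ) ≤ n * p) :
    Real.log (1 + n ^ 2 * (C * p)) ≤ Real.log (2 * C) + Real.log ((n : ℝ) ^ 2 * p) := by
  have hn1 : (1 : ℝ) ≤ n := by exact_mod_cast hn
  have hx1 : 1 ≤ (n : ℝ) ^ 2 * p := by
    have := Real.one_le_sqrt.2 hn1
    nlinarith
  rw [← Real.log_mul (by linarith) (by positivity)]
  apply Real.log_le_log (by positivity)
  nlinarith

/-- The number of choices of a pair costs less than what its copies of `K_{r+1}` minus an edge
gain. This is where the constant in the threshold enters: if `p` is close to the threshold, then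
`log (n ^ 2 * p)` is close to `(2 - 2 / (r + 2)) * log n`, and if `p` is larger, then the gain
`4 * log n` of the thinned family exceeds `log (n ^ 2)`. -/
lemma eventually_log_weight_le (hr : 2 ≤ r) {C ε : ℝ} (hC : 1 ≤ C) (hε : 0 < ε) (hε1 : ε ≤ 1 / 2) :
    ∀ᶠ n : ℕ in atTop, ∀ (p : ℝ) (k : ℕ), 0 < p → p ≤ 1 → √(n : ℝ) ≤ n * p →
      (n : ℝ) ≤ 2 * r * k →
      (1 + ε) * ((2 - 2 / ((r : ℝ) + 2)) * Real.log n) ≤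
        (k : ℝ) ^ (r - 1) * p ^ (r.choose 2 + (r - 1)) →
      Real.log (1 + n ^ 2 * (C * p)) + ε / 4 * Real.log n ≤
        (1 - ε / 8) * min ((k : ℝ) ^ (r - 1) * p ^ (r.choose 2 + (r - 1))) (4 * Real.log n) := by
  have hr0 : (2 : ℝ) ≤ r := by exact_mod_cast hr
  have ha1 : 1 ≤ 2 - 2 / ((r : ℝ) + 2) := by
    have : 2 / ((r : ℝ) + 2) ≤ 1 := by rw [div_le_one (by linarith)]; linarith
    linarith
  have hlogsmall := (Real.isLittleO_log_id_atTop.comp_tendsto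
    (Real.tendsto_log_atTop.comp tendsto_natCast_atTop_atTop)).bound (c := ε / 4) (by positivity)
  filter_upwards [hlogsmall, eventually_le_log
    (4 / ε * (Real.log (4 * (2 * r) ^ r) + Real.log (2 * C))),
    eventually_le_log (1 + Real.log (2 * C)), eventually_ge_atTop 1]
    with n hll hL1 hL2 hn p k hp hp1 hnp hk hμ
  have hn1 : (1 : ℝ) ≤ n := by exact_mod_cast hn
  have hlogC : 0 ≤ Real.log (2 * C) := Real.log_nonneg (by linarith)
  have hlog1 := log_one_add_le hC hn hp hnp
  have hlogp : Real.log p ≤ 0 := Real.log_nonpos hp.le hp1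
  have hlogsq : Real.log ((n : ℝ) ^ 2 * p) = 2 * Real.log n + Real.log p := by
    rw [Real.log_mul (by positivity) hp.ne', Real.log_pow]
    push_cast; ring
  have hlog3 := log_sq_mul_le hr (by linarith) hp hk
  have hz1 : 1 ≤ (2 * (r : ℝ)) ^ r := one_le_pow₀ (by linarith)
  simp only [Function.comp_apply, id_eq, Real.norm_eq_abs] at hll
  generalize (2 * (r : ℝ)) ^ r = z at *
  generalize (2 - 2 / ((r : ℝ) + 2)) = a at *
  generalize (k : ℝ) ^ (r - 1) * p ^ (r.choose 2 + (r - 1)) = μ at *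
  generalize Real.log ((n : ℝ) ^ 2 * p) = x at *
  generalize Real.log (1 + n ^ 2 * (C * p)) = y at *
  generalize Real.log n = L at *
  generalize Real.log (2 * C) = lc at *
  have hLpos : 1 ≤ L := by linarith
  rcases le_total (4 * L) μ with h4 | h4
  · rw [min_eq_right h4]
    nlinarith
  · rw [min_eq_left h4]
    have h7 := hlog3 h4
    rw [Real.log_mul (by positivity) (by positivity)] at h7
    rw [abs_of_nonneg (by linarith : 0 ≤ L)] at hll
    have hll' := (le_abs_self _).trans hll
    have h8 : Real.log (4 * z) + lc ≤ ε / 4 * L := by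
      have h : ε / 4 * (4 / ε * (Real.log (4 * z) + lc)) = Real.log (4 * z) + lc := by field_simp
      rw [← h]
      gcongr
    have h9 : (1 - ε / 8) * ((1 + ε) * (a * L)) ≤ (1 - ε / 8) * μ :=
      mul_le_mul_of_nonneg_left hμ (by linarith)
    have h10 : a * L + 3 / 4 * ε * L ≤ (1 - ε / 8) * ((1 + ε) * (a * L)) := by
      have h12 : L ≤ a * L := le_mul_of_one_le_left (by linarith) ha1
      have h11 : 1 + 3 / 4 * ε ≤ (1 - ε / 8) * (1 + ε) := by nlinarith
      calc a * L + 3 / 4 * ε * L ≤ a * L + 3 / 4 * ε * (a * L) := by gcongr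
        _ = (1 + 3 / 4 * ε) * (a * L) := by ring
        _ ≤ ((1 - ε / 8) * (1 + ε)) * (a * L) := by gcongr
        _ = _ := by ring
    linarith

end Conditions

/-! ### The cost of the cover -/

section CoverBounds

variable {r : ℕ}

/-- The cost of a cover is at most `A` for each of the `t` pairs, `B` for each of the `h` vertices and
`G` for each of the `s` vertices. -/
lemma coverWeight_le_exp {n : ℕ} {x y A B G : ℝ} (hx : 0 ≤ x) {t h s d₂ : ℕ}
    (hA : Real.log (1 + n ^ 2 * x) ≤ A) (hB : Real.log (1 + n) + x * n ≤ B)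
    (hG : Real.log (1 + n) + d₂ * Real.log y⁻¹ + y * x * n ≤ G) :
    coverWeight n x y t h s (s * d₂) ≤ Real.exp (t * A + h * B + s * G) := by
  have h1 : (1 + (n : ℝ) ^ 2 * x) ^ t = Real.exp (t * Real.log (1 + n ^ 2 * x)) := by
    rw [Real.exp_nat_mul, Real.exp_log (by positivity)]
  have h2 : ∀ j : ℕ, (1 + n : ℝ) ^ j = Real.exp (j * Real.log (1 + n)) := fun j => by
    rw [Real.exp_nat_mul, Real.exp_log (by positivity)]
  unfold coverWeight
  rw [h1, h2 h, h2 s, ← Real.exp_add, ← Real.exp_add, ← Real.exp_add, ← Real.exp_add]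
  apply Real.exp_le_exp.2
  push_cast
  have e1 : (t : ℝ) * Real.log (1 + n ^ 2 * x) ≤ t * A := by gcongr
  have e2 : (h : ℝ) * (Real.log (1 + n) + x * n) ≤ h * B := by gcongr
  have e3 : (s : ℝ) * (Real.log (1 + n) + d₂ * Real.log y⁻¹ + y * x * n) ≤ s * G := by gcongr
  linarith

lemma half_le_floor {x : ℝ} (hx : 1 ≤ x) : x / 2 ≤ ⌊x⌋₊ := by
  have h1 := Nat.lt_floor_add_one x
  have h2 : (1 : ℝ) ≤ ⌊x⌋₊ := by exact_mod_cast Nat.le_floor (by simpa using hx)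
  linarith

/-- The vertices of degree `D` in a graph with `t` pairs are few. -/
lemma cast_div_mul_le {t D : ℕ} {x η L : ℝ} (hL : 0 < L) (hη : 0 < η) (hx : 0 < x)
    (hD : η * x / L / 2 ≤ D) : ((2 * t / D : ℕ) : ℝ) * x ≤ 4 / η * (t * L) := by
  have hDpos : (0 : ℝ) < D := lt_of_lt_of_le (by positivity) hD
  have h1 : ((2 * t / D : ℕ) : ℝ) ≤ 2 * t / D := by
    have := Nat.cast_div_le (α := ℝ) (m := 2 * t) (n := D)
    push_cast at this
    exact this
  have h2 : x ≤ 2 * L / η * D := by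
    rw [div_div, div_le_iff₀ (by positivity)] at hD
    rw [div_mul_eq_mul_div, le_div_iff₀ hη]
    linarith
  calc ((2 * t / D : ℕ) : ℝ) * x ≤ (2 * t / D) * (2 * L / η * D) := by gcongr
    _ = _ := by field_simp; ring

set_option maxHeartbeats 400000 in
/-- The costs of the pairs that a maximal bounded-degree subgraph with `t` pairs leaves over: they are
dominated by the gain `ρ` per pair of the subgraph, or by the gain `K * n * p` for each of `a`
vertices of high degree. The constants are chosen in the order `y`, `κ`, `ε'`, `K`. -/
lemma eventually_cover_bounds (hr : 2 ≤ r) {C ε η : ℝ} (hC : 1 ≤ C) (hε : 0 < ε) (hε1 : ε ≤ 1)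
    (hη : 0 < η) :
    ∃ y κ ε' K : ℝ, 0 < y ∧ y ≤ 1 ∧ 0 < κ ∧ κ ≤ 1 ∧ 0 < ε' ∧ 1 ≤ K ∧
      ∀ᶠ n : ℕ in atTop, ∀ (p w ρ : ℝ), 0 < p → p ≤ 1 → √(n : ℝ) ≤ n * p → 0 ≤ w → w ≤ C * p →
        Real.log (1 + n ^ 2 * (C * p)) + ε * Real.log n ≤ ρ →
        1 ≤ ⌊η * (n * p) / Real.log n⌋₊ ∧
        (∀ t : ℕ, coverWeight n w y t ⌊ε' * (t * Real.log n) / (n * p)⌋₊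
          (2 * t / ⌊η * (n * p) / Real.log n⌋₊)
          (2 * t / ⌊η * (n * p) / Real.log n⌋₊ * (2 * ⌈κ * (n * p)⌉₊)) * Real.exp (-(ρ * t)) ≤
            Real.exp (-(ε / 2 * Real.log n * t))) ∧
        ∀ a : ℕ, 1 ≤ a → (Real.exp (-(K * (n * p))) * Real.exp (r * (n * w))) ^ a *
          coverWeight n w y ⌊2 * r * a * (n * p) / (ε' * Real.log n)⌋₊ (2 * r * a)
            (2 * ⌊2 * r * a * (n * p) / (ε' * Real.log n)⌋₊ / ⌊η * (n * p) / Real.log n⌋₊)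
            (2 * ⌊2 * r * a * (n * p) / (ε' * Real.log n)⌋₊ / ⌊η * (n * p) / Real.log n⌋₊ *
              (2 * ⌈κ * (n * p)⌉₊)) * (n : ℝ) ^ a ≤ Real.exp (-(n * p)) := by
  have hr0 : (2 : ℝ) ≤ r := by exact_mod_cast hr
  -- each vertex of full degree in the subgraph may cost `g * (n * p)`, as there are at most
  -- `4 * t * log n / (η * n * p)` of them
  set g : ℝ := min 1 (η * ε / 16) with hg
  have hg0 : 0 < g := by positivity
  have hg1 : g ≤ 1 := min_le_left _ _
  have hgη : 4 / η * g ≤ ε / 4 := by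
    have h1 : g ≤ η * ε / 16 := min_le_right _ _
    calc 4 / η * g ≤ 4 / η * (η * ε / 16) := by gcongr
      _ = _ := by field_simp; ring
  set y : ℝ := g / (4 * C) with hy
  have hy0 : 0 < y := by positivity
  have hy1 : y < 1 := by rw [hy, div_lt_one (by linarith)]; linarith
  set lam : ℝ := Real.log y⁻¹ with hlam
  have hlam0 : 0 < lam := Real.log_pos ((one_lt_inv₀ hy0).2 hy1)
  set κ : ℝ := min 1 (g / (8 * lam)) with hκ
  have hκ0 : 0 < κ := by positivity
  have hκg : 2 * κ * lam ≤ g / 4 := by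
    have h1 : κ ≤ g / (8 * lam) := min_le_right _ _
    calc 2 * κ * lam ≤ 2 * (g / (8 * lam)) * lam := by gcongr
      _ = _ := by field_simp; ring
  set ε' : ℝ := ε / (4 * (C + 1)) with hε'
  have hε'0 : 0 < ε' := by positivity
  set K : ℝ := r * C + 8 * r / ε' + 2 * r * (C + 1) + 2 with hK
  refine ⟨y, κ, ε', K, hy0, hy1.le, hκ0, min_le_left _ _, hε'0, ?_, ?_⟩
  · have : 0 ≤ r * C + 8 * r / ε' + 2 * r * (C + 1) := by positivity
    linarith
  filter_upwards [eventually_log_pow_le_sqrt ((4 + 4 * lam) / g) 1, eventually_log_pow_le_sqrt 2 1,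
    eventually_log_pow_le_sqrt (1 / η) 1,
    eventually_le_log 1, eventually_ge_atTop (⌈C⌉₊ + 2)]
    with n h1 h2 h3 h4 h5 p w ρ hp hp1 hnp hw hwC hρ
  rw [pow_one] at h1 h2 h3
  have hn2 : (C : ℝ) + 2 ≤ n := by
    have := Nat.le_ceil C
    have h6 : ((⌈C⌉₊ + 2 : ℕ) : ℝ) ≤ n := by exact_mod_cast h5
    push_cast at h6
    linarith
  have hn0 : (0 : ℝ) < n := by linarith
  have hx0 : 0 < n * p := by positivity
  set x := (n : ℝ) * p with hx
  set L := Real.log n with hL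
  have hL0 : 0 < L := by linarith
  have hlog1n : Real.log (1 + n) ≤ 2 * L := by
    have : 2 * L = Real.log ((n : ℝ) ^ 2) := by rw [Real.log_pow]; push_cast; ring
    rw [this]
    apply Real.log_le_log (by positivity)
    nlinarith
  have hDx : 1 ≤ η * x / L := by
    rw [le_div_iff₀ hL0]
    have : 1 / η * L ≤ x := h3.trans hnp
    rw [div_mul_eq_mul_div, div_le_iff₀ hη] at this
    linarith
  set D := ⌊η * x / L⌋₊ with hD
  have hDhalf : η * x / L / 2 ≤ D := half_le_floor hDx
  have hA1 : Real.log (1 + n ^ 2 * w) ≤ Real.log (1 + n ^ 2 * (C * p)) :=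
    Real.log_le_log (by positivity) (by gcongr)
  have hA2 : Real.log (1 + n ^ 2 * w) ≤ 3 * L := by
    have : 3 * L = Real.log ((n : ℝ) ^ 3) := by rw [Real.log_pow]; push_cast; ring
    rw [this]
    apply Real.log_le_log (by positivity)
    have hwC' : w ≤ C := hwC.trans (mul_le_of_le_one_right (by linarith) hp1)
    calc 1 + (n : ℝ) ^ 2 * w ≤ 1 + (n : ℝ) ^ 2 * C := by gcongr
      _ ≤ (n : ℝ) ^ 2 * (C + 2) := by nlinarith
      _ ≤ (n : ℝ) ^ 2 * n := by gcongr
      _ = _ := by ring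
  have hwn : w * n ≤ C * x := by
    calc w * n ≤ C * p * n := by gcongr
      _ = _ := by rw [hx]; ring
  have hB : Real.log (1 + n) + w * n ≤ (C + 1) * x := by
    have := h2.trans hnp
    linarith
  have hG : Real.log (1 + n) + ((2 * ⌈κ * x⌉₊ : ℕ) : ℝ) * Real.log y⁻¹ + y * w * n ≤ g * x := by
    have e1 : (⌈κ * x⌉₊ : ℝ) ≤ κ * x + 1 := (Nat.ceil_lt_add_one (by positivity)).le
    have e2 : ((2 * ⌈κ * x⌉₊ : ℕ) : ℝ) * lam ≤ 2 * (κ * x + 1) * lam := by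
      push_cast
      gcongr
    have e3 : y * w * n ≤ g / 4 * x := by
      calc y * w * n = y * (w * n) := by ring
        _ ≤ y * (C * x) := by gcongr
        _ = _ := by rw [hy]; field_simp
    have e4 : 2 * (κ * x + 1) * lam ≤ g / 4 * x + 2 * lam := by
      calc 2 * (κ * x + 1) * lam = 2 * κ * lam * x + 2 * lam := by ring
        _ ≤ _ := by gcongr
    have e5 : 2 * L + 2 * lam ≤ g / 2 * x := by
      have h6 := h1.trans hnp
      rw [div_mul_eq_mul_div, div_le_iff₀ hg0] at h6
      have : lam ≤ lam * L := le_mul_of_one_le_right hlam0.le h4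
      linarith
    rw [← hlam]
    linarith
  have hs : ∀ t : ℕ, ((2 * t / D : ℕ) : ℝ) * (g * x) ≤ ε / 4 * (t * L) := by
    intro t
    calc ((2 * t / D : ℕ) : ℝ) * (g * x) = g * (((2 * t / D : ℕ) : ℝ) * x) := by ring
      _ ≤ g * (4 / η * (t * L)) :=
          mul_le_mul_of_nonneg_left (cast_div_mul_le hL0 hη hx0 hDhalf) hg0.le
      _ = (4 / η * g) * (t * L) := by ring
      _ ≤ _ := by gcongr
  refine ⟨Nat.le_floor (by simpa using hDx), fun t => ?_, fun a ha => ?_⟩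
  · refine (mul_le_mul_of_nonneg_right (coverWeight_le_exp hw hA1 hB hG)
      (Real.exp_pos _).le).trans ?_
    rw [← Real.exp_add]
    apply Real.exp_le_exp.2
    have e1 : (⌊ε' * (t * L) / x⌋₊ : ℝ) * ((C + 1) * x) ≤ ε / 4 * (t * L) := by
      calc (⌊ε' * (t * L) / x⌋₊ : ℝ) * ((C + 1) * x) ≤ (ε' * (t * L) / x) * ((C + 1) * x) := by
            gcongr
            exact Nat.floor_le (by positivity)
        _ = _ := by rw [hε']; field_simp
    have e2 := hs t
    have e3 : (t : ℝ) * (Real.log (1 + n ^ 2 * (C * p)) + ε * L) ≤ t * ρ := by gcongr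
    linarith
  · set t := ⌊2 * r * a * x / (ε' * L)⌋₊ with ht
    have htle : (t : ℝ) * L ≤ 2 * r * a * x / ε' := by
      calc (t : ℝ) * L ≤ (2 * r * a * x / (ε' * L)) * L := by
            gcongr
            exact Nat.floor_le (by positivity)
        _ = _ := by field_simp
    have ha1 : (1 : ℝ) ≤ a := by exact_mod_cast ha
    have hna : (n : ℝ) ^ a = Real.exp (a * L) := by
      rw [Real.exp_nat_mul, Real.exp_log hn0]
    have hcw := coverWeight_le_exp (t := t) (h := 2 * r * a) (s := 2 * t / D) hw hA2 hB hG
    rw [hna, ← Real.exp_add, ← Real.exp_nat_mul]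
    refine (mul_le_mul_of_nonneg_right (mul_le_mul_of_nonneg_left hcw
      (Real.exp_pos _).le) (Real.exp_pos _).le).trans ?_
    rw [← Real.exp_add, ← Real.exp_add]
    apply Real.exp_le_exp.2
    have e1 := hs t
    have e2 : (n : ℝ) * w ≤ C * x := by linarith
    have e3 : (a : ℝ) * (-(K * x) + r * (n * w)) ≤ a * (-(K * x) + r * (C * x)) := by gcongr
    have e4 : ε / 4 * (t * L) ≤ t * L := by
      refine mul_le_of_le_one_left (by positivity) (by linarith)
    have e5 : (a : ℝ) * L ≤ a * x := by
      gcongr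
      have := h2.trans hnp
      linarith
    have e6 : x ≤ a * x := le_mul_of_one_le_left hx0.le ha1
    have e7 : (a : ℝ) * (K * x) = r * C * (a * x) + 4 * (2 * r * a * x / ε') +
        2 * r * (C + 1) * (a * x) + 2 * (a * x) := by rw [hK]; field_simp; ring
    push_cast
    clear_value K t D x L
    linarith

end CoverBounds

/-! ### Typical sets of crossing pairs -/

section Typical

variable {r : ℕ}

/-- The ratio in `card_many_cliqueFreeTuples_le`, with `x = n * p`, when each tuple of the moment
gains `exp (-4 * K * x)` and the bad tuples form a much smaller proportion. -/
lemma typical_ratio_le {K κ x : ℝ} (hK : 1 ≤ K) (hκ : 0 < κ) (hx : 1 ≤ x) {d : ℕ}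
    (hd : κ * x ≤ d) :
    (Real.exp (-(4 * (K * x))) + (d : ℝ) ^ r * (2 * (Real.exp (-(r + 3 * K / κ)) / 2)) ^ d) /
      Real.exp (-(K * x)) ≤ Real.exp (-(K * x)) := by
  have hKx : 1 ≤ K * x := by nlinarith
  rw [div_le_iff₀ (Real.exp_pos _), ← Real.exp_add]
  have hhalf : Real.exp (-1 : ℝ) ≤ 1 / 2 := by
    rw [Real.exp_neg, ← one_div]
    exact one_div_le_one_div_of_le (by norm_num) (by linarith [Real.add_one_le_exp (1 : ℝ)])
  have h3 : Real.exp (-(3 * (K * x))) ≤ Real.exp (-(K * x) + -(K * x)) / 2 := by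
    calc Real.exp (-(3 * (K * x))) ≤ Real.exp ((-(K * x) + -(K * x)) + (-1)) :=
          Real.exp_le_exp.2 (by linarith)
      _ ≤ _ := by rw [Real.exp_add]; nlinarith [Real.exp_pos (-(K * x) + -(K * x))]
  have h1 : Real.exp (-(4 * (K * x))) ≤ Real.exp (-(3 * (K * x))) :=
    Real.exp_le_exp.2 (by linarith)
  have h2 : (d : ℝ) ^ r * (2 * (Real.exp (-(r + 3 * K / κ)) / 2)) ^ d ≤
      Real.exp (-(3 * (K * x))) := by
    have e1 : (d : ℝ) ^ r ≤ Real.exp (r * d) := by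
      rw [Real.exp_nat_mul]
      gcongr
      linarith [Real.add_one_le_exp (d : ℝ)]
    rw [mul_div_cancel₀ _ (two_ne_zero), ← Real.exp_nat_mul]
    calc (d : ℝ) ^ r * Real.exp (d * -(r + 3 * K / κ))
        ≤ Real.exp (r * d) * Real.exp (d * -(r + 3 * K / κ)) := by gcongr
      _ = Real.exp (-(3 * K / κ * d)) := by rw [← Real.exp_add]; congr 1; ring
      _ ≤ _ := by
        apply Real.exp_le_exp.2
        have : 3 * K / κ * (κ * x) ≤ 3 * K / κ * d := by gcongr
        have e : 3 * K / κ * (κ * x) = 3 * (K * x) := by field_simp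
        linarith
  linarith

/-- The conditions of `card_many_cliqueFreeTuples_le` on the spread families. -/
lemma typical_spread_condition {n d b smax : ℕ} {p q K κ τ B : ℝ} (hr : 2 ≤ r) (hp : 0 < p)
    (hp1 : p ≤ 1) (hn : 1 ≤ n) (hK : 0 < K) (hκ : 0 < κ) (hκ1 : κ ≤ 1) (hτ : 0 < τ) (hq : 0 ≤ q)
    (hB : B = 2 ^ r * 32 * K / κ ^ r) (hB1 : 1 ≤ B) (hX : 1 ≤ (n : ℝ) ^ 2 * p ^ (r + 2))
    (hXB : B ^ 2 ≤ (n : ℝ) ^ 2 * p ^ (r + 2)) (hd : κ * (n * p) ≤ d)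
    (hb : (d : ℝ) ^ r ≤ 2 * b) (hqb : q * (b * p ^ r.choose 2) = 8 * K * (n * p))
    (hs : (smax : ℝ) ≤ τ ^ 2 / (2 ^ r * 2 * 2 ^ r * 8 * K * (2 * r) ^ r) * n)
    {a : ℕ} (ha : 2 ≤ a) (har : a ≤ r) :
    2 ^ r * (q * (d ^ (r - a) + 2 ^ r * (smax * b) / (τ ^ 2 * ((n : ℝ) / (2 * r)) ^ a)) *
      p ^ (r.choose 2 - a.choose 2)) ≤ 1 := by
  have hr0 : (2 : ℝ) ≤ r := by exact_mod_cast hr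
  have hn0 : (0 : ℝ) < n := by exact_mod_cast hn
  have hch : a.choose 2 ≤ r.choose 2 := Nat.choose_le_choose 2 har
  set z : ℝ := (2 * r) ^ r with hz
  have hz0 : 0 < z := by positivity
  have hx0 : 0 < n * p := by positivity
  have hB0 : 0 < B := by linarith
  have h1 : q * d ^ (r - a) * p ^ (r.choose 2 - a.choose 2) ≤ 1 / (2 * 2 ^ r) := by
    have h := mul_pow_sub_le (q := q) (s := 1) (k := (d : ℝ)) (p := p) (b := r)
      (e := r.choose 2) (a := a) (f := a.choose 2) har hch (by positivity)
      (U := 16 * K * (n * p)) (W := κ ^ r * (B * (n * p))) ?_ ?_ (by positivity)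
    · rw [mul_one] at h
      refine h.trans (le_of_eq ?_)
      rw [hB]
      field_simp
      norm_num
    · calc 1 * (q * ((d : ℝ) ^ r * p ^ r.choose 2)) ≤ 1 * (q * ((2 * b) * p ^ r.choose 2)) := by
            gcongr
        _ = 2 * (q * (b * p ^ r.choose 2)) := by ring
        _ = _ := by rw [hqb]; ring
    · calc κ ^ r * (B * (n * p)) ≤ κ ^ a * ((n : ℝ) ^ a * p ^ (a.choose 2 + a)) :=
            mul_le_mul (pow_le_pow_of_le_one hκ.le hκ1 har)
              (mul_le_pow_mul_pow hp hp1 hB1 hXB ha har) (by positivity) (by positivity)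
        _ = (κ * (n * p)) ^ a * p ^ a.choose 2 := by rw [mul_pow, mul_pow, pow_add]; ring
        _ ≤ _ := by gcongr
  have h2 : q * (2 ^ r * (smax * b) / (τ ^ 2 * ((n : ℝ) / (2 * r)) ^ a)) *
      p ^ (r.choose 2 - a.choose 2) ≤ 1 / (2 * 2 ^ r) := by
    have hv : (n : ℝ) ^ 2 * p / z ≤ ((n : ℝ) / (2 * r)) ^ a * p ^ a.choose 2 := by
      have e1 := sq_mul_le_pow_mul_pow hp hp1 hX ha har
      have e2 : (2 * (r : ℝ)) ^ a ≤ z := pow_le_pow_right₀ (by linarith) har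
      rw [div_pow, div_mul_eq_mul_div]
      gcongr
    have hpos : 0 < τ ^ 2 * ((n : ℝ) ^ 2 * p / z) := by positivity
    have e3 : q * (2 ^ r * (smax * b) / (τ ^ 2 * ((n : ℝ) / (2 * r)) ^ a)) *
        p ^ (r.choose 2 - a.choose 2) * (τ ^ 2 * ((n : ℝ) ^ 2 * p / z)) ≤
        2 ^ r * smax * (8 * K * (n * p)) := by
      calc _ ≤ q * (2 ^ r * (smax * b) / (τ ^ 2 * ((n : ℝ) / (2 * r)) ^ a)) *
            p ^ (r.choose 2 - a.choose 2) *
            (τ ^ 2 * (((n : ℝ) / (2 * r)) ^ a * p ^ a.choose 2)) := by gcongr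
        _ = 2 ^ r * smax * (q * (b * (p ^ (r.choose 2 - a.choose 2) * p ^ a.choose 2))) := by
            have : ((n : ℝ) / (2 * r)) ^ a ≠ 0 := by positivity
            field_simp
        _ = _ := by rw [pow_sub_mul_pow p hch, hqb]
    rw [← le_div_iff₀ hpos] at e3
    refine e3.trans ?_
    rw [div_le_iff₀ hpos]
    calc 2 ^ r * smax * (8 * K * (n * p)) ≤
        2 ^ r * (τ ^ 2 / (2 ^ r * 2 * 2 ^ r * 8 * K * z) * n) * (8 * K * (n * p)) := by gcongr
      _ = _ := by field_simp
  calc _ = 2 ^ r * (q * d ^ (r - a) * p ^ (r.choose 2 - a.choose 2) +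
        q * (2 ^ r * (smax * b) / (τ ^ 2 * ((n : ℝ) / (2 * r)) ^ a)) *
      p ^ (r.choose 2 - a.choose 2)) := by ring
    _ ≤ 2 ^ r * (1 / (2 * 2 ^ r) + 1 / (2 * 2 ^ r)) := by gcongr
    _ = 1 := by field_simp; norm_num

/-- For almost all sets of crossing pairs, only an exponentially small proportion of the tuples of
vertex sets of size proportional to `n * p` span no `K_r`. -/
lemma eventually_card_atypical_le (hr : 2 ≤ r) {K κ : ℝ} (hK : 1 ≤ K) (hκ : 0 < κ) (hκ1 : κ ≤ 1) :
    ∃ ν : ℝ, 0 < ν ∧ ∀ᶠ n : ℕ in atTop, ∀ (p η : ℝ) (c : Fin n → Fin r) (M : ℕ), 0 < p → p ≤ 1 →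
      Real.log n ≤ (n : ℝ) ^ (r - 1) * p ^ (r.choose 2 + (r - 1)) →
      (∀ j, (n : ℝ) ≤ 2 * r * (colorClass c j).card) → 0 < η →
      p * (crossPairs c).card ≤ (1 - η) * (M + 1) →
      ((((crossPairs c).powersetCard M).filter fun H =>
        Real.exp (-(K * (n * p))) * (transversals c).card ^ ⌈κ * (n * p)⌉₊ <
          (cliqueFreeTuples c ⌈κ * (n * p)⌉₊ H).card).card : ℝ) ≤
        η⁻¹ * Real.exp (-(ν * (n ^ 2 * p))) * (crossPairs c).card.choose M := by
  have hr0 : (2 : ℝ) ≤ r := by exact_mod_cast hr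
  have hK0 : 0 < K := by linarith
  set τ : ℝ := Real.exp (-(r + 3 * K / κ)) / 2 with hτ
  have hτ0 : 0 < τ := by positivity
  have hτ1 : τ ≤ 1 := by
    have : Real.exp (-(r + 3 * K / κ)) ≤ 1 := Real.exp_le_one_iff.2 (by
      have : 0 ≤ r + 3 * K / κ := by positivity
      linarith)
    rw [hτ]
    linarith
  set B : ℝ := 2 ^ r * 32 * K / κ ^ r with hB
  have hB1 : 1 ≤ B := by
    rw [hB, le_div_iff₀ (by positivity), one_mul]
    have h1 : κ ^ r ≤ 1 := pow_le_one₀ hκ.le hκ1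
    have h2 : (1 : ℝ) ≤ 2 ^ r := one_le_pow₀ (by norm_num)
    nlinarith
  set ν₀ : ℝ := τ ^ 2 / (2 ^ r * 2 * 2 ^ r * 8 * K * (2 * r) ^ r) with hν₀
  have hν₀0 : 0 < ν₀ := by positivity
  refine ⟨ν₀ / 2, by positivity, ?_⟩
  filter_upwards [eventually_le_sq_mul_pow (r := r) (B ^ 2), eventually_ge_atTop 1,
    tendsto_natCast_atTop_atTop.eventually_ge_atTop (1 / ν₀)]
    with n h1 hn hnν p η c M hp hp1 hbase hcl hη hpM
  have hn1 : (1 : ℝ) ≤ n := by exact_mod_cast hn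
  have hXB := h1 p hp hp1 hbase
  have hX : 1 ≤ (n : ℝ) ^ 2 * p ^ (r + 2) := (one_le_pow₀ hB1).trans hXB
  have hx1 : 1 ≤ n * p :=
    (Real.one_le_sqrt.2 hn1).trans (sqrt_le_mul_of_one_le hr hn hp hX)
  set x := (n : ℝ) * p with hx
  set d := ⌈κ * x⌉₊ with hd
  have hdx : κ * x ≤ d := Nat.le_ceil _
  have hd0 : 0 < d := Nat.ceil_pos.2 (by positivity)
  set b := (d ^ r + 1) / 2 with hb
  have hb2 : d ^ r ≤ 2 * b := by omega
  have hb2' : (d : ℝ) ^ r ≤ 2 * b := by exact_mod_cast hb2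
  have hb0 : (0 : ℝ) < b := by
    have : (0 : ℝ) < (d : ℝ) ^ r := by positivity
    linarith
  set smax := ⌊ν₀ * n⌋₊ with hsmax
  have hν1 : 1 ≤ ν₀ * n := by
    rw [div_le_iff₀ hν₀0] at hnν
    linarith
  have hs1 : (smax : ℝ) ≤ ν₀ * n := Nat.floor_le (by positivity)
  have hs2 : ν₀ * n / 2 ≤ smax := half_le_floor hν1
  have hs0 : (0 : ℝ) < smax := by linarith
  set q : ℝ := 8 * K * x / (b * p ^ r.choose 2) with hq
  have hqb : q * (b * p ^ r.choose 2) = 8 * K * x := by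
    rw [hq, div_mul_cancel₀]
    positivity
  have hq1 : q ≤ 1 := by
    rw [hq, div_le_one (by positivity)]
    have e1 := mul_le_pow_mul_pow hp hp1 hB1 hXB hr le_rfl
    have e2 : κ ^ r * (B * x) = 2 ^ r * 32 * K * x := by rw [hB]; field_simp
    have e3 : κ ^ r * (B * x) ≤ d ^ r * p ^ r.choose 2 := by
      calc κ ^ r * (B * x) ≤ κ ^ r * ((n : ℝ) ^ r * p ^ (r.choose 2 + r)) := by gcongr
        _ = (κ * x) ^ r * p ^ r.choose 2 := by rw [hx, mul_pow, mul_pow, pow_add]; ring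
        _ ≤ _ := by gcongr
    have e4 : (d : ℝ) ^ r * p ^ r.choose 2 ≤ 2 * b * p ^ r.choose 2 := by gcongr
    have e5 : (1 : ℝ) ≤ 2 ^ r := one_le_pow₀ (by norm_num)
    have e6 : K * x ≤ 2 ^ r * (K * x) := le_mul_of_one_le_left (by positivity) e5
    nlinarith
  have key := card_many_cliqueFreeTuples_le (c := c) (d := d) (b := b) (smax := smax) hd0 (by omega)
    (κ := fun a => 2 ^ r * (smax * b) / (τ ^ 2 * ((n : ℝ) / (2 * r)) ^ a)) (fun a => by positivity)
    (v₀ := (n : ℝ) / (2 * r)) (τ := τ) (by positivity)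
    (fun j => by
      rw [div_le_iff₀ (by positivity), mul_comm]
      exact hcl j) hτ0 hτ1
    (fun a _ _ => le_of_eq (by
      have : ((n : ℝ) / (2 * r)) ^ a ≠ 0 := by positivity
      field_simp)) M hp.le hp1 (by positivity : 0 ≤ q) hq1 hη hpM
    (fun a ha har => typical_spread_condition hr hp hp1 hn hK0 hκ hκ1 hτ0 (by positivity) hB hB1 hX
      hXB hdx hb2' hqb hs1 ha har) (Real.exp_pos (-(K * x)))
  refine key.trans ?_
  rw [mul_right_comm]
  gcongr
  have e1 : q * b * p ^ r.choose 2 / 2 = 4 * (K * x) := by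
    rw [mul_assoc, hqb]; ring
  rw [e1]
  calc _ ≤ (Real.exp (-(K * x))) ^ smax := by
        gcongr
        exact typical_ratio_le hK hκ hx1 hdx
    _ ≤ _ := by
        rw [← Real.exp_nat_mul]
        apply Real.exp_le_exp.2
        have e2 : ν₀ * n / 2 * x ≤ smax * x := by gcongr
        have e3 : (smax : ℝ) * x ≤ smax * (K * x) := by
          gcongr
          exact le_mul_of_one_le_left (by linarith) hK
        have e4 : ν₀ / 2 * (n ^ 2 * p) = ν₀ * n / 2 * x := by rw [hx]; ring
        rw [e4]
        linarith

end Typical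

/-! ### The sparse case for large `n` -/

section SparseAsymptotics

variable {r : ℕ}

/-- The number of all sets of at most `δ * m` monochromatic pairs is `exp (o (n ^ 2 * p))` as `δ`
tends to zero. -/
lemma few_mono_cost_le {n m N : ℕ} {p w C g η₁ : ℝ} (hC : 1 ≤ C) (hg : 0 < g) (hη₁ : η₁ ≤ 1 / 2)
    (hN : N ≤ n ^ 2) (hp : 0 < p) (hpN : p * N = (1 - η₁) ^ 2 * m) (hwC : w ≤ C * p)
    {y δ : ℝ} (hy : 0 < y) (hyg : y ≤ g / (4 * C)) (hy1 : y ≤ 1)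
    (hδg : δ ≤ g / (16 * (Real.log y⁻¹ + 1))) :
    δ * m * Real.log y⁻¹ + y * w * (n : ℝ) ^ 2 ≤ g / 2 * (n ^ 2 * p) := by
  have hlam : 0 ≤ Real.log y⁻¹ := Real.log_nonneg ((one_le_inv₀ hy).2 hy1)
  generalize Real.log y⁻¹ = lam at *
  have hm4 : (m : ℝ) ≤ 4 * (n ^ 2 * p) := by
    have h1 : (N : ℝ) ≤ n ^ 2 := by exact_mod_cast hN
    have h2 : p * N ≤ p * n ^ 2 := by gcongr
    have h3 : (1 / 2 : ℝ) ^ 2 * m ≤ (1 - η₁) ^ 2 * m := by gcongr; linarith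
    linarith
  have e1 : δ * m * lam ≤ g / 4 * (n ^ 2 * p) := by
    calc δ * m * lam ≤ g / (16 * (lam + 1)) * (4 * (n ^ 2 * p)) *
          (lam + 1) := by gcongr; linarith
      _ = _ := by field_simp; norm_num
  have e2 : y * w * (n : ℝ) ^ 2 ≤ g / 4 * (n ^ 2 * p) := by
    calc y * w * (n : ℝ) ^ 2 ≤ y * (C * p) * (n : ℝ) ^ 2 := by gcongr
      _ ≤ g / (4 * C) * (C * p) * (n : ℝ) ^ 2 := by gcongr
      _ = _ := by field_simp
  linarith

open Classical in
/-- The gain from the pairs of a graph with at most `t` pairs and maximum degree at most `D`. The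
thinning parameter reduces the expected number of copies per pair to at most `4 * log n`. -/
lemma card_noRootedClique_le_exp {n k D t M : ℕ} {c : Fin n → Fin r} {p η₁ ε : ℝ} (hr : 2 ≤ r)
    (hε : 0 < ε) (hp : 0 < p) (hp1 : p ≤ 1) (hη₁ : 0 < η₁)
    (hpM : p * (crossPairs c).card ≤ (1 - η₁) * (M + 1)) (hL : 0 < Real.log n)
    (hk : ∀ j, k ≤ (colorClass c j).card) (hnk : (n : ℝ) ≤ 2 * r * k)
    (hcond : ∀ q : ℝ, 0 ≤ q →
      q * ((k : ℝ) ^ (r - 1) * p ^ (r.choose 2 + (r - 1))) ≤ 4 * Real.log n →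
      (∀ a, 2 ≤ a → a + 1 ≤ r → q * t * (k : ℝ) ^ (r - 1 - a) *
        p ^ (r.choose 2 + (r - 1) - a.choose 2) ≤ ε / (4 * 4 ^ r * (r + 3))) ∧
      (∀ a, 1 ≤ a → a + 1 ≤ r → q * D * (k : ℝ) ^ (r - 1 - a) *
        p ^ (r.choose 2 + (r - 1) - (a.choose 2 + a)) ≤ ε / (4 * 4 ^ r * (r + 3))) ∧
      (∀ a, 1 ≤ a → a + 2 ≤ r → q * (k : ℝ) ^ (r - 1 - a) *
        p ^ (r.choose 2 + (r - 1) - (a.choose 2 + a * 2)) ≤ ε / (4 * 4 ^ r * (r + 3))))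
    {T T' : Finset (Sym2 (Fin n))} (hT : T ⊆ monoPairs c) (hT' : T' ⊆ T)
    (hD : ∀ v, (edgesAt T' v).card ≤ D) (ht : T'.card ≤ t) :
    ((((crossPairs c).powersetCard M).filter fun H => NoRootedClique c T H).card : ℝ) ≤
      η₁⁻¹ * Real.exp (-((1 - ε / 8) * min ((k : ℝ) ^ (r - 1) * p ^ (r.choose 2 + (r - 1)))
        (4 * Real.log n) * T'.card)) * (crossPairs c).card.choose M := by
  have hn0 : (0 : ℝ) < n := by
    rcases Nat.eq_zero_or_pos n with rfl | h
    · simp at hL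
    · exact_mod_cast h
  have hk0 : (0 : ℝ) < k := by
    by_contra! h
    have : (2 : ℝ) * r * k ≤ 0 := mul_nonpos_of_nonneg_of_nonpos (by positivity) h
    linarith
  set μ := (k : ℝ) ^ (r - 1) * p ^ (r.choose 2 + (r - 1)) with hμ
  have hμ0 : 0 < μ := by positivity
  set q := min μ (4 * Real.log n) / μ with hq
  have hq0 : 0 ≤ q := by positivity
  have hqμ : q * μ = min μ (4 * Real.log n) := div_mul_cancel₀ _ hμ0.ne'
  obtain ⟨c0, c1, c2⟩ := hcond q hq0 (by rw [hqμ]; exact min_le_right _ _)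
  have h := card_noRootedClique_le hk hT hT' hD ht M hp.le hp1 hq0
    (div_le_one_of_le₀ (min_le_left _ _) hμ0.le) hη₁ hpM (by positivity) c0 c1 c2
  refine h.trans (le_of_eq ?_)
  have e1 : q * (T'.card * (k : ℝ) ^ (r - 1)) * p ^ (r.choose 2 + (r - 1)) =
      min μ (4 * Real.log n) * T'.card := by rw [← hqμ, hμ]; ring
  have e2 : (4 : ℝ) ^ r * (r + 3) * (ε / (4 * 4 ^ r * (r + 3))) / 2 = ε / 8 := by
    field_simp; norm_num
  rw [e1, e2]
  ring_nf

/-- The set `H` has `m - #T` pairs; the margin `1 - η₁` between the density `p` and `m / N` covers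
the loss of the at most `δ * m` pairs of `T`. -/
lemma mul_le_of_card_le {m t N : ℕ} {p η₁ δ : ℝ} (hη₁ : η₁ ≤ 1) (hδ : δ ≤ η₁)
    (hpN : p * N = (1 - η₁) ^ 2 * m) (ht : (t : ℝ) ≤ δ * m) :
    p * N ≤ (1 - η₁) * ((m - t : ℕ) + 1) := by
  have h1 : (m : ℝ) - t ≤ ((m - t : ℕ) : ℝ) := by
    rw [sub_le_iff_le_add]
    exact_mod_cast (by omega : m ≤ m - t + t)
  have h2 : δ * m ≤ η₁ * m := by gcongr
  rw [hpN, sq, mul_assoc]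
  exact mul_le_mul_of_nonneg_left (by linarith) (by linarith)

lemma exp_cost_le {x X L ν ε cost g₀ : ℝ} (hg₀ : 0 ≤ g₀) (hν : 0 < ν)
    (hs : 2 / ν * (ε / 8) * L ≤ X) (hcost : cost ≤ ν / 2 * X) (hx : ν * X ≤ x) :
    g₀ * Real.exp (-x) * Real.exp cost ≤ g₀ * Real.exp (-(ε / 8 * L)) := by
  rw [mul_assoc, ← Real.exp_add]
  refine mul_le_mul_of_nonneg_left (Real.exp_le_exp.2 ?_) hg₀
  have h3 : ε / 8 * L ≤ ν / 2 * X := by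
    calc ε / 8 * L = ν / 2 * (2 / ν * (ε / 8) * L) := by field_simp
      _ ≤ _ := mul_le_mul_of_nonneg_left hs (by positivity)
  linarith

set_option maxHeartbeats 800000 in
open Classical in
/-- Counting when a positive proportion of the crossing pairs is missing, in the form that the weight
`m / (N - m)` of a monochromatic pair is at most `C * p`. -/
theorem eventually_card_sparse_le (hr : 2 ≤ r) {C ε η₁ : ℝ} (hC : 1 ≤ C) (hε : 0 < ε)
    (hε1 : ε ≤ 1 / 2) (hη₁ : 0 < η₁) (hη₁' : η₁ ≤ 1 / 2) :
    ∃ δ : ℝ, 0 < δ ∧ ∃ A : ℝ, 0 < A ∧ ∀ᶠ n : ℕ in atTop, ∀ (c : Fin n → Fin r) (m k : ℕ) (p : ℝ),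
      m < (crossPairs c).card → 0 < p → p ≤ 1 →
      p * (crossPairs c).card = (1 - η₁) ^ 2 * m →
      (m : ℝ) / ((crossPairs c).card - m) ≤ C * p →
      (∀ j, k ≤ (colorClass c j).card) → (n : ℝ) ≤ 2 * r * k → k ≤ n →
      (1 + ε) * ((2 - 2 / ((r : ℝ) + 2)) * Real.log n) ≤
        (k : ℝ) ^ (r - 1) * p ^ (r.choose 2 + (r - 1)) →
      ∀ 𝒢 : Finset (Finset (Sym2 (Fin n)) × Finset (Sym2 (Fin n))),
        (∀ x ∈ 𝒢, IsBadPair c m x.1 x.2 ∧ (x.1.card : ℝ) ≤ δ * m) →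
        (𝒢.card : ℝ) ≤ A * Real.exp (-(ε / 8 * Real.log n)) * (crossPairs c).card.choose m := by
  have hr0 : (2 : ℝ) ≤ r := by exact_mod_cast hr
  have ha1 : 1 ≤ 2 - 2 / ((r : ℝ) + 2) := by
    have : 2 / ((r : ℝ) + 2) ≤ 1 := by rw [div_le_one (by linarith)]; linarith
    linarith
  obtain ⟨η, hη, hrooted⟩ := eventually_rooted_conditions hr (θ := ε / (4 * 4 ^ r * (r + 3)))
    (by positivity)
  obtain ⟨y, κ, ε', K, hy, hy1, hκ, hκ1, hε', hK, hcover⟩ :=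
    eventually_cover_bounds hr hC (ε := ε / 4) (by linarith) (by linarith) hη
  obtain ⟨ν, hν, htyp⟩ := eventually_card_atypical_le hr hK hκ hκ1
  set g : ℝ := min ν (η / 4) with hg
  have hg0 : 0 < g := by positivity
  set y' : ℝ := min 1 (g / (4 * C)) with hy'
  have hy'0 : 0 < y' := by positivity
  have hy'1 : y' ≤ 1 := min_le_left _ _
  have hlam : 0 ≤ Real.log y'⁻¹ := Real.log_nonneg ((one_le_inv₀ hy'0).2 hy'1)
  set δ : ℝ := min η₁ (g / (16 * (Real.log y'⁻¹ + 1))) with hδ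
  have hδ0 : 0 < δ := by positivity
  refine ⟨δ, hδ0, 4 * η₁⁻¹ + Real.exp 1, by positivity, ?_⟩
  filter_upwards [hrooted, hcover, htyp, eventually_le_sq_mul_pow (r := r) 1,
    eventually_log_weight_le hr hC hε hε1, eventually_log_pow_le_sqrt (1 / η) 1,
    eventually_log_pow_le_sqrt (2 / ν * (ε / 8)) 1,
    eventually_log_pow_le_sqrt (2 / (η / 4) * (ε / 8)) 1,
    eventually_log_pow_le_sqrt (ε / 8) 1,
    eventually_le_log (8 / ε), eventually_ge_atTop 1]
    with n Hroot Hcov Htyp Hsq Hlog Hs1 Hs2 Hs3 Hs4 HL hn c m k p hm hp hp1 hpN hw hk hnk hkn hμ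
      𝒢 h𝒢
  rw [pow_one] at Hs1 Hs2 Hs3 Hs4
  have hn1 : (1 : ℝ) ≤ n := by exact_mod_cast hn
  set L := Real.log n with hLdef
  have hL1 : 1 ≤ L := by
    refine le_trans ?_ HL
    rw [le_div_iff₀ hε]
    linarith
  set μ := (k : ℝ) ^ (r - 1) * p ^ (r.choose 2 + (r - 1)) with hμdef
  have hμL : L ≤ μ := by
    refine le_trans ?_ hμ
    have h1 : L ≤ (2 - 2 / ((r : ℝ) + 2)) * L := le_mul_of_one_le_left (by linarith) ha1
    nlinarith
  have hbase : L ≤ (n : ℝ) ^ (r - 1) * p ^ (r.choose 2 + (r - 1)) := hμL.trans (by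
    rw [hμdef]; gcongr)
  have hX := Hsq p hp hp1 hbase
  have hnp := sqrt_le_mul_of_one_le hr hn hp hX
  have hn2p : (n : ℝ) * p ≤ n ^ 2 * p := by
    rw [sq, mul_assoc]
    exact le_mul_of_one_le_left (by positivity) hn1
  have hNn : (crossPairs c).card ≤ n ^ 2 := by
    have := card_sym2_le (crossPairs c)
    rwa [Fintype.card_fin] at this
  have hNm : (0 : ℝ) < (crossPairs c).card - m := sub_pos.2 (by exact_mod_cast hm)
  have hw0 : 0 ≤ (m : ℝ) / ((crossPairs c).card - m) := by positivity
  set ρ := (1 - ε / 8) * min μ (4 * L) with hρ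
  have hρL : L / 2 ≤ ρ := by
    have h1 : L ≤ min μ (4 * L) := le_min hμL (by linarith)
    have h2 : 1 / 2 ≤ 1 - ε / 8 := by linarith
    nlinarith
  obtain ⟨hD1, hcovT, hcovA⟩ := Hcov p _ ρ hp hp1 hnp hw0 hw
    (Hlog p k hp hp1 hnp hnk hμ)
  set D := ⌊η * (n * p) / L⌋₊ with hD
  set tmax := ⌊η * (n ^ 2 * p) / L⌋₊ with htmax
  set d := ⌈κ * (n * p)⌉₊ with hd
  have hDL : D * L ≤ η * (n * p) := by
    rw [← le_div_iff₀ (by linarith)]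
    exact Nat.floor_le (by positivity)
  have htL : tmax * L ≤ η * (n ^ 2 * p) := by
    rw [← le_div_iff₀ (by linarith)]
    exact Nat.floor_le (by positivity)
  have htmax2 : η * (n ^ 2 * p) / L / 2 ≤ tmax := by
    refine half_le_floor ?_
    rw [le_div_iff₀ (by linarith), one_mul]
    have h1 := (Hs1.trans hnp).trans hn2p
    rw [div_mul_eq_mul_div, div_le_iff₀ hη] at h1
    linarith
  have hcost := few_mono_cost_le (δ := δ) hC hg0 hη₁' hNn hp hpN hw hy'0 (min_le_right _ _) hy'1
    (min_le_right _ _)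
  have hpM : ∀ T : Finset (Sym2 (Fin n)), (T.card : ℝ) ≤ δ * m →
      p * (crossPairs c).card ≤ (1 - η₁) * ((m - T.card : ℕ) + 1) := fun T hT =>
    mul_le_of_card_le (by linarith) (min_le_left _ _) hpN hT
  have key := card_sparse_le c hm (D := D) (d := d) (tmax := tmax) (l := δ * m) (y := y) (y' := y')
    (ρ := ρ) (σ := ε / 4 / 2 * L) (g₀ := η₁⁻¹) (gB := η₁⁻¹ * Real.exp (-(ν * (n ^ 2 * p))))
    (β := Real.exp (-(K * (n * p)))) (b₁ := η₁⁻¹ * Real.exp (-(ε / 8 * L)))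
    (b₂ := η₁⁻¹ * Real.exp (-(ε / 8 * L))) (b₄ := Real.exp (-(n * p)))
    (fun t => 2 * t / D) (fun t => ⌊ε' * (t * L) / (n * p)⌋₊)
    (fun a => ⌊2 * r * a * (n * p) / (ε' * L)⌋₊) hD1 (by positivity) (by positivity)
    (by positivity) (by positivity) hy hy1 hy'0 hy'1
    (fun t a h => (Nat.le_div_iff_mul_le hD1).2 h)
    (fun t t' h => Nat.div_le_div_right (by omega))
    (fun t a h => by
      rw [Nat.floor_lt (by positivity), div_lt_iff₀ (by positivity)] at h
      refine Nat.le_floor ?_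
      rw [le_div_iff₀ (by positivity)]
      push_cast at h
      linarith)
    (fun T T' hT hT' hTD hTt hTl => card_noRootedClique_le_exp hr hε hp hp1 hη₁ (hpM T hTl)
      (by linarith) hk hnk (fun q hq hqμ => Hroot p q k D tmax hp hp1 hq hbase hnk hqμ hDL htL)
      hT hT' hTD hTt)
    (fun T hT hTl => Htyp p η₁ c _ hp hp1 hbase (fun j => hnk.trans (by
      gcongr
      exact hk j)) hη₁ (hpM T hTl))
    ?_ ?_ ?_ ?_ ?_ 𝒢 h𝒢
  · refine key.trans (mul_le_mul_of_nonneg_right ?_ (Nat.cast_nonneg _))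
    have e1 : Real.exp (-(ε / 4 / 2 * L)) = Real.exp (-(ε / 8 * L)) := by congr 1; ring
    have e2 : Real.exp 1 * Real.exp (-(n * p)) ≤ Real.exp 1 * Real.exp (-(ε / 8 * L)) :=
      mul_le_mul_of_nonneg_left (Real.exp_le_exp.2 (by linarith [Hs4.trans hnp]))
        (Real.exp_pos 1).le
    rw [e1]
    linarith
  · rw [Fintype.card_fin]
    refine exp_cost_le (inv_pos.2 hη₁).le hν ((Hs2.trans hnp).trans hn2p) (hcost.trans ?_) le_rfl
    exact mul_le_mul_of_nonneg_right (by linarith [min_le_left ν (η / 4)]) (by positivity)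
  · rw [Fintype.card_fin]
    refine exp_cost_le (ν := η / 4) (inv_pos.2 hη₁).le (by positivity) (Hs3.trans (hnp.trans hn2p))
      (hcost.trans ?_) ?_
    · exact mul_le_mul_of_nonneg_right (by linarith [min_le_right ν (η / 4)]) (by positivity)
    · calc η / 4 * (n ^ 2 * p) = L / 2 * (η * (n ^ 2 * p) / L / 2) := by field_simp; norm_num
        _ ≤ _ := mul_le_mul hρL htmax2 (by positivity) (by linarith)
  · have h1 : (1 : ℝ) ≤ ε / 4 / 2 * L := by
      rw [div_le_iff₀ hε] at HL
      linarith
    have hhalf : Real.exp (-1 : ℝ) ≤ 1 / 2 := by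
      rw [Real.exp_neg, ← one_div]
      exact one_div_le_one_div_of_le (by norm_num) (by linarith [Real.add_one_le_exp (1 : ℝ)])
    exact (Real.exp_le_exp.2 (by linarith)).trans hhalf
  · intro t _ _
    rw [Fintype.card_fin]
    exact hcovT t
  · intro a ha _
    rw [Fintype.card_fin]
    exact hcovA a ha

end SparseAsymptotics

/-! ### From graphs to sets of pairs -/

section Graphs

variable {n r : ℕ}

open Classical in
/-- The edges of `G`, as a finite set. -/
noncomputable def edgePairs (G : SimpleGraph (Fin n)) : Finset (Sym2 (Fin n)) :=
  Finset.univ.filter fun e => e ∈ G.edgeSet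

lemma mk_mem_edgePairs {G : SimpleGraph (Fin n)} {a b : Fin n} :
    s(a, b) ∈ edgePairs G ↔ G.Adj a b := by
  simp [edgePairs]

lemma numEdges_eq (G : SimpleGraph (Fin n)) : numEdges G = (edgePairs G).card := by
  rw [numEdges, ← Set.ncard_coe_finset]
  congr 1
  ext e
  simp [edgePairs]

lemma edgePairs_partitionGraph (c : Fin n → Fin r) :
    edgePairs (partitionGraph c) = crossPairs c := by
  ext e
  induction e with
  | h a b =>
    rw [mk_mem_edgePairs, mk_mem_crossPairs]
    simp [partitionGraph]

lemma edgePairs_sdiff (G : SimpleGraph (Fin n)) (c : Fin n → Fin r) :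
    edgePairs (G \ partitionGraph c) = edgePairs G ∩ monoPairs c := by
  ext e
  induction e with
  | h a b =>
    rw [Finset.mem_inter, mk_mem_edgePairs, mk_mem_edgePairs, mk_mem_monoPairs]
    simp only [SimpleGraph.sdiff_adj, partitionGraph, SimpleGraph.comap_adj, SimpleGraph.top_adj,
      not_not]
    exact ⟨fun h => ⟨h.1, h.1.ne, h.2⟩, fun h => ⟨h.1, h.2.2⟩⟩

lemma edgePairs_eq_union (G : SimpleGraph (Fin n)) (c : Fin n → Fin r) :
    edgePairs G = (edgePairs G ∩ monoPairs c) ∪ (edgePairs G ∩ crossPairs c) := by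
  ext e
  induction e with
  | h a b =>
    simp only [Finset.mem_union, Finset.mem_inter, mk_mem_edgePairs, mk_mem_monoPairs,
      mk_mem_crossPairs]
    constructor
    · intro h
      by_cases hc : c a = c b
      · exact Or.inl ⟨h, h.ne, hc⟩
      · exact Or.inr ⟨h, hc⟩
    · rintro (h | h) <;> exact h.1

lemma card_inter_add_card_inter (G : SimpleGraph (Fin n)) (c : Fin n → Fin r) :
    (edgePairs G ∩ monoPairs c).card + (edgePairs G ∩ crossPairs c).card = (edgePairs G).card := by
  rw [← Finset.card_union_of_disjoint, ← edgePairs_eq_union]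
  rw [Finset.disjoint_left]
  intro e he he'
  exact (Finset.mem_filter.1 (Finset.mem_inter.1 he').2).2
    (Finset.mem_filter.1 (Finset.mem_inter.1 he).2).2.2

lemma edgePairs_injective : Function.Injective (edgePairs (n := n)) := by
  intro G G' h
  ext a b
  rw [← mk_mem_edgePairs, h, mk_mem_edgePairs]

lemma noRootedClique_of_cliqueFree {G : SimpleGraph (Fin n)} (c : Fin n → Fin r)
    (hG : G.CliqueFree (r + 1)) :
    NoRootedClique c (edgePairs G ∩ monoPairs c) (edgePairs G ∩ crossPairs c) := by
  intro v w hw hv hvj hsub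
  have hadj : ∀ j, G.Adj v (w j) := by
    intro j
    by_cases hj : j = c v
    · rw [hj]
      exact mk_mem_edgePairs.1 (Finset.mem_inter.1 hv).1
    · exact mk_mem_edgePairs.1 (Finset.mem_inter.1 (hvj j hj)).1
  have hclique : G.IsNClique r (Finset.univ.image w) := by
    refine ⟨?_, ?_⟩
    · intro a ha b hb hab
      obtain ⟨j, -, rfl⟩ := Finset.mem_image.1 (Finset.mem_coe.1 ha)
      obtain ⟨k, -, rfl⟩ := Finset.mem_image.1 (Finset.mem_coe.1 hb)
      refine mk_mem_edgePairs.1 (Finset.mem_inter.1 (hsub (mem_pairsOn.2 ⟨j, Finset.mem_univ _, k,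
        Finset.mem_univ _, ?_, rfl⟩))).1
      rintro rfl
      exact hab rfl
    · rw [Finset.card_image_of_injective _ (injective_of_transversal hw), Finset.card_univ,
        Fintype.card_fin]
  refine hG _ (hclique.insert (a := v) fun b hb => ?_)
  obtain ⟨j, -, rfl⟩ := Finset.mem_image.1 hb
  exact hadj j

lemma degInClass_self (G : SimpleGraph (Fin n)) (c : Fin n → Fin r) (v : Fin n) :
    degInClass G c v (c v) = (nbrs (edgePairs G ∩ monoPairs c) v).card := by
  rw [degInClass, ← Set.ncard_coe_finset]
  congr 1
  ext u
  simp only [Set.mem_ofPred_eq, Finset.mem_coe, mem_nbrs, Finset.mem_inter, mk_mem_edgePairs,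
    mk_mem_monoPairs]
  exact ⟨fun h => ⟨h.1, h.1.ne, h.2.symm⟩, fun h => ⟨h.1, h.2.2.symm⟩⟩

lemma degInClass_of_ne (G : SimpleGraph (Fin n)) (c : Fin n → Fin r) {v : Fin n} {j : Fin r}
    (hj : j ≠ c v) : degInClass G c v j =
      ((nbrs (edgePairs G ∩ crossPairs c) v).filter fun u => c u = j).card := by
  rw [degInClass, ← Set.ncard_coe_finset]
  congr 1
  ext u
  simp only [Set.mem_ofPred_eq, Finset.coe_filter, mem_nbrs, Finset.mem_inter, mk_mem_edgePairs,
    mk_mem_crossPairs]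
  refine ⟨fun h => ⟨⟨h.1, fun h' => hj ?_⟩, h.2⟩, fun h => ⟨h.1.1, h.2⟩⟩
  rw [← h.2, h']

lemma isBadPair_of_mem {m : ℕ} {δ γ : ℝ} {c : Fin n → Fin r} {G : SimpleGraph (Fin n)}
    (hG : G ∈ starFamilyOfPartition m δ γ c) :
    IsBadPair c m (edgePairs G ∩ monoPairs c) (edgePairs G ∩ crossPairs c) ∧
      ((edgePairs G ∩ monoPairs c).card : ℝ) ≤ δ * m := by
  obtain ⟨⟨⟨⟨hm, hfree⟩, -, -⟩, hfew, hunf⟩, hpos⟩ := hG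
  rw [numEdges_eq, edgePairs_sdiff] at hpos
  refine ⟨⟨Finset.inter_subset_right, Finset.inter_subset_right, ?_, Finset.card_pos.1 hpos,
    noRootedClique_of_cliqueFree c hfree, fun v j hj => ?_⟩, ?_⟩
  · rw [card_inter_add_card_inter, ← numEdges_eq, hm]
  · rw [← degInClass_self, ← degInClass_of_ne G c hj]
    exact hunf v j hj
  · rw [FewMonochromatic, numEdges_eq, edgePairs_sdiff] at hfew
    exact hfew

lemma exists_pairs_of_starFamily (m : ℕ) (δ γ : ℝ) (c : Fin n → Fin r) :
    ∃ 𝒢 : Finset (Finset (Sym2 (Fin n)) × Finset (Sym2 (Fin n))),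
      (starFamilyOfPartition m δ γ c).ncard = 𝒢.card ∧
      ∀ x ∈ 𝒢, IsBadPair c m x.1 x.2 ∧ (x.1.card : ℝ) ≤ δ * m := by
  classical
  set F := (Set.toFinite (starFamilyOfPartition m δ γ c)).toFinset with hF
  refine ⟨F.image fun G => (edgePairs G ∩ monoPairs c, edgePairs G ∩ crossPairs c), ?_, ?_⟩
  · rw [Finset.card_image_of_injective, ← Set.ncard_eq_toFinset_card]
    intro G G' h
    obtain ⟨h1, h2⟩ := Prod.ext_iff.1 h
    dsimp only at h1 h2
    apply edgePairs_injective
    rw [edgePairs_eq_union G c, h1, h2, ← edgePairs_eq_union]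
  · intro x hx
    obtain ⟨G, hG, rfl⟩ := Finset.mem_image.1 hx
    exact isBadPair_of_mem ((Set.Finite.mem_toFinset _).1 hG)

lemma ncard_color_eq (c : Fin n → Fin r) (j : Fin r) :
    ({v | c v = j} : Set (Fin n)).ncard = (colorClass c j).card := by
  rw [← Set.ncard_coe_finset]
  congr 1
  ext v
  simp [colorClass]

/-- The number of crossing pairs is at most that of the balanced colouring. -/
lemma card_crossPairs_le (hr : 1 ≤ r) (c : Fin n → Fin r) :
    ((crossPairs c).card : ℝ) ≤ ((r : ℝ) - 1) / (2 * r) * n ^ 2 := by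
  have hr0 : (0 : ℝ) < r := by exact_mod_cast hr
  have h1 : 2 * (crossPairs c).card ≤ ∑ v, (edgesAt (crossPairs c) v).card := by
    have h2 : ∑ v, (edgesAt (crossPairs c) v).card =
        ∑ e ∈ crossPairs c, (Finset.univ.filter fun v => v ∈ e).card :=
      Finset.sum_card_bipartiteAbove_eq_sum_card_bipartiteBelow (s := Finset.univ)
        (t := crossPairs c) fun v e => v ∈ e
    rw [h2, mul_comm, ← smul_eq_mul]
    refine Finset.card_nsmul_le_sum _ _ _ fun e he => ?_
    induction e with
    | h a b =>
      have hab : a ≠ b := fun h => mk_mem_crossPairs.1 he (by rw [h])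
      rw [← Finset.card_pair hab]
      refine Finset.card_le_card fun x hx => ?_
      simpa using hx
  have h3 : ∀ v, (edgesAt (crossPairs c) v).card + (colorClass c (c v)).card = n := by
    intro v
    have : nbrs (crossPairs c) v = Finset.univ \ colorClass c (c v) := by
      ext u
      simp [mem_nbrs, mk_mem_crossPairs, colorClass, eq_comm]
    rw [card_edgesAt, this, Finset.card_sdiff_add_card_eq_card (Finset.subset_univ _),
      Finset.card_univ, Fintype.card_fin]
  have h4 : ∑ v, (colorClass c (c v)).card = ∑ j, (colorClass c j).card ^ 2 := by
    rw [← Finset.sum_fiberwise_of_maps_to (s := Finset.univ) (t := Finset.univ) (g := c)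
      fun _ _ => Finset.mem_univ _]
    refine Finset.sum_congr rfl fun j _ => ?_
    rw [Finset.sum_congr rfl (g := fun _ => (colorClass c j).card)
      fun v hv => by rw [(Finset.mem_filter.1 hv).2], Finset.sum_const, smul_eq_mul, sq]
    rfl
  have h5 : ∑ j, (colorClass c j).card = n := by
    have := Finset.card_eq_sum_card_fiberwise (f := c) (s := Finset.univ) (t := Finset.univ)
      fun _ _ => Finset.mem_coe.2 (Finset.mem_univ _)
    rw [Finset.card_univ, Fintype.card_fin] at this
    exact this.symm
  have h6 : (n : ℝ) ^ 2 ≤ r * ∑ j, ((colorClass c j).card : ℝ) ^ 2 := by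
    have := sq_sum_le_card_mul_sum_sq (s := (Finset.univ : Finset (Fin r)))
      (f := fun j => ((colorClass c j).card : ℝ))
    rw [Finset.card_univ, Fintype.card_fin] at this
    have h7 : ∑ j, ((colorClass c j).card : ℝ) = n := by exact_mod_cast h5
    rwa [h7] at this
  have h8 : ∑ v, (edgesAt (crossPairs c) v).card + ∑ j, (colorClass c j).card ^ 2 = n * n := by
    rw [← h4, ← Finset.sum_add_distrib, Finset.sum_congr rfl fun v _ => h3 v]
    simp
  have h9 : 2 * ((crossPairs c).card : ℝ) + ∑ j, ((colorClass c j).card : ℝ) ^ 2 ≤ n * n := by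
    have : 2 * (crossPairs c).card + ∑ j, (colorClass c j).card ^ 2 ≤ n * n := by omega
    exact_mod_cast this
  rw [div_mul_eq_mul_div, le_div_iff₀ (by positivity)]
  nlinarith

end Graphs

/-! ### The threshold -/

section Threshold

variable {r : ℕ}

/-- With `k = n / r` vertices per class and density `p = m_r(n) / ((r - 1) / (2 * r) * n ^ 2)`, the
expected number `k ^ (r - 1) * p ^ e` of copies of `K_{r+1}` minus an edge on a given monochromatic
pair is exactly `(2 - 2 / (r + 2)) * log n`; here without denominators. -/
lemma mThreshold_pow (hr : 2 ≤ r) {n : ℕ} (hn : 1 ≤ n) :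
    mThreshold r n ^ (r.choose 2 + (r - 1)) * (n : ℝ) ^ (r - 1) =
      (((r : ℝ) - 1) / (2 * r) * n ^ 2) ^ (r.choose 2 + (r - 1)) *
        ((r : ℝ) ^ (r - 1) * ((2 - 2 / ((r : ℝ) + 2)) * Real.log n)) := by
  have hr0 : (2 : ℝ) ≤ r := by exact_mod_cast hr
  have hn1 : (1 : ℝ) ≤ n := by exact_mod_cast hn
  have hL : 0 ≤ Real.log n := Real.log_nonneg hn1
  set e := r.choose 2 + (r - 1) with he
  have he1 : 1 ≤ e := by omega
  have he0 : (e : ℝ) ≠ 0 := by positivity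
  have hr1 : ((r - 1 : ℕ) : ℝ) = (r : ℝ) - 1 := by rw [Nat.cast_sub (by omega)]; simp
  have he2 : 2 / ((r : ℝ) + 2) * e = (r - 1 : ℕ) := by
    have h := exponent_identity hr
    rw [← he] at h
    rw [hr1]
    linarith
  have hch : (((r + 1).choose 2 : ℕ) : ℝ) - 1 = e := by
    have : (r + 1).choose 2 = e + 1 := by
      have h := Nat.choose_succ_succ' r 1
      rw [Nat.choose_one_right] at h
      change (r + 1).choose 2 = r + r.choose 2 at h
      omega
    rw [this]; push_cast; ring
  set ζ : ℝ := ((2 * (r : ℝ) + 2) / ((r : ℝ) + 2)) with hζ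
  have hζ0 : 0 < ζ := by positivity
  have hζa : ζ = 2 - 2 / ((r : ℝ) + 2) := by rw [hζ]; field_simp; ring
  have h1 : (((r : ℝ) * ζ ^ (1 / ((r : ℝ) - 1))) ^ (2 / ((r : ℝ) + 2))) ^ e =
      (r : ℝ) ^ (r - 1) * ζ := by
    rw [← Real.rpow_mul_natCast (by positivity), he2, Real.rpow_natCast, mul_pow,
      ← Real.rpow_mul_natCast hζ0.le, hr1, one_div, inv_mul_cancel₀ (by linarith), Real.rpow_one]
  have h2 : ((n : ℝ) ^ (2 - 2 / ((r : ℝ) + 2))) ^ e * (n : ℝ) ^ (r - 1) = (n ^ 2 : ℝ) ^ e := by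
    rw [← Real.rpow_mul_natCast (by positivity), ← Real.rpow_natCast (n : ℝ) (r - 1),
      ← Real.rpow_add (by positivity), ← he2, ← pow_mul, ← Real.rpow_natCast]
    congr 1
    push_cast
    ring
  have h3 : (Real.log n ^ (1 / (((r + 1).choose 2 : ℝ) - 1))) ^ e = Real.log n := by
    rw [hch, ← Real.rpow_mul_natCast hL, one_div, inv_mul_cancel₀ he0, Real.rpow_one]
  rw [← hζa] at h2
  rw [mThreshold, thetaConst, ← hζ, mul_pow, mul_pow, mul_pow, h1, h3, ← hζa, mul_pow]
  calc _ = (((r : ℝ) - 1) / (2 * r)) ^ e * ((r : ℝ) ^ (r - 1) * ζ) *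
        (((n : ℝ) ^ ζ) ^ e * (n : ℝ) ^ (r - 1)) * Real.log n := by ring
    _ = _ := by rw [h2]; ring

/-- Above the threshold, a pair has more than `(2 - 2 / (r + 2)) * log n` expected copies. -/
lemma expected_copies_ge (hr : 2 ≤ r) {ε ε₁ η₁ γ p : ℝ} (hε : 0 < ε) (hε₁ : 0 < ε₁)
    (hε₁ε : 2 * ε₁ ≤ ε) (hε₁' : ε₁ ≤ 1 / 2)
    (hη₁ : η₁ = ε₁ / (8 * (r.choose 2 + (r - 1) : ℕ))) (hγ : γ = ε₁ / (4 * r ^ 2)) {n m k N : ℕ}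
    (hn : 1 ≤ n) (hm : (1 + ε) * mThreshold r n ≤ m) (hk : (1 / (r : ℝ) - γ) * n ≤ k)
    (hN : (N : ℝ) ≤ ((r : ℝ) - 1) / (2 * r) * n ^ 2) (hp : 0 ≤ p)
    (hpN : p * N = (1 - η₁) ^ 2 * m) :
    (1 + ε₁) * ((2 - 2 / ((r : ℝ) + 2)) * Real.log n) ≤
      (k : ℝ) ^ (r - 1) * p ^ (r.choose 2 + (r - 1)) := by
  have hr0 : (2 : ℝ) ≤ r := by exact_mod_cast hr
  have hn1 : (1 : ℝ) ≤ n := by exact_mod_cast hn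
  set e := r.choose 2 + (r - 1) with he
  have he1 : 1 ≤ e := by omega
  have he1' : (1 : ℝ) ≤ e := by exact_mod_cast he1
  have hT := mThreshold_pow hr hn
  rw [← he] at hT
  have hL : 0 ≤ Real.log n := Real.log_nonneg hn1
  have hT0 : 0 ≤ mThreshold r n := by
    have : (0 : ℝ) ≤ (r : ℝ) - 1 := by linarith
    unfold mThreshold thetaConst
    positivity
  set X := ((r : ℝ) - 1) / (2 * r) * (n : ℝ) ^ 2 with hX
  have hX0 : 0 < X := by
    have : (0 : ℝ) < (r : ℝ) - 1 := by linarith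
    positivity
  have ha0 : 0 ≤ 2 - 2 / ((r : ℝ) + 2) := by
    have : 2 / ((r : ℝ) + 2) ≤ 1 := by rw [div_le_one (by linarith)]; linarith
    linarith
  set Y := (2 - 2 / ((r : ℝ) + 2)) * Real.log n with hY
  have hY0 : 0 ≤ Y := by positivity
  have hη0 : 0 < η₁ := by rw [hη₁]; positivity
  have hη1 : η₁ ≤ 1 := by
    rw [hη₁, div_le_one (by positivity)]
    linarith
  have hb1 : 1 - ε₁ / 4 ≤ (1 - η₁) ^ (2 * e) := by
    have h := one_add_mul_le_pow (a := -η₁) (by linarith) (2 * e)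
    have e1 : ((2 * e : ℕ) : ℝ) * -η₁ = -(ε₁ / 4) := by
      rw [hη₁]; push_cast; field_simp; norm_num
    rw [e1] at h
    simpa [sub_eq_add_neg] using h
  have hrγ : r * γ ≤ 1 := by
    rw [hγ]
    have : r * (ε₁ / (4 * (r : ℝ) ^ 2)) = ε₁ / (4 * r) := by field_simp
    rw [this, div_le_one (by positivity)]
    linarith
  have hb2 : 1 - ε₁ / 4 ≤ (1 - r * γ) ^ (r - 1) := by
    have hγ0 : 0 < r * γ := by rw [hγ]; positivity
    have h := one_add_mul_le_pow (a := -(r * γ)) (by linarith) (r - 1)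
    have e1 : ((r - 1 : ℕ) : ℝ) * (r * γ) ≤ r * (r * γ) := by
      gcongr
      omega
    have e2 : r * (r * γ) = ε₁ / 4 := by rw [hγ]; field_simp
    rw [← sub_eq_add_neg] at h
    linarith
  have hb3 : 1 + 2 * ε₁ ≤ (1 + ε) ^ e := by
    calc 1 + 2 * ε₁ ≤ 1 + ε := by linarith
      _ ≤ (1 + ε) ^ e := le_self_pow₀ (by linarith) (by omega)
  -- compare the expected numbers of copies, multiplied by `X ^ e * r ^ (r - 1)`
  have hpX : (1 - η₁) ^ 2 * ((1 + ε) * mThreshold r n) ≤ p * X := by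
    calc (1 - η₁) ^ 2 * ((1 + ε) * mThreshold r n) ≤ (1 - η₁) ^ 2 * m := by gcongr
      _ = p * N := hpN.symm
      _ ≤ _ := by gcongr
  have hkn : (1 - r * γ) * n ≤ r * k := by
    calc (1 - r * γ) * n = r * ((1 / (r : ℝ) - γ) * n) := by field_simp
      _ ≤ _ := by gcongr
  have h1 : ((1 - η₁) ^ 2 * ((1 + ε) * mThreshold r n)) ^ e * ((1 - r * γ) * n) ^ (r - 1) ≤
      (p * X) ^ e * (r * k) ^ (r - 1) := by
    have h2 : 0 ≤ 1 - r * γ := by linarith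
    have h3 : 0 ≤ 1 - η₁ := by linarith
    gcongr
  have h2 : ((1 - η₁) ^ 2 * ((1 + ε) * mThreshold r n)) ^ e * ((1 - r * γ) * n) ^ (r - 1) =
      ((1 - η₁) ^ (2 * e) * (1 - r * γ) ^ (r - 1) * (1 + ε) ^ e) *
        (X ^ e * ((r : ℝ) ^ (r - 1) * Y)) := by
    rw [← hT, mul_pow, mul_pow, mul_pow, ← pow_mul]
    ring
  have h3 : (p * X) ^ e * (r * k) ^ (r - 1) =
      (X ^ e * (r : ℝ) ^ (r - 1)) * ((k : ℝ) ^ (r - 1) * p ^ e) := by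
    rw [mul_pow, mul_pow]; ring
  rw [h2, h3] at h1
  have h4 : 1 + ε₁ ≤ (1 - η₁) ^ (2 * e) * (1 - r * γ) ^ (r - 1) * (1 + ε) ^ e := by
    calc 1 + ε₁ ≤ (1 - ε₁ / 4) * (1 - ε₁ / 4) * (1 + 2 * ε₁) := by
          nlinarith [mul_nonneg hε₁.le (sub_nonneg.2 hε₁'), pow_pos hε₁ 3]
      _ ≤ _ := by
        have : 0 ≤ 1 - ε₁ / 4 := by linarith
        gcongr
  refine le_of_mul_le_mul_left (le_trans ?_ h1) (by positivity : 0 < X ^ e * (r : ℝ) ^ (r - 1))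
  calc X ^ e * (r : ℝ) ^ (r - 1) * ((1 + ε₁) * Y)
      = (1 + ε₁) * (X ^ e * ((r : ℝ) ^ (r - 1) * Y)) := by ring
    _ ≤ _ := by gcongr

end Threshold

/-! ### Conclusion -/

section Conclusion

variable {r : ℕ}

/-- The dense case: `card_dense_le` with `u` of order `n / (24 * r)`. -/
lemma card_badPairs_dense_le (hr : 2 ≤ r) {n m : ℕ} (hn : 24 * r ≤ n) {c : Fin n → Fin r}
    (hcl : ∀ j, n ≤ 2 * r * (colorClass c j).card) {δ : ℝ} (hδ : δ ≤ 1 / (8 * (48 * r) ^ 2))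
    (hm : (8 : ℝ) ^ (48 * r) * ((crossPairs c).card - m) ≤ m)
    (𝒢 : Finset (Finset (Sym2 (Fin n)) × Finset (Sym2 (Fin n))))
    (h𝒢 : ∀ x ∈ 𝒢, IsBadPair c m x.1 x.2 ∧ (x.1.card : ℝ) ≤ δ * m) :
    (𝒢.card : ℝ) ≤ (1 / 2) ^ n * (crossPairs c).card.choose m := by
  have hr0 : (2 : ℝ) ≤ r := by exact_mod_cast hr
  set u := n / (24 * r) with hu
  have hu1 : 1 ≤ u := (Nat.one_le_div_iff (by omega)).2 hn
  have hun : 24 * r * u ≤ n := Nat.mul_div_le n (24 * r)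
  have hnu : n ≤ 48 * r * u := by
    have h1 : n < 24 * r * u + 24 * r := by
      have h2 := Nat.div_add_mod n (24 * r)
      have h3 := Nat.mod_lt n (by omega : 0 < 24 * r)
      rw [← hu] at h2
      omega
    have h4 : 24 * r ≤ 24 * r * u := Nat.le_mul_of_pos_right _ hu1
    have h5 : 48 * r * u = 24 * r * u + 24 * r * u := by ring
    omega
  have hZ : (8 : ℝ) ^ n ≤ ((8 : ℝ) ^ (48 * r)) ^ u := by
    rw [← pow_mul]
    exact pow_le_pow_right₀ (by norm_num) hnu
  have hZbig : 8 * (48 * (r : ℝ)) ^ 2 ≤ 8 ^ (48 * r) := by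
    have h1 : (48 * r : ℝ) ≤ 2 ^ (48 * r) := by
      exact_mod_cast (Nat.lt_two_pow_self (n := 48 * r)).le
    have h2 : (8 : ℝ) ≤ 2 ^ (48 * r) := by
      calc (8 : ℝ) = 2 ^ 3 := by norm_num
        _ ≤ _ := pow_le_pow_right₀ (by norm_num) (by omega)
    calc 8 * (48 * (r : ℝ)) ^ 2 ≤ 2 ^ (48 * r) * (2 ^ (48 * r)) ^ 2 := by gcongr
      _ = ((2 : ℝ) ^ 3) ^ (48 * r) := by rw [← pow_mul, ← pow_mul]; ring
      _ = _ := by norm_num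
  have hcard := card_dense_le c (m := m) (u := u) hu1
    (fun j => by
      have h1 : 24 * r * u ≤ 2 * r * (colorClass c j).card := hun.trans (hcl j)
      have h2 : 2 * r * (12 * u) ≤ 2 * r * (colorClass c j).card := by
        calc 2 * r * (12 * u) = 24 * r * u := by ring
          _ ≤ _ := h1
      exact Nat.le_of_mul_le_mul_left h2 (by omega))
    (Z := 8 ^ (48 * r)) (one_le_pow₀ (by norm_num))
    (by rw [Fintype.card_fin]; exact hZ) hm 𝒢 fun x hx => by
      obtain ⟨h1, h2⟩ := h𝒢 x hx
      refine ⟨h1, ?_⟩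
      have h3 := Finset.card_sdiff_add_card_eq_card h1.subset_cross
      have h4 := h1.card_add
      have h5 : ((crossPairs c \ x.2).card : ℝ) + x.2.card = (crossPairs c).card := by
        exact_mod_cast h3
      have h6 : (x.1.card : ℝ) + x.2.card = m := by exact_mod_cast h4
      set b : ℝ := (48 * r) ^ 2 with hb
      have hb1 : 1 ≤ b := one_le_pow₀ (by linarith)
      have hδ' : δ * m ≤ m / (8 * b) := by
        calc δ * m ≤ 1 / (8 * b) * m := by gcongr
          _ = _ := by ring
      have hm2 : (m : ℝ) ≤ 2 * n ^ 2 := by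
        have h7 : (x.2.card : ℝ) ≤ n ^ 2 := by
          have := card_sym2_le x.2
          rw [Fintype.card_fin] at this
          exact_mod_cast this
        have h8 : (m : ℝ) / (8 * b) ≤ m / 2 := by
          gcongr
          linarith
        linarith
      have hmis : ((crossPairs c).card : ℝ) - m ≤ m / (8 * b) := by
        rw [le_div_iff₀ (by positivity)]
        rcases le_total ((crossPairs c).card - m : ℝ) 0 with h | h
        · exact (mul_nonpos_of_nonpos_of_nonneg h (by positivity)).trans (by positivity)
        · calc _ ≤ ((crossPairs c).card - m : ℝ) * 8 ^ (48 * r) := by gcongr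
            _ ≤ m := by rwa [mul_comm]
      have h9 : ((crossPairs c \ x.2).card : ℝ) < (u : ℝ) ^ 2 := by
        have h10 : (n : ℝ) ^ 2 ≤ b * u ^ 2 := by
          rw [hb, ← mul_pow]
          gcongr
          exact_mod_cast hnu
        have h11 : (m : ℝ) / (8 * b) ≤ (u : ℝ) ^ 2 / 4 := by
          rw [div_le_iff₀ (by positivity)]
          nlinarith
        have h12 : (0 : ℝ) < (u : ℝ) ^ 2 := by positivity
        linarith
      exact_mod_cast h9
  rwa [Fintype.card_fin] at hcard

/-- For large `n` the graphs that are not properly coloured are rare: the dense and the sparse case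
together. In the sparse case the density `p` is `m / N`, reduced by a constant factor near `1`. -/
lemma eventually_card_badPairs_le (hr : 2 ≤ r) {ε ε₁ : ℝ} (hε : 0 < ε) (hε₁ : 0 < ε₁)
    (hε₁ε : 2 * ε₁ ≤ ε) (hε₁' : ε₁ ≤ 1 / 2) :
    ∃ δ : ℝ, 0 < δ ∧ ∃ A : ℝ, 0 < A ∧ ∀ᶠ n : ℕ in atTop, ∀ (m : ℕ) (c : Fin n → Fin r),
      (1 + ε) * mThreshold r n ≤ m → IsBalanced (ε₁ / (4 * r ^ 2)) c →
      ∀ 𝒢 : Finset (Finset (Sym2 (Fin n)) × Finset (Sym2 (Fin n))),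
        (∀ x ∈ 𝒢, IsBadPair c m x.1 x.2 ∧ (x.1.card : ℝ) ≤ δ * m) →
        (𝒢.card : ℝ) ≤ A * Real.exp (-(ε₁ / 8 * Real.log n)) * (crossPairs c).card.choose m := by
  have hr0 : (2 : ℝ) ≤ r := by exact_mod_cast hr
  set η₁ : ℝ := ε₁ / (8 * (r.choose 2 + (r - 1) : ℕ)) with hη₁
  have he1 : (1 : ℝ) ≤ (r.choose 2 + (r - 1) : ℕ) := by
    exact_mod_cast (by omega : 1 ≤ r.choose 2 + (r - 1))
  have hη0 : 0 < η₁ := by positivity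
  have hη1 : η₁ ≤ 1 / 2 := by
    rw [hη₁, div_le_iff₀ (by positivity)]
    linarith
  set Z : ℝ := 8 ^ (48 * r) with hZ
  have hZ1 : 1 ≤ Z := one_le_pow₀ (by norm_num)
  obtain ⟨δ, hδ, A, hA, hsparse⟩ := eventually_card_sparse_le hr (C := 4 * (1 + Z)) (by linarith)
    hε₁ hε₁' hη0 hη1
  set γ : ℝ := ε₁ / (4 * r ^ 2) with hγ
  have hγr : γ ≤ 1 / (2 * r) := by
    rw [hγ, div_le_div_iff₀ (by positivity) (by positivity)]
    nlinarith
  refine ⟨min δ (1 / (8 * (48 * r) ^ 2)), by positivity, A + 1, by positivity, ?_⟩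
  filter_upwards [hsparse, eventually_ge_atTop (24 * r)] with n Hsparse hn m c hm hbal 𝒢 h𝒢
  have hn1 : (1 : ℝ) ≤ n := by exact_mod_cast (by omega : 1 ≤ n)
  have hn0 : (0 : ℝ) < n := by linarith
  have hcl : ∀ j, (1 / (r : ℝ) - γ) * n ≤ (colorClass c j).card := fun j => by
    rw [← ncard_color_eq]
    exact (hbal j).1
  set k := ⌈(1 / (r : ℝ) - γ) * n⌉₊ with hk
  have hk1 : (1 / (r : ℝ) - γ) * n ≤ k := Nat.le_ceil _
  have hkc : ∀ j, k ≤ (colorClass c j).card := fun j => Nat.ceil_le.2 (hcl j)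
  have hkn : k ≤ n := by
    have h0 : 0 < r := by omega
    refine (hkc ⟨0, h0⟩).trans ((Finset.card_le_univ _).trans ?_)
    rw [Fintype.card_fin]
  have hnk : (n : ℝ) ≤ 2 * r * k := by
    calc (n : ℝ) = 2 * r * (1 / (2 * r) * n) := by field_simp
      _ ≤ 2 * r * ((1 / (r : ℝ) - γ) * n) := by
          gcongr
          have : 1 / (r : ℝ) = 1 / (2 * r) + 1 / (2 * r) := by field_simp; norm_num
          linarith
      _ ≤ _ := by gcongr
  have hexp : 0 ≤ Real.exp (-(ε₁ / 8 * Real.log n)) := (Real.exp_pos _).le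
  by_cases hdense : Z * ((crossPairs c).card - m) ≤ m
  · have h1 := card_badPairs_dense_le hr hn
      (fun j => by
        have : (n : ℝ) ≤ 2 * r * (colorClass c j).card := hnk.trans (by
          gcongr
          exact hkc j)
        exact_mod_cast this) (min_le_right _ _) hdense 𝒢 h𝒢
    refine h1.trans (mul_le_mul_of_nonneg_right ?_ (Nat.cast_nonneg _))
    have h2 : (1 / 2 : ℝ) ^ n ≤ Real.exp (-(ε₁ / 8 * Real.log n)) := by
      calc (1 / 2 : ℝ) ^ n = ((2 : ℝ) ^ n)⁻¹ := by rw [one_div, inv_pow]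
        _ ≤ (n : ℝ)⁻¹ := by
            gcongr
            exact_mod_cast Nat.lt_two_pow_self.le
        _ = Real.exp (-Real.log n) := by rw [Real.exp_neg, Real.exp_log hn0]
        _ ≤ _ := by
            apply Real.exp_le_exp.2
            have := Real.log_nonneg hn1
            nlinarith
    linarith [mul_nonneg hA.le hexp]
  · rcases 𝒢.eq_empty_or_nonempty with rfl | ⟨x₀, hx₀⟩
    · simp only [Finset.card_empty, Nat.cast_zero]; positivity
    have hm0 : (0 : ℝ) < m := by
      have h1 := (h𝒢 x₀ hx₀).1
      have h2 := h1.card_add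
      have h3 := h1.nonempty.card_pos
      exact_mod_cast (by omega : 0 < m)
    rw [not_le] at hdense
    have hmN : (m : ℝ) < (crossPairs c).card := by
      by_contra! h
      have : Z * ((crossPairs c).card - m) ≤ 0 :=
        mul_nonpos_of_nonneg_of_nonpos (by linarith) (by linarith)
      linarith
    have hN0 : (0 : ℝ) < (crossPairs c).card := hm0.trans hmN
    set p : ℝ := (1 - η₁) ^ 2 * m / (crossPairs c).card with hp
    have hη2 : 0 < 1 - η₁ := by linarith
    have hp0 : 0 < p := by positivity
    have hpN : p * (crossPairs c).card = (1 - η₁) ^ 2 * m := div_mul_cancel₀ _ hN0.ne'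
    have hp1 : p ≤ 1 := by
      rw [hp, div_le_one hN0]
      have : (1 - η₁) ^ 2 ≤ 1 := pow_le_one₀ hη2.le (by linarith)
      nlinarith
    have hw : (m : ℝ) / ((crossPairs c).card - m) ≤ 4 * (1 + Z) * p := by
      rw [div_le_iff₀ (by linarith), hp]
      have h1 : (1 / 2 : ℝ) ^ 2 ≤ (1 - η₁) ^ 2 := by gcongr; linarith
      have h2 : ((crossPairs c).card : ℝ) ≤ (1 + Z) * ((crossPairs c).card - m) := by linarith
      have h3 : (m : ℝ) * (crossPairs c).card ≤
          (4 * (1 - η₁) ^ 2) * m * ((1 + Z) * ((crossPairs c).card - m)) := by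
        have h4 : (1 : ℝ) ≤ 4 * (1 - η₁) ^ 2 := by linarith
        have h5 : (m : ℝ) ≤ (4 * (1 - η₁) ^ 2) * m := le_mul_of_one_le_left hm0.le h4
        exact mul_le_mul h5 h2 hN0.le (by positivity)
      rw [← mul_div_assoc, div_mul_eq_mul_div, le_div_iff₀ hN0]
      linarith
    have h1 := Hsparse c m k p (by exact_mod_cast hmN) hp0 hp1 hpN hw hkc hnk hkn
      (expected_copies_ge hr hε hε₁ hε₁ε hε₁' hη₁ hγ (by omega) hm hk1
        (card_crossPairs_le (by omega) c) hp0.le hpN) 𝒢 fun x hx =>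
          ⟨(h𝒢 x hx).1, (h𝒢 x hx).2.trans (by gcongr; exact min_le_left _ _)⟩
    refine h1.trans (mul_le_mul_of_nonneg_right ?_ (Nat.cast_nonneg _))
    exact mul_le_mul_of_nonneg_right (by linarith) hexp

end Conclusion

theorem theorem5p3 (r : ℕ) (hr : 2 ≤ r) (ε : ℝ) (hε : 0 < ε) :
    ∃ γ : ℝ, 0 < γ ∧ ∃ ω : ℕ → ℝ, (∀ n, 0 < ω n) ∧ Tendsto ω atTop atTop ∧
      ∃ δ₀ : ℝ, 0 < δ₀ ∧ ∀ δ : ℝ, 0 < δ → δ ≤ δ₀ →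
        ∀ n m : ℕ, (1 + ε) * mThreshold r n ≤ (m : ℝ) →
          ∀ c : Fin n → Fin r, IsBalanced γ c →
            ((starFamilyOfPartition m δ γ c).ncard : ℝ) ≤
              1 / ω n * ((numEdges (partitionGraph c)).choose m : ℝ) := by
  set ε₁ : ℝ := min ε 1 / 2 with hε₁
  have hε₁0 : 0 < ε₁ := by positivity
  have hr0 : (0 : ℝ) < r := by exact_mod_cast (by omega : 0 < r)
  obtain ⟨δ, hδ, A, hA, hev⟩ := eventually_card_badPairs_le hr hε hε₁0
    (by linarith [min_le_left ε 1]) (by linarith [min_le_right ε 1])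
  obtain ⟨n₀, hn₀⟩ := eventually_atTop.1 hev
  refine ⟨ε₁ / (4 * r ^ 2), by positivity, fun n => Real.exp (ε₁ / 8 * Real.log n) / A,
    fun n => by positivity, ?_, min δ (1 / ((n₀ : ℝ) ^ 2 + 1)), by positivity, ?_⟩
  · refine Tendsto.atTop_div_const hA (Real.tendsto_exp_atTop.comp ?_)
    exact (Real.tendsto_log_atTop.comp tendsto_natCast_atTop_atTop).const_mul_atTop (by positivity)
  intro δ' hδ' hδ'le n m hm c hc
  obtain ⟨𝒢, hcard, h𝒢⟩ := exists_pairs_of_starFamily m δ' (ε₁ / (4 * r ^ 2)) c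
  rw [hcard, numEdges_eq, edgePairs_partitionGraph]
  rcases le_or_gt n₀ n with hn | hn
  · have h1 := hn₀ n hn m c hm hc 𝒢 fun x hx => ⟨(h𝒢 x hx).1, (h𝒢 x hx).2.trans (by
      gcongr
      exact hδ'le.trans (min_le_left _ _))⟩
    refine h1.trans (le_of_eq ?_)
    dsimp only
    rw [Real.exp_neg, one_div_div, ← div_eq_mul_inv]
  · -- a graph on few vertices has fewer than `1 / δ'` edges, so at most `δ' * m` of them means none
    rcases 𝒢.eq_empty_or_nonempty with rfl | ⟨x, hx⟩
    · simp only [Finset.card_empty, Nat.cast_zero]; positivity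
    exfalso
    obtain ⟨h1, h2⟩ := h𝒢 x hx
    have h3 : (1 : ℝ) ≤ x.1.card := by exact_mod_cast h1.nonempty.card_pos
    have hdisj : Disjoint x.1 x.2 := by
      rw [Finset.disjoint_left]
      intro e he he'
      exact (Finset.mem_filter.1 (h1.subset_cross he')).2
        (Finset.mem_filter.1 (h1.subset_mono he)).2.2
    have h4 : m ≤ n ^ 2 := by
      rw [← h1.card_add, ← Finset.card_union_of_disjoint hdisj]
      have := card_sym2_le (x.1 ∪ x.2)
      rwa [Fintype.card_fin] at this
    have h5 : (m : ℝ) < (n₀ : ℝ) ^ 2 + 1 := by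
      have h6 : n ^ 2 ≤ n₀ ^ 2 := Nat.pow_le_pow_left hn.le 2
      have : m < n₀ ^ 2 + 1 := by omega
      exact_mod_cast this
    have h6 : δ' * m < 1 := by
      calc δ' * m ≤ 1 / ((n₀ : ℝ) ^ 2 + 1) * m := by
            gcongr
            exact hδ'le.trans (min_le_right _ _)
        _ < 1 := by
            rw [div_mul_eq_mul_div, one_mul, div_lt_one (by positivity)]
            exact h5
    linarith
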